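/- For $N\in\mathbb{N}=\{1,2,3,\dots\}$ let $$\widehat S_N=\begin{pmatrix}0&0&0&0&1\\0&0&0&1&0\\0&0&-2N&0&0\\0&1&0&0&0\\1&0&0&0&0\end{pmatrix},$$ let $SO(\widehat S_N;\mathbb{R})=\{M\in SL_5(\mathbb{R}) : M'\widehat S_N M=\widehat S_N\}$ (where $M'$ is the transpose), and let $SO_0(\widehat S_N;\mathbb{R})$ be its connected component of the identity. Let $\widehat\Gamma_N=SO_0(\widehat S_N;\mathbb{Z})$ and $\widehat{\mathcal G}_N=SO_0(\widehat S_N;\mathbb{Q})$ be the groups of integral, respectively rational, matrices in $SO_0(\widehat S_N;\mathbb{R})$, and for a prime $p$ let $\widehat{\mathcal G}_{N,p}$ be the subgroup of all matrices in $\widehat{\mathcal G}_N$ of the form $p^{-r}M$ with $M$ integral and $r\ge 0$. For a Hecke pair $(U,G)$ (that is, $U$ is a subgroup of the group $G$ and each double coset $UgU$, $g\in G$, is a finite union of right cosets $Uh$) let $\mathcal H(U,G)$ be the Hecke algebra over $\mathbb{Z}$: the $U$-invariant elements (under right multiplication) of the free $\mathbb{Z}$-module on the right cosets $Uh$, with the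 product $\sum_i a_i\,Ug_i\cdot\sum_j b_j\,Uh_j=\sum_{i,j}a_ib_j\,Ug_ih_j$; a double coset is identified with the sum of the right cosets contained in it. The pairs $(\widehat\Gamma_N,\widehat{\mathcal G}_N)$ and $(\widehat\Gamma_N,\widehat{\mathcal G}_{N,p})$ are Hecke pairs. Put $$T_{N,1}(p)=\widehat\Gamma_N\,\tfrac1p\,\mathrm{diag}(1,p,p,p,p^2)\,\widehat\Gamma_N,\qquad T_{N,2}(p)=\widehat\Gamma_N\,\tfrac1p\,\mathrm{diag}(1,1,p,p^2,p^2)\,\widehat\Gamma_N.$$ **Theorem 3.** Let $N\in\mathbb{N}$ be squarefree. (i) For every prime $p$ the primary component $\mathcal H(\widehat\Gamma_N,\widehat{\mathcal G}_{N,p})$ is the ring of all polynomials over $\mathbb{Z}$ in $T_{N,1}(p)$ and $T_{N,2}(p)$, and these two elements are algebraically independent; that is, there is a ring isomorphism $\mathbb{Z}[X_1,X_2]\to\mathcal H(\widehat\Gamma_N,\widehat{\mathcal G}_{N,p})$ with $X_1\mapsto T_{N,1}(p)$ and $X_2\mapsto T_{N,2}(p)$. (ii) The Hecke algebra $\mathcal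 H(\widehat\Gamma_N,\widehat{\mathcal G}_N)$ has no zero-divisors. -/

import Mathlib

/-! ### The Hecke algebra over `ℤ` of a pair `(U, G)` -/

namespace HeckeSO

section Abstract

variable {G : Type*} [Group G]

/-- The set `U \ G` of right cosets `U h`, `h ∈ G`. -/
abbrev RightCosets (U : Subgroup G) : Type _ := Quotient (QuotientGroup.rightRel U)

/-- The right coset `U g`. -/
def coset (U : Subgroup G) (g : G) : RightCosets U := Quotient.mk (QuotientGroup.rightRel U) g

/-- The set of right cosets contained in the double coset `U g U`. -/
def cosetsIn (U : Subgroup G) (g : G) : Set (RightCosets U) :=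
  {c | ∃ x ∈ DoubleCoset.doubleCoset g (U : Set G) (U : Set G), coset U x = c}

/-- `(U, G)` is a Hecke pair: each double coset `U g U` consists of finitely many right cosets. -/
def IsHeckePair (U : Subgroup G) : Prop := ∀ g : G, (cosetsIn U g).Finite

theorem coset_eq_iff {U : Subgroup G} {g h : G} : coset U g = coset U h ↔ h * g⁻¹ ∈ U := by
  unfold coset
  rw [Quotient.eq]
  exact QuotientGroup.rightRel_apply

theorem coset_mul_left {U : Subgroup G} {u : G} (hu : u ∈ U) (g : G) :
    coset U (u * g) = coset U g := by
  rw [coset_eq_iff]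
  simpa using hu

/-- The right translation `U x ↦ U x g` on right cosets. -/
def translate (U : Subgroup G) (g : G) : RightCosets U → RightCosets U :=
  Quotient.map (fun x => x * g) (by
    intro a b hab
    have h : b * a⁻¹ ∈ U := QuotientGroup.rightRel_apply.1 hab
    refine QuotientGroup.rightRel_apply.2 ?_
    simpa [mul_assoc] using h)

theorem translate_coset (U : Subgroup G) (g x : G) :
    translate U g (coset U x) = coset U (x * g) := rfl

theorem translate_translate (U : Subgroup G) (g h : G) (c : RightCosets U) :
    translate U h (translate U g c) = translate U (g * h) c := by
  induction c using Quotient.inductionOn with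
  | h x => exact congrArg (coset U) (mul_assoc x g h)

theorem translate_one (U : Subgroup G) (c : RightCosets U) : translate U 1 c = c := by
  induction c using Quotient.inductionOn with
  | h x => exact congrArg (coset U) (mul_one x)

/-- Right translation by `g` on the free `ℤ`-module over the right cosets. -/
noncomputable def chainTranslate (U : Subgroup G) (g : G) :
    (RightCosets U →₀ ℤ) →ₗ[ℤ] (RightCosets U →₀ ℤ) :=
  Finsupp.lmapDomain ℤ ℤ (translate U g)

theorem chainTranslate_single (U : Subgroup G) (g : G) (c : RightCosets U) (a : ℤ) :
    chainTranslate U g (Finsupp.single c a) = Finsupp.single (translate U g c) a := by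
  simp [chainTranslate, Finsupp.mapDomain_single]

theorem chainTranslate_mul (U : Subgroup G) (g h : G) (x : RightCosets U →₀ ℤ) :
    chainTranslate U (g * h) x = chainTranslate U h (chainTranslate U g x) := by
  induction x using Finsupp.induction_linear with
  | zero => simp
  | add x y hx hy => simp only [map_add, hx, hy]
  | single c a => simp only [chainTranslate_single, translate_translate]

theorem chainTranslate_one (U : Subgroup G) (x : RightCosets U →₀ ℤ) :
    chainTranslate U 1 x = x := by
  induction x using Finsupp.induction_linear with
  | zero => simp
  | add x y hx hy => simp only [map_add, hx, hy]
  | single c a => simp only [chainTranslate_single, translate_one]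

/-- The elements of the free `ℤ`-module over the right cosets `U h` that are invariant under right
multiplication by `U`. -/
def invariants (U : Subgroup G) : AddSubgroup (RightCosets U →₀ ℤ) where
  carrier := {x | ∀ u ∈ U, chainTranslate U u x = x}
  zero_mem' := by intro u _; simp
  add_mem' := by
    intro x y hx hy u hu
    rw [map_add, hx u hu, hy u hu]
  neg_mem' := by
    intro x hx u hu
    rw [map_neg, hx u hu]

/-- The product `(∑ aᵢ U gᵢ) (∑ bⱼ U hⱼ) = ∑ aᵢ bⱼ U gᵢ hⱼ`. The representative `hⱼ = d.out` of the
right coset `d` is arbitrary: its choice does not matter when the left factor is invariant. -/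
noncomputable def chainMul (U : Subgroup G) (x y : RightCosets U →₀ ℤ) : RightCosets U →₀ ℤ :=
  x.sum fun c a => y.sum fun d b => Finsupp.single (translate U d.out c) (a * b)

/-- Left multiplication by `x` as a linear map. -/
noncomputable def chainMulLin (U : Subgroup G) (x : RightCosets U →₀ ℤ) :
    (RightCosets U →₀ ℤ) →ₗ[ℤ] (RightCosets U →₀ ℤ) :=
  Finsupp.linearCombination ℤ fun d => chainTranslate U d.out x

theorem chainMul_eq (U : Subgroup G) (x y : RightCosets U →₀ ℤ) :
    chainMul U x y = chainMulLin U x y := by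
  unfold chainMul chainMulLin
  rw [Finsupp.sum_comm, Finsupp.linearCombination_apply]
  refine Finsupp.sum_congr fun d _ => ?_
  rw [chainTranslate, Finsupp.lmapDomain_apply, Finsupp.mapDomain, Finsupp.smul_sum]
  refine Finsupp.sum_congr fun c _ => ?_
  rw [Finsupp.smul_single, smul_eq_mul, mul_comm]

theorem chainMulLin_add (U : Subgroup G) (x x' y : RightCosets U →₀ ℤ) :
    chainMulLin U (x + x') y = chainMulLin U x y + chainMulLin U x' y := by
  induction y using Finsupp.induction_linear with
  | zero => simp
  | add y z hy hz => rw [map_add, map_add, map_add, hy, hz]; abel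
  | single c a => simp [chainMulLin, Finsupp.linearCombination_single]

theorem chainMulLin_single {U : Subgroup G} {x : RightCosets U →₀ ℤ} (hx : x ∈ invariants U)
    (h : G) (b : ℤ) :
    chainMulLin U x (Finsupp.single (coset U h) b) = b • chainTranslate U h x := by
  have h1 : coset U (coset U h).out = coset U h := Quotient.out_eq _
  have h2 : (coset U h).out * h⁻¹ ∈ U := coset_eq_iff.1 h1.symm
  have h3 : (coset U h).out = ((coset U h).out * h⁻¹) * h := by simp
  rw [chainMulLin, Finsupp.linearCombination_single, h3, chainTranslate_mul, hx _ h2]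

theorem chainMulLin_translate {U : Subgroup G} {x : RightCosets U →₀ ℤ} (hx : x ∈ invariants U)
    (g : G) (y : RightCosets U →₀ ℤ) :
    chainMulLin U x (chainTranslate U g y) = chainTranslate U g (chainMulLin U x y) := by
  induction y using Finsupp.induction_linear with
  | zero => simp
  | add y z hy hz => simp only [map_add, hy, hz]
  | single c a =>
    induction c using Quotient.inductionOn with
    | h k =>
      change chainMulLin U x (chainTranslate U g (Finsupp.single (coset U k) a)) =
        chainTranslate U g (chainMulLin U x (Finsupp.single (coset U k) a))
      rw [chainTranslate_single, translate_coset, chainMulLin_single hx, chainMulLin_single hx,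
        map_smul, chainTranslate_mul]

theorem chainMulLin_mem {U : Subgroup G} {x y : RightCosets U →₀ ℤ} (hx : x ∈ invariants U)
    (hy : y ∈ invariants U) : chainMulLin U x y ∈ invariants U := by
  intro u hu
  rw [← chainMulLin_translate hx, hy u hu]

theorem chainMulLin_assoc {U : Subgroup G} {x y : RightCosets U →₀ ℤ} (hx : x ∈ invariants U)
    (hy : y ∈ invariants U) (z : RightCosets U →₀ ℤ) :
    chainMulLin U (chainMulLin U x y) z = chainMulLin U x (chainMulLin U y z) := by
  induction z using Finsupp.induction_linear with
  | zero => simp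
  | add z w hz hw => simp only [map_add, hz, hw]
  | single c a =>
    induction c using Quotient.inductionOn with
    | h k =>
      change chainMulLin U (chainMulLin U x y) (Finsupp.single (coset U k) a) =
        chainMulLin U x (chainMulLin U y (Finsupp.single (coset U k) a))
      rw [chainMulLin_single (chainMulLin_mem hx hy), chainMulLin_single hy, map_smul,
        chainMulLin_translate hx]

theorem one_mem_invariants (U : Subgroup G) :
    Finsupp.single (coset U 1) (1 : ℤ) ∈ invariants U := by
  intro u hu
  rw [chainTranslate_single, translate_coset, one_mul]
  congr 1
  simpa using coset_mul_left hu (1 : G)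

theorem chainMulLin_one {U : Subgroup G} {x : RightCosets U →₀ ℤ} (hx : x ∈ invariants U) :
    chainMulLin U x (Finsupp.single (coset U 1) 1) = x := by
  rw [chainMulLin_single hx, one_smul, chainTranslate_one]

theorem one_chainMulLin (U : Subgroup G) (y : RightCosets U →₀ ℤ) :
    chainMulLin U (Finsupp.single (coset U 1) 1) y = y := by
  induction y using Finsupp.induction_linear with
  | zero => simp
  | add z w hz hw => simp only [map_add, hz, hw]
  | single c a =>
    induction c using Quotient.inductionOn with
    | h k =>
      change chainMulLin U _ (Finsupp.single (coset U k) a) = Finsupp.single (coset U k) a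
      rw [chainMulLin_single (one_mem_invariants U), chainTranslate_single, translate_coset]
      simp

/-- The Hecke algebra `H(U, G)` over `ℤ`, for `U` a subgroup of the group `G`. For a Hecke pair,
a double coset `U g U` is identified with the sum of the right cosets it consists of, and these
sums form a `ℤ`-basis of the `U`-invariant chains of right cosets. -/
def HeckeAlgebra (U : Subgroup G) : Type _ := invariants U

noncomputable instance (U : Subgroup G) : AddCommGroup (HeckeAlgebra U) :=
  inferInstanceAs (AddCommGroup (invariants U))

noncomputable instance (U : Subgroup G) : Mul (HeckeAlgebra U) :=
  ⟨fun x y => ⟨chainMul U x.1 y.1, by rw [chainMul_eq]; exact chainMulLin_mem x.2 y.2⟩⟩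

noncomputable instance (U : Subgroup G) : One (HeckeAlgebra U) :=
  ⟨⟨Finsupp.single (coset U 1) 1, one_mem_invariants U⟩⟩

theorem val_mul {U : Subgroup G} (x y : HeckeAlgebra U) :
    (x * y).1 = chainMulLin U x.1 y.1 := chainMul_eq U x.1 y.1

theorem val_add {U : Subgroup G} (x y : HeckeAlgebra U) : (x + y).1 = x.1 + y.1 := rfl

theorem val_zero {U : Subgroup G} : (0 : HeckeAlgebra U).1 = 0 := rfl

theorem val_one {U : Subgroup G} :
    (1 : HeckeAlgebra U).1 = Finsupp.single (coset U 1) 1 := rfl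

noncomputable instance (U : Subgroup G) : Ring (HeckeAlgebra U) :=
  { (inferInstance : AddCommGroup (HeckeAlgebra U)) with
    mul := (· * ·)
    one := 1
    left_distrib := fun x y z => Subtype.ext (by simp only [val_mul, val_add, map_add])
    right_distrib := fun x y z => Subtype.ext (by
      simp only [val_mul, val_add, chainMulLin_add])
    zero_mul := fun x => Subtype.ext (by
      have h := chainMulLin_add U 0 0 x.1
      rw [val_mul, val_zero]
      simpa using h)
    mul_zero := fun x => Subtype.ext (by rw [val_mul, val_zero, map_zero])
    mul_assoc := fun x y z => Subtype.ext (by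
      simp only [val_mul]
      exact chainMulLin_assoc x.2 y.2 z.1)
    one_mul := fun x => Subtype.ext (by rw [val_mul, val_one, one_chainMulLin])
    mul_one := fun x => Subtype.ext (by rw [val_mul, val_one, chainMulLin_one x.2]) }

theorem translate_mem_cosetsIn {U : Subgroup G} {g u : G} (hu : u ∈ U) (c : RightCosets U) :
    translate U u c ∈ cosetsIn U g ↔ c ∈ cosetsIn U g := by
  have key : ∀ u ∈ U, ∀ c ∈ cosetsIn U g, translate U u c ∈ cosetsIn U g := by
    rintro u hu c ⟨x, hx, rfl⟩
    obtain ⟨a, ha, b, hb, rfl⟩ := DoubleCoset.mem_doubleCoset.1 hx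
    exact ⟨a * g * b * u, DoubleCoset.mem_doubleCoset.2
      ⟨a, ha, b * u, U.mul_mem hb hu, by group⟩, rfl⟩
  refine ⟨fun h => ?_, key u hu c⟩
  have h' := key u⁻¹ (U.inv_mem hu) _ h
  rwa [translate_translate, mul_inv_cancel, translate_one] at h'

/-- The double coset `U g U` as an element of the Hecke algebra: the sum of the right cosets
contained in it. -/
noncomputable def doubleCosetElement {U : Subgroup G} (hU : IsHeckePair U) (g : G) :
    HeckeAlgebra U :=
  ⟨Finsupp.indicator (hU g).toFinset fun _ _ => 1, by
    intro u hu
    have hinj : Function.Injective (translate U u) := by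
      intro c d hcd
      have := congrArg (translate U u⁻¹) hcd
      simpa [translate_translate, translate_one] using this
    ext c
    obtain ⟨d, rfl⟩ : ∃ d, translate U u d = c :=
      ⟨translate U u⁻¹ c, by simp [translate_translate, translate_one]⟩
    rw [chainTranslate, Finsupp.lmapDomain_apply, Finsupp.mapDomain_apply hinj]
    classical
    simp only [Finsupp.indicator_apply, Set.Finite.mem_toFinset, translate_mem_cosetsIn hu]⟩

end Abstract

/-! ### The orthogonal groups -/

section Orthogonal

open Matrix

/-- The symmetric matrix `Ŝ_N` of signature `(2, 3)`. -/
def Shat (N : ℕ) : Matrix (Fin 5) (Fin 5) ℝ :=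
  !![0, 0, 0, 0, 1;
     0, 0, 0, 1, 0;
     0, 0, -2 * (N : ℝ), 0, 0;
     0, 1, 0, 0, 0;
     1, 0, 0, 0, 0]

/-- `SO(Ŝ_N; ℝ)`, the matrices `M ∈ SL₅(ℝ)` with `Mᵀ Ŝ_N M = Ŝ_N`. -/
def SOReal (N : ℕ) : Subgroup (Matrix.SpecialLinearGroup (Fin 5) ℝ) where
  carrier := {M | (M : Matrix (Fin 5) (Fin 5) ℝ)ᵀ * Shat N * (M : Matrix (Fin 5) (Fin 5) ℝ)
    = Shat N}
  one_mem' := by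
    change (1 : Matrix (Fin 5) (Fin 5) ℝ)ᵀ * Shat N * 1 = Shat N
    simp
  mul_mem' := by
    intro A B hA hB
    change A.1ᵀ * Shat N * A.1 = Shat N at hA
    change B.1ᵀ * Shat N * B.1 = Shat N at hB
    change (A.1 * B.1)ᵀ * Shat N * (A.1 * B.1) = Shat N
    calc (A.1 * B.1)ᵀ * Shat N * (A.1 * B.1)
        = B.1ᵀ * (A.1ᵀ * Shat N * A.1) * B.1 := by
          rw [transpose_mul]; simp only [Matrix.mul_assoc]
      _ = Shat N := by rw [hA, hB]
  inv_mem' := by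
    intro A hA
    change A.1ᵀ * Shat N * A.1 = Shat N at hA
    change (A⁻¹).1ᵀ * Shat N * (A⁻¹).1 = Shat N
    have h1 : A.1 * (A⁻¹).1 = 1 := congrArg Subtype.val (mul_inv_cancel A)
    have h2 : (A⁻¹).1ᵀ * A.1ᵀ = 1 := by rw [← transpose_mul, h1, transpose_one]
    calc (A⁻¹).1ᵀ * Shat N * (A⁻¹).1
        = (A⁻¹).1ᵀ * (A.1ᵀ * Shat N * A.1) * (A⁻¹).1 := by rw [hA]
      _ = ((A⁻¹).1ᵀ * A.1ᵀ) * Shat N * (A.1 * (A⁻¹).1) := by simp only [Matrix.mul_assoc]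
      _ = Shat N := by rw [h1, h2, Matrix.one_mul, Matrix.mul_one]

/-- `SO₀(Ŝ_N; ℝ)`, the connected component of the identity in `SO(Ŝ_N; ℝ)`. -/
def SO0Real (N : ℕ) : Subgroup (Matrix.SpecialLinearGroup (Fin 5) ℝ) :=
  (Subgroup.connectedComponentOfOne (SOReal N)).map (SOReal N).subtype

/-- `Ĝ_N = SO₀(Ŝ_N; ℚ)`, the rational matrices in `SO₀(Ŝ_N; ℝ)`. -/
noncomputable def GHat (N : ℕ) : Subgroup (Matrix.SpecialLinearGroup (Fin 5) ℚ) :=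
  (SO0Real N).comap (Matrix.SpecialLinearGroup.map (algebraMap ℚ ℝ))

/-- `Γ̂_N = SO₀(Ŝ_N; ℤ)`, the integral matrices in `SO₀(Ŝ_N; ℝ)`, inside `Ĝ_N`. -/
noncomputable def GammaHat (N : ℕ) : Subgroup (Matrix.SpecialLinearGroup (Fin 5) ℚ) :=
  GHat N ⊓ (Matrix.SpecialLinearGroup.map (n := Fin 5) (Int.castRingHom ℚ)).range

/-- `Ĝ_{N,p}`, the matrices `p⁻ʳ M` in `Ĝ_N` with `M` integral and `r ≥ 0`. -/
noncomputable def GHatPrimary (N p : ℕ) : Subgroup (Matrix.SpecialLinearGroup (Fin 5) ℚ) where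
  carrier := {g | g ∈ GHat N ∧ ∃ (r : ℕ) (M : Matrix (Fin 5) (Fin 5) ℤ),
    (g : Matrix (Fin 5) (Fin 5) ℚ) = ((p : ℚ) ^ r)⁻¹ • M.map (Int.cast : ℤ → ℚ)}
  one_mem' := ⟨(GHat N).one_mem, 0, 1, by simp⟩
  mul_mem' := by
    rintro a b ⟨ha, r, A, hA⟩ ⟨hb, s, B, hB⟩
    refine ⟨(GHat N).mul_mem ha hb, r + s, A * B, ?_⟩
    have h : (A * B).map (Int.cast : ℤ → ℚ) = A.map (Int.cast : ℤ → ℚ) * B.map Int.cast :=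
      Matrix.map_mul (f := Int.castRingHom ℚ)
    change a.1 * b.1 = _
    rw [hA, hB, h, smul_mul_smul_comm, pow_add, mul_inv]
  inv_mem' := by
    rintro a ⟨ha, r, A, hA⟩
    refine ⟨(GHat N).inv_mem ha, r * 4, A.adjugate, ?_⟩
    have h : A.adjugate.map (Int.cast : ℤ → ℚ) = (A.map (Int.cast : ℤ → ℚ)).adjugate :=
      RingHom.map_adjugate (Int.castRingHom ℚ) A
    change a.1.adjugate = _
    rw [hA, h, Matrix.adjugate_smul, pow_mul]
    simp

theorem GHatPrimary_le (N p : ℕ) : GHatPrimary N p ≤ GHat N := fun _ h => h.1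

/-- The Hecke algebra `H(Γ̂_N, Ĝ_N)`. -/
abbrev HeckeFull (N : ℕ) : Type := HeckeAlgebra ((GammaHat N).subgroupOf (GHat N))

/-- The primary component `H(Γ̂_N, Ĝ_{N,p})`. -/
abbrev HeckePrimary (N p : ℕ) : Type := HeckeAlgebra ((GammaHat N).subgroupOf (GHatPrimary N p))

theorem exists_common_denominator (A : Matrix (Fin 5) (Fin 5) ℚ) :
    ∃ (m : ℕ) (B : Matrix (Fin 5) (Fin 5) ℤ), m ≠ 0 ∧
      (m : ℚ) • A = B.map (Int.cast : ℤ → ℚ) := by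
  refine ⟨∏ i, ∏ j, (A i j).den, fun i j => ((∏ i, ∏ j, (A i j).den : ℕ) * A i j).num, ?_, ?_⟩
  · exact Finset.prod_ne_zero_iff.2 fun i _ => Finset.prod_ne_zero_iff.2 fun j _ => (A i j).den_ne_zero
  · ext i j
    have hd : (A i j).den ∣ ∏ i, ∏ j, (A i j).den :=
      (Finset.dvd_prod_of_mem (fun j => (A i j).den) (Finset.mem_univ j)).trans
        (Finset.dvd_prod_of_mem (fun i => ∏ j, (A i j).den) (Finset.mem_univ i))
    obtain ⟨k, hk⟩ := hd
    have h1 : ((∏ i, ∏ j, (A i j).den : ℕ) : ℚ) * A i j = ((k * (A i j).num : ℤ) : ℚ) := by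
      rw [hk]
      have := Rat.mul_den_eq_num (A i j)
      push_cast
      linear_combination (k : ℚ) * this
    change ((∏ i, ∏ j, (A i j).den : ℕ) : ℚ) * A i j =
      ((((∏ i, ∏ j, (A i j).den : ℕ) : ℚ) * A i j).num : ℚ)
    rw [h1, Rat.num_intCast]

theorem conj_integral {N : ℕ} {g a b : Matrix.SpecialLinearGroup (Fin 5) ℚ} (hg : g ∈ GHat N)
    {m k : ℕ} {B C : Matrix (Fin 5) (Fin 5) ℤ}
    (hB : (m : ℚ) • (g : Matrix (Fin 5) (Fin 5) ℚ) = B.map (Int.cast : ℤ → ℚ))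
    (hC : (k : ℚ) • ((g⁻¹ : Matrix.SpecialLinearGroup (Fin 5) ℚ) : Matrix (Fin 5) (Fin 5) ℚ)
      = C.map (Int.cast : ℤ → ℚ))
    (ha : a ∈ GHat N) (hb : b ∈ GHat N) {x y : Matrix.SpecialLinearGroup (Fin 5) ℤ}
    (hx : Matrix.SpecialLinearGroup.map (Int.castRingHom ℚ) x = a)
    (hy : Matrix.SpecialLinearGroup.map (Int.castRingHom ℚ) y = b)
    (hxy : (x : Matrix (Fin 5) (Fin 5) ℤ).map (Int.cast : ℤ → ZMod (m * k)) =
      (y : Matrix (Fin 5) (Fin 5) ℤ).map (Int.cast : ℤ → ZMod (m * k))) :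
    (g * a) * (g * b)⁻¹ ∈ GammaHat N := by
  have hdvd : ∃ D : Matrix (Fin 5) (Fin 5) ℤ,
      (x : Matrix (Fin 5) (Fin 5) ℤ) - y = ((m * k : ℕ) : ℤ) • D := by
    have : ∀ i j, ∃ d : ℤ, (x : Matrix (Fin 5) (Fin 5) ℤ) i j - (y : Matrix (Fin 5) (Fin 5) ℤ) i j
        = ((m * k : ℕ) : ℤ) * d := by
      intro i j
      have h := congrFun (congrFun hxy i) j
      simp only [Matrix.map_apply] at h
      exact (ZMod.intCast_eq_intCast_iff_dvd_sub _ _ _).1 h.symm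
    choose D hD using this
    exact ⟨Matrix.of D, by ext i j; exact hD i j⟩
  obtain ⟨D, hD⟩ := hdvd
  have mapmul : ∀ P Q : Matrix (Fin 5) (Fin 5) ℤ, (P * Q).map (Int.cast : ℤ → ℚ) =
      P.map (Int.cast : ℤ → ℚ) * Q.map Int.cast := fun P Q =>
    Matrix.map_mul (f := Int.castRingHom ℚ)
  have hbinv : ((b⁻¹ : Matrix.SpecialLinearGroup (Fin 5) ℚ) : Matrix (Fin 5) (Fin 5) ℚ) =
      ((y⁻¹ : Matrix.SpecialLinearGroup (Fin 5) ℤ) : Matrix (Fin 5) (Fin 5) ℤ).map (Int.cast : ℤ → ℚ) := by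
    rw [← hy, ← map_inv]; rfl
  have haM : (a : Matrix (Fin 5) (Fin 5) ℚ) =
      (x : Matrix (Fin 5) (Fin 5) ℤ).map (Int.cast : ℤ → ℚ) := by
    rw [← hx]; rfl
  have hbM : (b : Matrix (Fin 5) (Fin 5) ℚ) =
      (y : Matrix (Fin 5) (Fin 5) ℤ).map (Int.cast : ℤ → ℚ) := by
    rw [← hy]; rfl
  set E : Matrix (Fin 5) (Fin 5) ℤ := B * D *
    ((y⁻¹ : Matrix.SpecialLinearGroup (Fin 5) ℤ) : Matrix (Fin 5) (Fin 5) ℤ) * C with hE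
  have hsub : (a : Matrix (Fin 5) (Fin 5) ℚ) = b + ((m : ℚ) * k) • D.map (Int.cast : ℤ → ℚ) := by
    rw [haM, hbM]
    ext i j
    have := congrFun (congrFun hD i) j
    simp only [Matrix.sub_apply, Matrix.smul_apply, smul_eq_mul] at this
    have h2 : ((x : Matrix (Fin 5) (Fin 5) ℤ) i j : ℚ) =
        (y : Matrix (Fin 5) (Fin 5) ℤ) i j + m * k * D i j := by
      have h3 := congrArg (Int.cast : ℤ → ℚ) this
      push_cast at h3
      linarith
    simpa using h2
  have hconj : (((g * a) * (g * b)⁻¹ : Matrix.SpecialLinearGroup (Fin 5) ℚ) :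
      Matrix (Fin 5) (Fin 5) ℚ) = (1 + E).map (Int.cast : ℤ → ℚ) := by
    have e1 : ((g * a) * (g * b)⁻¹ : Matrix.SpecialLinearGroup (Fin 5) ℚ) = g * a * b⁻¹ * g⁻¹ := by group
    have hgg : (g : Matrix (Fin 5) (Fin 5) ℚ) * (b : Matrix (Fin 5) (Fin 5) ℚ) *
        ((b⁻¹ : Matrix.SpecialLinearGroup (Fin 5) ℚ) : Matrix (Fin 5) (Fin 5) ℚ) *
        ((g⁻¹ : Matrix.SpecialLinearGroup (Fin 5) ℚ) : Matrix (Fin 5) (Fin 5) ℚ) = 1 := by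
      simp only [← Matrix.SpecialLinearGroup.coe_mul]
      rw [show g * b * b⁻¹ * g⁻¹ = 1 by group, Matrix.SpecialLinearGroup.coe_one]
    have e2 : (1 + E).map (Int.cast : ℤ → ℚ) = 1 + E.map (Int.cast : ℤ → ℚ) := by
      rw [Matrix.map_add _ (by intros; push_cast; rfl)]
      congr 1
      exact Matrix.map_one _ (by simp) (by simp)
    rw [e1, e2, hE, mapmul, mapmul, mapmul, ← hB, ← hC, ← hbinv, Matrix.SpecialLinearGroup.coe_mul,
      Matrix.SpecialLinearGroup.coe_mul, Matrix.SpecialLinearGroup.coe_mul, hsub, Matrix.mul_add,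
      Matrix.add_mul, Matrix.add_mul, hgg]
    congr 1
    simp only [Matrix.mul_smul, Matrix.smul_mul, smul_smul]
    congr 1
    ring
  clear_value E
  refine ⟨(GHat N).mul_mem ((GHat N).mul_mem hg ha) ((GHat N).inv_mem ((GHat N).mul_mem hg hb)),
    ⟨1 + E, ?_⟩, ?_⟩
  · have h1 : ((1 + E).map (Int.cast : ℤ → ℚ)).det = 1 := by
      rw [← hconj]; exact Matrix.SpecialLinearGroup.det_coe _
    have h2 : (((1 + E).det : ℤ) : ℚ) = ((1 + E).map (Int.cast : ℤ → ℚ)).det :=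
      RingHom.map_det (Int.castRingHom ℚ) (1 + E)
    rw [h1] at h2
    exact Int.cast_injective (h2.trans Int.cast_one.symm)
  · apply Subtype.ext
    exact hconj.symm

/-- `(Γ̂_N, G)` is a Hecke pair for every group `G ≤ Ĝ_N`. -/
theorem isHeckePair_of_le {N : ℕ} {H : Subgroup (Matrix.SpecialLinearGroup (Fin 5) ℚ)}
    (hH : H ≤ GHat N) : IsHeckePair ((GammaHat N).subgroupOf H) := by
  intro g
  obtain ⟨m, B, hm, hB⟩ := exists_common_denominator (g : Matrix.SpecialLinearGroup (Fin 5) ℚ)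
  obtain ⟨k, C, hk, hC⟩ := exists_common_denominator
    ((g : Matrix.SpecialLinearGroup (Fin 5) ℚ)⁻¹ : Matrix.SpecialLinearGroup (Fin 5) ℚ)
  have : NeZero (m * k) := ⟨Nat.mul_ne_zero hm hk⟩
  set U := (GammaHat N).subgroupOf H
  have hlift : ∀ u : U, ∃ x : Matrix.SpecialLinearGroup (Fin 5) ℤ,
      Matrix.SpecialLinearGroup.map (Int.castRingHom ℚ) x = (u : H).1 := fun u => u.2.2
  choose ι hι using hlift
  let f : U → Matrix (Fin 5) (Fin 5) (ZMod (m * k)) := fun u =>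
    (ι u : Matrix (Fin 5) (Fin 5) ℤ).map (Int.cast : ℤ → ZMod (m * k))
  have hf : ∀ u v : U, f u = f v → coset U (g * (u : H)) = coset U (g * (v : H)) := by
    intro u v huv
    rw [coset_eq_iff, Subgroup.mem_subgroupOf]
    exact conj_integral (hH g.2) hB hC (hH v.1.2) (hH u.1.2) (hι v) (hι u) huv.symm
  have hrange : cosetsIn U g ⊆ Set.range fun u : U => coset U (g * (u : H)) := by
    rintro c ⟨x, hx, rfl⟩
    obtain ⟨a, ha, b, hb, rfl⟩ := DoubleCoset.mem_doubleCoset.1 hx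
    exact ⟨⟨b, hb⟩, by rw [mul_assoc, coset_mul_left ha]⟩
  refine Set.Finite.subset ?_ hrange
  have hfin : (Set.range f).Finite := Set.toFinite _
  have : Set.range (fun u : U => coset U (g * (u : H))) ⊆
      (fun y : Matrix (Fin 5) (Fin 5) (ZMod (m * k)) =>
        coset U (g * ((Function.invFun f y : U) : H))) '' Set.range f := by
    rintro _ ⟨u, rfl⟩
    exact ⟨f u, ⟨u, rfl⟩, hf _ _ (Function.invFun_eq ⟨u, rfl⟩)⟩
  exact (hfin.image _).subset this

/-- The path-connected torus `diag(eˢ, eᵗ, 1, e⁻ᵗ, e⁻ˢ)` in `SO(Ŝ_N; ℝ)`. -/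
noncomputable def torus (N : ℕ) (x : ℝ × ℝ) : SOReal N :=
  ⟨⟨diagonal ![Real.exp x.1, Real.exp x.2, 1, Real.exp (-x.2), Real.exp (-x.1)], by
    rw [det_diagonal]
    simp [Fin.prod_univ_succ, Real.exp_neg]⟩, by
    change (diagonal _)ᵀ * Shat N * diagonal _ = Shat N
    ext i j
    rw [diagonal_transpose, mul_diagonal, diagonal_mul]
    fin_cases i <;> fin_cases j <;> simp [Shat, Real.exp_neg]⟩

theorem torus_mem (N : ℕ) (x : ℝ × ℝ) : ((torus N x : SOReal N) :
    Matrix.SpecialLinearGroup (Fin 5) ℝ) ∈ SO0Real N := by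
  have hc : Continuous (torus N) := by
    refine Continuous.subtype_mk (Continuous.subtype_mk ?_ _) _
    refine Continuous.matrix_diagonal (continuous_pi fun i => ?_)
    fin_cases i
    all_goals
      simp
      fun_prop
  have h0 : torus N 0 = 1 := by
    refine Subtype.ext (Subtype.ext ?_)
    change diagonal _ = (1 : Matrix (Fin 5) (Fin 5) ℝ)
    rw [← diagonal_one]
    congr 1
    funext i
    fin_cases i <;> simp
  refine ⟨torus N x, ?_, rfl⟩
  exact (isPreconnected_range hc).subset_connectedComponent ⟨0, h0⟩ ⟨x, rfl⟩

theorem diag_mem (N : ℕ) {s t : ℝ} (hs : 0 < s) (ht : 0 < t) (g : Matrix.SpecialLinearGroup (Fin 5) ℚ)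
    (hg : (g : Matrix (Fin 5) (Fin 5) ℚ).map (algebraMap ℚ ℝ) = diagonal ![s, t, 1, t⁻¹, s⁻¹]) :
    g ∈ GHat N := by
  have h := torus_mem N (Real.log s, Real.log t)
  have e : Matrix.SpecialLinearGroup.map (algebraMap ℚ ℝ) g = (torus N (Real.log s, Real.log t)).1 := by
    refine Subtype.ext ?_
    change (g : Matrix (Fin 5) (Fin 5) ℚ).map (algebraMap ℚ ℝ) = diagonal _
    rw [hg]
    simp [Real.exp_neg, Real.exp_log hs, Real.exp_log ht]
  change Matrix.SpecialLinearGroup.map (algebraMap ℚ ℝ) g ∈ SO0Real N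
  rw [e]
  exact h

/-- The matrix `p⁻¹ diag(1, p, p, p, p²)` as an element of `Ĝ_{N,p}`. -/
noncomputable def d1 (N p : ℕ) (hp : p.Prime) : GHatPrimary N p :=
  have hp0 : (p : ℚ) ≠ 0 := Nat.cast_ne_zero.2 hp.ne_zero
  ⟨⟨(p : ℚ)⁻¹ • diagonal ![1, (p : ℚ), p, p, (p : ℚ) ^ 2], by
    rw [det_smul, det_diagonal]
    simp [Fin.prod_univ_succ]
    field_simp⟩, by
    have hpR : (0 : ℝ) < p := Nat.cast_pos.2 hp.pos
    refine ⟨diag_mem N (s := (p : ℝ)⁻¹) (t := 1) (by positivity) one_pos _ ?_, 1,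
      diagonal ![1, (p : ℤ), p, p, (p : ℤ) ^ 2], ?_⟩
    · ext i j
      fin_cases i <;> fin_cases j <;> simp [hpR.ne'] <;> field_simp
    · ext i j
      fin_cases i <;> fin_cases j <;> simp⟩

/-- The matrix `p⁻¹ diag(1, 1, p, p², p²)` as an element of `Ĝ_{N,p}`. -/
noncomputable def d2 (N p : ℕ) (hp : p.Prime) : GHatPrimary N p :=
  have hp0 : (p : ℚ) ≠ 0 := Nat.cast_ne_zero.2 hp.ne_zero
  ⟨⟨(p : ℚ)⁻¹ • diagonal ![1, 1, (p : ℚ), (p : ℚ) ^ 2, (p : ℚ) ^ 2], by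
    rw [det_smul, det_diagonal]
    simp [Fin.prod_univ_succ]
    field_simp⟩, by
    have hpR : (0 : ℝ) < p := Nat.cast_pos.2 hp.pos
    refine ⟨diag_mem N (s := (p : ℝ)⁻¹) (t := (p : ℝ)⁻¹) (by positivity) (by positivity) _ ?_, 1,
      diagonal ![1, 1, (p : ℤ), (p : ℤ) ^ 2, (p : ℤ) ^ 2], ?_⟩
    · ext i j
      fin_cases i <;> fin_cases j <;> simp [hpR.ne'] <;> field_simp
    · ext i j
      fin_cases i <;> fin_cases j <;> simp⟩

/-- `T_{N,1}(p) = Γ̂_N p⁻¹ diag(1, p, p, p, p²) Γ̂_N`. -/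
noncomputable def T1 (N p : ℕ) (hp : p.Prime) : HeckePrimary N p :=
  doubleCosetElement (isHeckePair_of_le (GHatPrimary_le N p)) (d1 N p hp)

/-- `T_{N,2}(p) = Γ̂_N p⁻¹ diag(1, 1, p, p², p²) Γ̂_N`. -/
noncomputable def T2 (N p : ℕ) (hp : p.Prime) : HeckePrimary N p :=
  doubleCosetElement (isHeckePair_of_le (GHatPrimary_le N p)) (d2 N p hp)

end Orthogonal

end HeckeSO

/-!
A group element has a degree: the common denominator of its entries and the common denominator of
its `2 × 2` minors, compared lexicographically. Both are submultiplicative and invariant under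
`Γ̂_N` on either side. For squarefree `N`, transitivity of `Γ̂_N` on primitive isotropic vectors
brings every element of `Ĝ_N` to the form `diag(1/a, 1/b, 1, b, a)` with `b ∣ a`, first in the
outer hyperbolic plane and then, through Atkin–Lehner matrices, on the ternary form
`x₁ x₃ - N x₂²`. Such a matrix has degree `(a, a b)`, so the degree determines the double coset.

In a product of two double cosets of degrees `(a, a b)` and `(a', a' b')`, the top degree is
attained by the product `t t'` of the two diagonal matrices, with multiplicity one: a right coset
representative may be taken upper triangular, and attaining the top degree leaves no room for
cancellation in its first two rows, whence it lies in `Γ̂_N t'`. Thus leading terms multiply, there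
are no zero divisors, and the `p`-primary degrees are exactly the products of powers of the degrees
of the two generators. Commutativity holds because the long Weyl element inverts the diagonal
matrices.
-/

namespace HeckeSO

section Coefficients

variable {G : Type*} [Group G] {U : Subgroup G}

/-- The coefficient of the right coset `U g` in an element of the Hecke algebra. -/
def coeff (g : G) : HeckeAlgebra U →+ ℤ where
  toFun x := x.1 (coset U g)
  map_zero' := rfl
  map_add' _ _ := rfl

theorem coset_surjective (U : Subgroup G) : Function.Surjective (coset U) :=
  Quotient.mk_surjective

theorem coset_out (d : RightCosets U) : coset U d.out = d := Quotient.out_eq d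

theorem exists_coset_out_eq_mul (g : G) : ∃ u ∈ U, (coset U g).out = u * g :=
  ⟨(coset U g).out * g⁻¹, coset_eq_iff.1 (coset_out (coset U g)).symm, by simp⟩

theorem coeff_def (g : G) (x : HeckeAlgebra U) : coeff g x = x.1 (coset U g) := rfl

theorem coeff_out (d : RightCosets U) (x : HeckeAlgebra U) : coeff d.out x = x.1 d := by
  rw [coeff_def, coset_out]

theorem coeff_ext {x y : HeckeAlgebra U} (h : ∀ g, coeff g x = coeff g y) : x = y :=
  Subtype.ext <| Finsupp.ext <| (coset_surjective U).forall.2 h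

theorem coeff_mul_left {u : G} (hu : u ∈ U) (g : G) (x : HeckeAlgebra U) :
    coeff (u * g) x = coeff g x := by
  rw [coeff_def, coset_mul_left hu, coeff_def]

/-- Right translation by `g` as a permutation of the right cosets. -/
def translateEquiv (U : Subgroup G) (g : G) : RightCosets U ≃ RightCosets U where
  toFun := translate U g
  invFun := translate U g⁻¹
  left_inv c := by rw [translate_translate, mul_inv_cancel, translate_one]
  right_inv c := by rw [translate_translate, inv_mul_cancel, translate_one]

theorem translateEquiv_coset (g h : G) : translateEquiv U g (coset U h) = coset U (h * g) := rfl

theorem chainTranslate_apply (g h : G) (x : RightCosets U →₀ ℤ) :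
    chainTranslate U g x (coset U h) = x (coset U (h * g⁻¹)) := by
  have hcoset : coset U h = translateEquiv U g (coset U (h * g⁻¹)) := by
    rw [translateEquiv_coset, inv_mul_cancel_right]
  rw [hcoset, chainTranslate, Finsupp.lmapDomain_apply]
  exact Finsupp.mapDomain_apply (translateEquiv U g).injective _ _

theorem coeff_mul_right {u : G} (hu : u ∈ U) (g : G) (x : HeckeAlgebra U) :
    coeff (g * u) x = coeff g x := by
  rw [coeff_def, ← x.2 u hu, chainTranslate_apply, mul_inv_cancel_right, coeff_def]

theorem coeff_eq_of_mem_doubleCoset {g h : G}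
    (hh : h ∈ DoubleCoset.doubleCoset g (U : Set G) (U : Set G)) (x : HeckeAlgebra U) :
    coeff h x = coeff g x := by
  obtain ⟨a, ha, b, hb, rfl⟩ := DoubleCoset.mem_doubleCoset.1 hh
  rw [coeff_mul_right hb, coeff_mul_left ha]

theorem coeff_mul (g : G) (x y : HeckeAlgebra U) :
    coeff g (x * y) = ∑ᶠ d : RightCosets U, coeff d.out y * coeff (g * d.out⁻¹) x := by
  rw [coeff_def, val_mul, chainMulLin, Finsupp.linearCombination_apply, Finsupp.sum,
    Finsupp.finsetSum_apply, finsum_eq_sum_of_support_subset]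
  · refine Finset.sum_congr rfl fun d _ => ?_
    rw [Finsupp.smul_apply, chainTranslate_apply, smul_eq_mul, coeff_out, coeff_def]
  · intro d hd
    rw [Finset.mem_coe, Finsupp.mem_support_iff, ← coeff_out]
    exact left_ne_zero_of_mul hd

theorem coeff_coset_out_mul_coeff (g k : G) (x y : HeckeAlgebra U) :
    coeff (coset U k).out y * coeff (g * (coset U k).out⁻¹) x =
      coeff k y * coeff (g * k⁻¹) x := by
  obtain ⟨u, hu, hout⟩ := exists_coset_out_eq_mul (U := U) k
  rw [hout, mul_inv_rev, ← mul_assoc, coeff_mul_left hu, coeff_mul_right (U.inv_mem hu)]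

theorem coeff_one (g : G) :
    coeff g (1 : HeckeAlgebra U) = (U : Set G).indicator 1 g := by
  classical
  rw [coeff_def, val_one, Finsupp.single_apply, Set.indicator_apply]
  simp only [coset_eq_iff, inv_one, mul_one, SetLike.mem_coe, Pi.one_apply]

theorem coset_mem_cosetsIn {g h : G} :
    coset U h ∈ cosetsIn U g ↔ h ∈ DoubleCoset.doubleCoset g (U : Set G) (U : Set G) := by
  refine ⟨?_, fun hh => ⟨h, hh, rfl⟩⟩
  rintro ⟨x, hx, hxh⟩
  obtain ⟨a, ha, b, hb, rfl⟩ := DoubleCoset.mem_doubleCoset.1 hx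
  exact DoubleCoset.mem_doubleCoset.2
    ⟨h * (a * g * b)⁻¹ * a, U.mul_mem (coset_eq_iff.1 hxh) ha, b, hb, by group⟩

theorem coeff_doubleCosetElement (hU : IsHeckePair U) (g h : G) :
    coeff h (doubleCosetElement hU g) =
      (DoubleCoset.doubleCoset g (U : Set G) (U : Set G)).indicator 1 h := by
  classical
  change Finsupp.indicator (hU g).toFinset (fun _ _ => (1 : ℤ)) (coset U h) = _
  simp only [Finsupp.indicator_apply, Set.Finite.mem_toFinset, coset_mem_cosetsIn,
    Set.indicator_apply, Pi.one_apply, dite_eq_ite]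

-- Shimura's argument: coefficients are invariant under inversion, which reverses products.
theorem mul_comm_of_inv_mem_doubleCoset
    (hinv : ∀ g : G, g⁻¹ ∈ DoubleCoset.doubleCoset g (U : Set G) (U : Set G))
    (x y : HeckeAlgebra U) : x * y = y * x := by
  have coeff_inv (z : HeckeAlgebra U) (g : G) : coeff g⁻¹ z = coeff g z :=
    coeff_eq_of_mem_doubleCoset (hinv g) z
  refine coeff_ext fun g => ?_
  rw [← coeff_inv (y * x), coeff_mul, coeff_mul, ← finsum_comp_equiv (translateEquiv U g)]
  refine finsum_congr <| (coset_surjective U).forall.2 fun k => ?_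
  rw [translateEquiv_coset, coeff_coset_out_mul_coeff, coeff_coset_out_mul_coeff]
  calc coeff (k * g) y * coeff (g * (k * g)⁻¹) x
      = coeff (k * g) y * coeff k⁻¹ x := by rw [mul_inv_rev, mul_inv_cancel_left]
    _ = coeff k x * coeff (k * g)⁻¹ y := by rw [coeff_inv, coeff_inv, mul_comm]
    _ = coeff k x * coeff (g⁻¹ * k⁻¹) y := by rw [mul_inv_rev]

end Coefficients

section Degree

variable {G M : Type*} [Group G] [LinearOrder M] {U : Subgroup G} {deg : G → M}

/-- `x` has degree at most `m`, where `m` is the degree of some group element, and the coefficient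
of `x` in degree `m` is `c`. The case `c = 0` is allowed. -/
structure HasLeading (deg : G → M) (x : HeckeAlgebra U) (m : M) (c : ℤ) : Prop where
  mem_range : m ∈ Set.range deg
  deg_le : ∀ g, coeff g x ≠ 0 → deg g ≤ m
  coeff_eq : ∀ g, deg g = m → coeff g x = c

namespace HasLeading

variable {x y : HeckeAlgebra U} {m : M} {a b : ℤ}

theorem zsmul (hx : HasLeading deg x m a) (b : ℤ) : HasLeading deg (b • x) m (b * a) where
  mem_range := hx.mem_range
  deg_le g hg := hx.deg_le g fun h => hg (by rw [map_zsmul, h, smul_zero])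
  coeff_eq g hg := by rw [map_zsmul, hx.coeff_eq g hg, smul_eq_mul]

theorem deg_lt_of_coeff_sub_ne_zero (hx : HasLeading deg x m a) (hy : HasLeading deg y m a)
    {g : G} (hg : coeff g (x - y) ≠ 0) : deg g < m := by
  rw [map_sub] at hg
  refine lt_of_le_of_ne ?_ fun hm => hg ?_
  · by_cases hgx : coeff g x = 0
    · exact hy.deg_le g fun hgy => hg (by rw [hgx, hgy, sub_zero])
    · exact hx.deg_le g hgx
  · rw [hx.coeff_eq g hm, hy.coeff_eq g hm, sub_self]

end HasLeading

variable [CommMonoid M]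

/-- A degree on `G` relative to `U`: it separates the double cosets of `U`, and among the double
cosets occurring in a product of two there is one of maximal degree, which occurs with
multiplicity one. The last field encodes the multiplicity: it asks for a `k` of degree
`deg g * deg h` such that exactly one right coset `U d` satisfies `d ∈ U h U` and
`k * d⁻¹ ∈ U g U`. -/
structure IsDegree (U : Subgroup G) (deg : G → M) : Prop where
  deg_of_mem : ∀ u ∈ U, deg u = 1
  deg_mul_le : ∀ g h, deg (g * h) ≤ deg g * deg h
  mem_doubleCoset : ∀ g h, deg h = deg g → h ∈ DoubleCoset.doubleCoset g (U : Set G) (U : Set G)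
  exists_leading : ∀ g h, ∃ k d₀, deg k = deg g * deg h ∧ deg d₀ = deg h ∧
    deg (k * d₀⁻¹) = deg g ∧
    ∀ d, deg d = deg h → deg (k * d⁻¹) = deg g → coset U d = coset U d₀

namespace IsDegree

theorem deg_mul_left (h : IsDegree U deg) {u : G} (hu : u ∈ U) (g : G) :
    deg (u * g) = deg g := by
  refine le_antisymm ?_ ?_
  · simpa only [h.deg_of_mem u hu, one_mul] using h.deg_mul_le u g
  · simpa only [inv_mul_cancel_left, h.deg_of_mem _ (U.inv_mem hu), one_mul]
      using h.deg_mul_le u⁻¹ (u * g)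

theorem deg_mul_right (h : IsDegree U deg) {u : G} (hu : u ∈ U) (g : G) :
    deg (g * u) = deg g := by
  refine le_antisymm ?_ ?_
  · simpa only [h.deg_of_mem u hu, mul_one] using h.deg_mul_le g u
  · simpa only [mul_inv_cancel_right, h.deg_of_mem _ (U.inv_mem hu), mul_one]
      using h.deg_mul_le (g * u) u⁻¹

theorem deg_eq_of_mem_doubleCoset (h : IsDegree U deg) {g k : G}
    (hk : k ∈ DoubleCoset.doubleCoset g (U : Set G) (U : Set G)) : deg k = deg g := by
  obtain ⟨a, ha, b, hb, rfl⟩ := DoubleCoset.mem_doubleCoset.1 hk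
  rw [h.deg_mul_right hb, h.deg_mul_left ha]

theorem deg_coset_out (h : IsDegree U deg) (g : G) : deg (coset U g).out = deg g := by
  obtain ⟨u, hu, hout⟩ := exists_coset_out_eq_mul (U := U) g
  rw [hout, h.deg_mul_left hu]

theorem coeff_congr (h : IsDegree U deg) {g k : G} (hk : deg k = deg g) (x : HeckeAlgebra U) :
    coeff k x = coeff g x :=
  coeff_eq_of_mem_doubleCoset (h.mem_doubleCoset g k hk) x

theorem hasLeading_doubleCosetElement (h : IsDegree U deg) (hU : IsHeckePair U) (g : G) :
    HasLeading deg (doubleCosetElement hU g) (deg g) 1 where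
  mem_range := ⟨g, rfl⟩
  deg_le k hk := by
    rw [coeff_doubleCosetElement] at hk
    exact (h.deg_eq_of_mem_doubleCoset (Set.mem_of_indicator_ne_zero hk)).le
  coeff_eq k hk := by
    rw [coeff_doubleCosetElement, Set.indicator_of_mem (h.mem_doubleCoset g k hk), Pi.one_apply]

theorem hasLeading_one (h : IsDegree U deg) : HasLeading deg (1 : HeckeAlgebra U) 1 1 where
  mem_range := ⟨1, h.deg_of_mem 1 U.one_mem⟩
  deg_le g hg := by
    rw [coeff_one] at hg
    exact (h.deg_of_mem g (Set.mem_of_indicator_ne_zero hg)).le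
  coeff_eq g hg := by
    rw [h.coeff_congr (hg.trans (h.deg_of_mem 1 U.one_mem).symm), coeff_one,
      Set.indicator_of_mem U.one_mem, Pi.one_apply]

theorem exists_hasLeading (h : IsDegree U deg) {x : HeckeAlgebra U} (hx : x ≠ 0) :
    ∃ m c, c ≠ 0 ∧ HasLeading deg x m c := by
  have hsupp : x.1.support.Nonempty :=
    Finsupp.support_nonempty_iff.2 fun h0 => hx (Subtype.ext h0)
  obtain ⟨c, hc, hmax⟩ := Finset.exists_max_image x.1.support (fun c => deg c.out) hsupp
  refine ⟨deg c.out, coeff c.out x, ?_, ⟨c.out, rfl⟩, fun g hg => ?_,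
    fun g hg => h.coeff_congr hg x⟩
  · rw [coeff_out]
    exact Finsupp.mem_support_iff.1 hc
  · rw [← h.deg_coset_out g]
    exact hmax (coset U g) (Finsupp.mem_support_iff.2 hg)

variable [IsOrderedCancelMonoid M]

theorem hasLeading_mul (h : IsDegree U deg) {x y : HeckeAlgebra U} {m n : M} {a b : ℤ}
    (hx : HasLeading deg x m a) (hy : HasLeading deg y n b) :
    HasLeading deg (x * y) (m * n) (a * b) := by
  obtain ⟨g, rfl⟩ := hx.mem_range
  obtain ⟨k, rfl⟩ := hy.mem_range
  have bounds {l d : G} (hld : coeff d y * coeff (l * d⁻¹) x ≠ 0) :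
      deg (l * d⁻¹) ≤ deg g ∧ deg d ≤ deg k ∧ deg l ≤ deg (l * d⁻¹) * deg d :=
    ⟨hx.deg_le _ (right_ne_zero_of_mul hld), hy.deg_le _ (left_ne_zero_of_mul hld), by
      simpa only [inv_mul_cancel_right] using h.deg_mul_le (l * d⁻¹) d⟩
  obtain ⟨l, d₀, hl, hd₀, hld₀, huniq⟩ := h.exists_leading g k
  refine ⟨⟨l, hl⟩, fun l' hl' => ?_, fun l' hl' => ?_⟩
  · rw [coeff_mul] at hl'
    obtain ⟨d, hd⟩ : ∃ d : RightCosets U, coeff d.out y * coeff (l' * d.out⁻¹) x ≠ 0 := by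
      by_contra! hzero
      exact hl' (finsum_eq_zero_of_forall_eq_zero hzero)
    obtain ⟨hgd, hkd, hld⟩ := bounds hd
    exact hld.trans (mul_le_mul' hgd hkd)
  · rw [h.coeff_congr (hl'.trans hl.symm), coeff_mul, finsum_eq_single _ (coset U d₀),
      coeff_coset_out_mul_coeff, hx.coeff_eq _ hld₀, hy.coeff_eq _ hd₀, mul_comm]
    intro d hd
    contrapose! hd
    obtain ⟨hgd, hkd, hld⟩ := bounds hd
    rw [hl] at hld
    obtain ⟨hgd, hkd⟩ := (mul_le_mul_iff_of_ge hgd hkd).1 hld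
    rw [← coset_out d]
    exact huniq _ hkd hgd

theorem hasLeading_pow (h : IsDegree U deg) {x : HeckeAlgebra U} {m : M} {a : ℤ}
    (hx : HasLeading deg x m a) (n : ℕ) : HasLeading deg (x ^ n) (m ^ n) (a ^ n) := by
  induction n with
  | zero => simpa only [pow_zero] using h.hasLeading_one
  | succ n ih => simpa only [pow_succ] using h.hasLeading_mul ih hx

theorem noZeroDivisors (h : IsDegree U deg) : NoZeroDivisors (HeckeAlgebra U) where
  eq_zero_or_eq_zero_of_mul_eq_zero {x y} hxy := by
    by_contra! hne
    obtain ⟨m, a, ha, hx⟩ := h.exists_hasLeading hne.1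
    obtain ⟨n, b, hb, hy⟩ := h.exists_hasLeading hne.2
    have hmul := h.hasLeading_mul hx hy
    obtain ⟨g, hg⟩ := hmul.mem_range
    have hzero := hmul.coeff_eq g hg
    rw [hxy, map_zero] at hzero
    exact mul_ne_zero ha hb hzero.symm

end IsDegree

end Degree

section PolynomialRing

variable {G M σ : Type*} [Group G] [CommMonoid M] [LinearOrder M] {U : Subgroup G} {deg : G → M}
  (hcomm : ∀ x y : HeckeAlgebra U, x * y = y * x) (T : σ → HeckeAlgebra U)

/-- A Hecke algebra with commuting elements as a commutative ring. -/
noncomputable abbrev commRingOfMulComm : CommRing (HeckeAlgebra U) :=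
  { (inferInstance : Ring (HeckeAlgebra U)) with mul_comm := hcomm }

/-- The evaluation of polynomials at the elements `T i` of a commutative Hecke algebra. -/
noncomputable def evalHom : MvPolynomial σ ℤ →+* HeckeAlgebra U :=
  letI := commRingOfMulComm hcomm
  MvPolynomial.eval₂Hom (Int.castRingHom _) T

theorem evalHom_X (i : σ) : evalHom hcomm T (MvPolynomial.X i) = T i :=
  letI := commRingOfMulComm hcomm
  MvPolynomial.eval₂Hom_X' _ _ i

namespace IsDegree

variable [IsOrderedCancelMonoid M] {hcomm T} {δ : σ → M}

theorem hasLeading_evalHom_monomial (h : IsDegree U deg)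
    (hT : ∀ i, HasLeading deg (T i) (δ i) 1) (e : σ →₀ ℕ) (c : ℤ) :
    HasLeading deg (evalHom hcomm T (MvPolynomial.monomial e c))
      (e.prod fun i n => δ i ^ n) c := by
  classical
  suffices HasLeading deg (evalHom hcomm T (MvPolynomial.monomial e 1))
      (e.prod fun i n => δ i ^ n) 1 by
    simpa only [MvPolynomial.smul_monomial, ← map_zsmul, smul_eq_mul, mul_one] using this.zsmul c
  induction e using Finsupp.induction with
  | zero =>
    simpa only [MvPolynomial.monomial_zero', map_one, Finsupp.prod_zero_index]
      using h.hasLeading_one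
  | single_add i n e _ _ ih =>
    rw [MvPolynomial.monomial_single_add, map_mul, map_pow, evalHom_X,
      Finsupp.prod_add_index' (fun i => pow_zero (δ i)) (fun i => pow_add (δ i)),
      Finsupp.prod_single_index (h := fun i n => δ i ^ n) (pow_zero (δ i))]
    simpa only [one_pow, one_mul] using h.hasLeading_mul (h.hasLeading_pow (hT i) n) ih

theorem evalHom_injective (h : IsDegree U deg) (hT : ∀ i, HasLeading deg (T i) (δ i) 1)
    (hinj : Function.Injective fun e : σ →₀ ℕ => e.prod fun i n => δ i ^ n) :
    Function.Injective (evalHom hcomm T) := by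
  rw [injective_iff_map_eq_zero]
  intro P hP
  by_contra hne
  obtain ⟨e, he, hmax⟩ := Finset.exists_max_image P.support
    (fun e => e.prod fun i n => δ i ^ n) (MvPolynomial.support_nonempty.2 hne)
  have hlead := h.hasLeading_evalHom_monomial (hcomm := hcomm) hT
  obtain ⟨g, hg⟩ := (hlead e 1).mem_range
  have hcoeff : coeff g (evalHom hcomm T P) = P.coeff e := by
    conv_lhs => rw [P.as_sum, map_sum, map_sum]
    rw [Finset.sum_eq_single_of_mem e he, (hlead e _).coeff_eq g hg]
    intro e' he' hee'
    by_contra hge'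
    exact hee' (hinj (le_antisymm (hmax e' he') (hg.ge.trans ((hlead e' _).deg_le g hge'))))
  rw [hP, map_zero] at hcoeff
  exact MvPolynomial.mem_support_iff.1 he hcoeff.symm

theorem evalHom_surjective [WellFoundedLT M] (h : IsDegree U deg)
    (hT : ∀ i, HasLeading deg (T i) (δ i) 1)
    (hgen : ∀ g, ∃ e : σ →₀ ℕ, (e.prod fun i n => δ i ^ n) = deg g) :
    Function.Surjective (evalHom hcomm T) := by
  have hlead (m : M) : ∀ x c, HasLeading deg x m c → x ∈ (evalHom hcomm T).range := by
    induction m using WellFoundedLT.induction with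
    | ind m ih =>
      intro x c hx
      obtain ⟨g, rfl⟩ := hx.mem_range
      obtain ⟨e, he⟩ := hgen g
      set y := evalHom hcomm T (MvPolynomial.monomial e c) with hy
      have hy_lead : HasLeading deg y (deg g) c := he ▸ h.hasLeading_evalHom_monomial hT e c
      have hy_mem : y ∈ (evalHom hcomm T).range := ⟨_, hy.symm⟩
      rw [← sub_add_cancel x y]
      refine add_mem ?_ hy_mem
      by_cases hxy : x - y = 0
      · rw [hxy]
        exact zero_mem _
      obtain ⟨n, b, hb, hn⟩ := h.exists_hasLeading hxy
      obtain ⟨k, rfl⟩ := hn.mem_range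
      refine ih _ (hx.deg_lt_of_coeff_sub_ne_zero hy_lead ?_) (x - y) b hn
      rwa [hn.coeff_eq k rfl]
  intro x
  by_cases hx : x = 0
  · exact ⟨0, by rw [hx, map_zero]⟩
  · obtain ⟨m, c, -, hm⟩ := h.exists_hasLeading hx
    exact hlead m x c hm

theorem exists_mvPolynomial_ringEquiv [WellFoundedLT M] (h : IsDegree U deg)
    (hcomm : ∀ x y : HeckeAlgebra U, x * y = y * x) (hT : ∀ i, HasLeading deg (T i) (δ i) 1)
    (hinj : Function.Injective fun e : σ →₀ ℕ => e.prod fun i n => δ i ^ n)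
    (hgen : ∀ g, ∃ e : σ →₀ ℕ, (e.prod fun i n => δ i ^ n) = deg g) :
    ∃ φ : MvPolynomial σ ℤ ≃+* HeckeAlgebra U, ∀ i, φ (MvPolynomial.X i) = T i :=
  ⟨RingEquiv.ofBijective (evalHom hcomm T)
    ⟨h.evalHom_injective hT hinj, h.evalHom_surjective hT hgen⟩, evalHom_X hcomm T⟩

end IsDegree

end PolynomialRing

open Matrix

section Denominators

/-- The integers inside `ℚ`. -/
abbrev intSubring : Subring ℚ := (Int.castRingHom ℚ).range

theorem mem_intSubring {q : ℚ} : q ∈ intSubring ↔ ∃ z : ℤ, (z : ℚ) = q := Iff.rfl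

theorem intCast_mem_intSubring (z : ℤ) : (z : ℚ) ∈ intSubring := ⟨z, rfl⟩

theorem natCast_mul_mem_intSubring {q : ℚ} {k : ℕ} : (k : ℚ) * q ∈ intSubring ↔ q.den ∣ k := by
  constructor
  · rintro ⟨z, hz⟩
    obtain rfl | hk := eq_or_ne k 0
    · exact dvd_zero _
    have hq : q = Rat.divInt z k := by
      rw [Rat.divInt_eq_div, Int.cast_natCast, eq_div_iff (Nat.cast_ne_zero.2 hk), mul_comm]
      exact hz.symm
    exact Int.natCast_dvd_natCast.1 (hq ▸ Rat.den_dvd z k)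
  · rintro ⟨c, rfl⟩
    refine ⟨c * q.num, ?_⟩
    rw [eq_intCast, Int.cast_mul, ← Rat.mul_den_eq_num q]
    push_cast
    ring

theorem mem_intSubring_of_mul_sq {n : ℤ} (hn : Squarefree n) {q : ℚ}
    (h : (n : ℚ) * q ^ 2 ∈ intSubring) : q ∈ intSubring := by
  obtain ⟨z, hz⟩ := mem_intSubring.1 h
  have hnum : z * (q.den : ℤ) ^ 2 = n * q.num ^ 2 := by
    have : (z : ℚ) * q.den ^ 2 = n * q.num ^ 2 := by
      rw [hz, ← Rat.mul_den_eq_num q]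
      ring
    exact_mod_cast this
  have hcoprime : IsCoprime ((q.den : ℤ) ^ 2) (q.num ^ 2) :=
    (Int.isCoprime_iff_nat_coprime.2 q.reduced).symm.pow
  have hdvd : (q.den : ℤ) * q.den ∣ n :=
    pow_two (q.den : ℤ) ▸ hcoprime.dvd_of_dvd_mul_right (Dvd.intro_left z hnum)
  have hden : q.den = 1 := Int.ofNat_isUnit.1 (hn _ hdvd) |> Nat.isUnit_iff.1
  exact ⟨q.num, Rat.coe_int_num_of_den_eq_one hden⟩

theorem dvd_of_sq_dvd_mul_sq {n d s : ℤ} (hn : Squarefree n) (h : d ^ 2 ∣ n * s ^ 2) : d ∣ s := by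
  obtain rfl | hd := eq_or_ne d 0
  · simpa [hn.ne_zero] using h
  have hd' : (d : ℚ) ≠ 0 := Int.cast_ne_zero.2 hd
  obtain ⟨c, hc⟩ := h
  have hint : (n : ℚ) * ((s : ℚ) / d) ^ 2 ∈ intSubring := by
    refine mem_intSubring.2 ⟨c, ?_⟩
    rw [div_pow, mul_div_assoc', eq_div_iff (pow_ne_zero 2 hd'), mul_comm]
    exact_mod_cast hc.symm
  obtain ⟨z, hz⟩ := mem_intSubring.1 (mem_intSubring_of_mul_sq hn hint)
  rw [eq_div_iff hd'] at hz
  exact Dvd.intro_left z (by exact_mod_cast hz)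

variable {l m n : Type*} [Fintype l] [Fintype m] [Fintype n]

/-- The least common denominator of the entries of a rational matrix. -/
def matDen (M : Matrix m n ℚ) : ℕ := Finset.univ.lcm fun x : m × n => (M x.1 x.2).den

theorem matDen_dvd_iff {M : Matrix m n ℚ} {k : ℕ} :
    matDen M ∣ k ↔ ∀ i j, (k : ℚ) * M i j ∈ intSubring := by
  simp only [matDen, Finset.lcm_dvd_iff, natCast_mul_mem_intSubring, Finset.mem_univ, true_imp_iff,
    Prod.forall]

theorem matDen_mul_mem (M : Matrix m n ℚ) (i : m) (j : n) : (matDen M : ℚ) * M i j ∈ intSubring :=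
  matDen_dvd_iff.1 dvd_rfl i j

theorem matDen_pos (M : Matrix m n ℚ) : 0 < matDen M := by
  refine Nat.pos_of_ne_zero fun h => ?_
  obtain ⟨x, -, hx⟩ := Finset.lcm_eq_zero_iff.1 h
  exact (M x.1 x.2).den_ne_zero hx

theorem matDen_eq_one {M : Matrix m n ℚ} (h : ∀ i j, M i j ∈ intSubring) : matDen M = 1 := by
  rw [← Nat.dvd_one, matDen_dvd_iff]
  simpa using h

theorem matDen_mul_dvd (A : Matrix l m ℚ) (B : Matrix m n ℚ) :
    matDen (A * B) ∣ matDen A * matDen B := by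
  refine matDen_dvd_iff.2 fun i j => ?_
  rw [Matrix.mul_apply, Finset.mul_sum]
  refine Subring.sum_mem _ fun k _ => ?_
  rw [Nat.cast_mul, mul_mul_mul_comm]
  exact mul_mem (matDen_mul_mem _ _ _) (matDen_mul_mem _ _ _)

theorem matDen_submatrix_dvd {l' m' : Type*} [Fintype l'] [Fintype m'] (M : Matrix l m ℚ)
    (f : l' → l) (g : m' → m) : matDen (M.submatrix f g) ∣ matDen M :=
  matDen_dvd_iff.2 fun i j => matDen_mul_mem M (f i) (g j)

end Denominators

section Minors

variable {l m n R : Type*} [CommRing R]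

/-- The `2 × 2` minors of a matrix, indexed by all pairs of rows and all pairs of columns. -/
def minors (M : Matrix m n R) : Matrix (m × m) (n × n) R :=
  of fun i j => M i.1 j.1 * M i.2 j.2 - M i.1 j.2 * M i.2 j.1

theorem minors_apply (M : Matrix m n R) (i i' : m) (j j' : n) :
    minors M (i, i') (j, j') = M i j * M i' j' - M i j' * M i' j := rfl

theorem minors_self (M : Matrix m n R) (i : m) (j : n × n) : minors M (i, i) j = 0 :=
  sub_eq_zero.2 (mul_comm _ _)

theorem minors_mul [Fintype m] [LinearOrder m] (A : Matrix l m R) (B : Matrix m n R) :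
    minors (A * B) = (minors A).submatrix id (Subtype.val : {k : m × m // k.1 < k.2} → m × m) *
      (minors B).submatrix Subtype.val id := by
  ext ⟨i, i'⟩ ⟨j, j'⟩
  let f : m × m → R := fun k => A i k.1 * A i' k.2 * minors B k (j, j')
  have hdiag (k : m × m) (hk : k.1 = k.2) : f k = 0 := by
    obtain ⟨k, k'⟩ := k
    obtain rfl : k = k' := hk
    simp only [f, minors_self, mul_zero]
  have hsplit (k : m × m) :
      f k = (if k.1 < k.2 then f k else 0) + if k.2 < k.1 then f k else 0 := by
    rcases lt_trichotomy k.1 k.2 with hk | hk | hk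
    · simp [hk, hk.not_gt]
    · simp [hdiag k hk]
    · simp [hk, hk.not_gt]
  calc minors (A * B) (i, i') (j, j') = ∑ k, f k := by
        simp only [minors_apply, Matrix.mul_apply, Finset.sum_mul_sum, ← Finset.sum_sub_distrib,
          Fintype.sum_prod_type, f]
        exact Fintype.sum_congr _ _ fun k => Fintype.sum_congr _ _ fun k' => by ring
    _ = ∑ k, (if k.1 < k.2 then f k else 0) +
          ∑ k : m × m, if k.1 < k.2 then f k.swap else 0 := by
        rw [Fintype.sum_congr _ _ hsplit, Finset.sum_add_distrib]
        exact congrArg _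
          ((Equiv.prodComm m m).sum_comp fun k : m × m => if k.2 < k.1 then f k else 0).symm
    _ = ∑ k with k.1 < k.2, minors A (i, i') k * minors B k (j, j') := by
        rw [← Finset.sum_add_distrib, Finset.sum_filter]
        refine Fintype.sum_congr _ _ fun k => ?_
        split_ifs
        · simp only [f, minors, of_apply, Prod.fst_swap, Prod.snd_swap]
          ring
        · rw [add_zero]
    _ = _ := Finset.sum_subtype _ (by simp) _

theorem matDen_minors_mul_dvd [Fintype l] [Fintype m] [LinearOrder m] [Fintype n]
    (A : Matrix l m ℚ) (B : Matrix m n ℚ) :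
    matDen (minors (A * B)) ∣ matDen (minors A) * matDen (minors B) := by
  rw [minors_mul]
  exact (matDen_mul_dvd _ _).trans
    (mul_dvd_mul (matDen_submatrix_dvd _ _ _) (matDen_submatrix_dvd _ _ _))

theorem minors_mem_intSubring {M : Matrix m n ℚ} (h : ∀ i j, M i j ∈ intSubring) (i : m × m)
    (j : n × n) : minors M i j ∈ intSubring :=
  sub_mem (mul_mem (h _ _) (h _ _)) (mul_mem (h _ _) (h _ _))

theorem minors_diagonal [DecidableEq n] (d : n → R) (i i' : n) (j : n × n) :
    minors (diagonal d) (i, i') j = d i * d i' * minors (1 : Matrix n n R) (i, i') j := by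
  have h (i j : n) : diagonal d i j = d i * (1 : Matrix n n R) i j := by
    rw [← diagonal_one, diagonal_apply, diagonal_apply]
    split_ifs <;> simp
  simp only [minors, of_apply, h]
  ring

end Minors

section Degree

variable {l m n : Type*} [Fintype l] [Fintype m] [Fintype n]

/-- The degree of a rational matrix: the common denominators of its entries and of its
`2 × 2` minors. On double cosets it is the degree of the leading term argument. -/
def matDeg (M : Matrix m n ℚ) : ℕ+ ×ₗ ℕ+ :=
  toLex (⟨matDen M, matDen_pos M⟩, ⟨matDen (minors M), matDen_pos _⟩)

theorem matDeg_eq_toLex_iff {M : Matrix m n ℚ} {x y : ℕ+} :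
    matDeg M = toLex (x, y) ↔ matDen M = x ∧ matDen (minors M) = y := by
  exact toLex_inj.trans (Prod.mk_inj.trans (and_congr PNat.coe_inj.symm PNat.coe_inj.symm))

theorem matDeg_mul_le [LinearOrder m] (A : Matrix l m ℚ) (B : Matrix m n ℚ) :
    matDeg (A * B) ≤ matDeg A * matDeg B :=
  Prod.Lex.toLex_mono <| Prod.mk_le_mk.2
    ⟨PNat.le_of_dvd (PNat.dvd_iff.2 (matDen_mul_dvd A B)),
      PNat.le_of_dvd (PNat.dvd_iff.2 (matDen_minors_mul_dvd A B))⟩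

theorem matDeg_eq_one {M : Matrix m n ℚ} (h : ∀ i j, M i j ∈ intSubring) : matDeg M = 1 :=
  matDeg_eq_toLex_iff.2 ⟨matDen_eq_one h, matDen_eq_one (minors_mem_intSubring h)⟩

/-- The diagonal entries of `diagMat a b`. -/
def diagEntries (a b : ℚ) : Fin 5 → ℚ := ![a⁻¹, b⁻¹, 1, b, a]

/-- The diagonal matrix `diag(1/a, 1/b, 1, b, a)`; for `b ∣ a` these represent the double cosets. -/
def diagMat (a b : ℚ) : Matrix (Fin 5) (Fin 5) ℚ :=
  diagonal (diagEntries a b)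

theorem diagMat_mul_diagMat (a b a' b' : ℚ) :
    diagMat a b * diagMat a' b' = diagMat (a * a') (b * b') := by
  rw [diagMat, diagMat, diagonal_mul_diagonal, diagMat]
  congr 1
  ext i
  fin_cases i <;> simp [diagEntries, mul_comm]

theorem diagMat_one : diagMat 1 1 = 1 := by
  rw [diagMat, ← diagonal_one]
  congr 1
  ext i
  fin_cases i <;> simp [diagEntries]

section DiagMat

variable {a b : ℕ+}

theorem natCast_mul_diagEntries_mem (hab : b ∣ a) (i : Fin 5) :
    ((a : ℕ) : ℚ) * diagEntries a b i ∈ intSubring := by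
  obtain ⟨c, rfl⟩ := hab
  fin_cases i
  · exact ⟨1, Int.cast_one.trans (mul_inv_cancel₀ (Nat.cast_ne_zero.2 (b * c).ne_zero)).symm⟩
  · exact ⟨c, by simp [diagEntries, mul_right_comm]⟩
  · exact ⟨b * c, by simp [diagEntries]⟩
  · exact ⟨b * c * b, by simp [diagEntries]⟩
  · exact ⟨b * c * (b * c), by simp [diagEntries]⟩

theorem natCast_mul_diagEntries_mem_of_ne_zero {i : Fin 5} (hi : i ≠ 0) :
    ((b : ℕ) : ℚ) * diagEntries a b i ∈ intSubring := by
  fin_cases i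
  · exact absurd rfl hi
  · exact ⟨1, by simp [diagEntries]⟩
  · exact ⟨b, by simp [diagEntries]⟩
  · exact ⟨b * b, by simp [diagEntries]⟩
  · exact ⟨b * a, by simp [diagEntries]⟩

theorem mul_mul_diagEntries_mem (hab : b ∣ a) {i j : Fin 5} (hij : i ≠ j) :
    ((a : ℕ) * (b : ℕ) : ℚ) * (diagEntries a b i * diagEntries a b j) ∈ intSubring := by
  wlog hj : j ≠ 0 generalizing i j
  · rw [mul_comm (diagEntries a b i)]
    exact this hij.symm (not_not.1 hj ▸ hij)
  rw [mul_mul_mul_comm]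
  exact mul_mem (natCast_mul_diagEntries_mem hab i) (natCast_mul_diagEntries_mem_of_ne_zero hj)

theorem matDen_diagMat (hab : b ∣ a) : matDen (diagMat a b) = a := by
  refine Nat.dvd_antisymm (matDen_dvd_iff.2 fun i j => ?_) ?_
  · rw [diagMat, diagonal_apply]
    split_ifs
    · exact natCast_mul_diagEntries_mem hab i
    · simp
  · have h := natCast_mul_mem_intSubring.1 (matDen_mul_mem (diagMat a b) 0 0)
    have hentry : diagMat a b 0 0 = (a : ℚ)⁻¹ := rfl
    rwa [hentry, Rat.inv_natCast_den_of_pos a.pos] at h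

theorem matDen_minors_diagMat (hab : b ∣ a) : matDen (minors (diagMat a b)) = a * b := by
  refine Nat.dvd_antisymm (matDen_dvd_iff.2 fun i j => ?_) ?_
  · obtain ⟨i, i'⟩ := i
    rw [diagMat, minors_diagonal, ← mul_assoc, Nat.cast_mul]
    obtain rfl | hi := eq_or_ne i i'
    · rw [minors_self, mul_zero]
      exact zero_mem _
    · refine mul_mem (mul_mul_diagEntries_mem hab hi) (minors_mem_intSubring (fun i j => ?_) _ _)
      rw [one_apply]
      split_ifs <;> simp
  · have h := natCast_mul_mem_intSubring.1 (matDen_mul_mem (minors (diagMat a b)) (0, 1) (0, 1))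
    have hentry : minors (diagMat a b) (0, 1) (0, 1) = ((a * b : ℕ) : ℚ)⁻¹ := by
      simp [minors, diagMat, diagEntries, mul_comm]
    rwa [hentry, Rat.inv_natCast_den_of_pos (Nat.mul_pos a.pos b.pos)] at h

theorem matDeg_diagMat (hab : b ∣ a) : matDeg (diagMat a b) = toLex (a, a * b) :=
  matDeg_eq_toLex_iff.2 ⟨matDen_diagMat hab, matDen_minors_diagMat hab⟩

end DiagMat

end Degree

section Similitudes

variable {R S : Type*} [CommRing R] [CommRing S] {n c c' : R} {A B : Matrix (Fin 5) (Fin 5) R}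

/-- The Gram matrix `Ŝ` over a commutative ring. -/
def gram (n : R) : Matrix (Fin 5) (Fin 5) R :=
  !![0, 0, 0, 0, 1;
     0, 0, 0, 1, 0;
     0, 0, -2 * n, 0, 0;
     0, 1, 0, 0, 0;
     1, 0, 0, 0, 0]

/-- `2 n` times the inverse of the Gram matrix. -/
def cogram (n : R) : Matrix (Fin 5) (Fin 5) R :=
  !![0, 0, 0, 0, 2 * n;
     0, 0, 0, 2 * n, 0;
     0, 0, -1, 0, 0;
     0, 2 * n, 0, 0, 0;
     2 * n, 0, 0, 0, 0]

/-- The quadratic form `x₀ x₄ + x₁ x₃ - n x₂²`, whose Gram matrix is `gram n`. -/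
def quad (n : R) (v : Fin 5 → R) : R :=
  v 0 * v 4 + v 1 * v 3 - n * v 2 ^ 2

/-- A similitude of the form `quad n` with multiplier `c`; the isometries are those with `c = 1`. -/
def IsSimilitude (n c : R) (A : Matrix (Fin 5) (Fin 5) R) : Prop :=
  Aᵀ * gram n * A = c • gram n

theorem map_gram (f : R →+* S) (n : R) : (gram n).map f = gram (f n) := by
  ext i j
  fin_cases i <;> fin_cases j <;> simp [gram, map_ofNat]

theorem cogram_mul_gram (n : R) :
    cogram n * gram n = (2 * n) • (1 : Matrix (Fin 5) (Fin 5) R) := by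
  ext i j
  fin_cases i <;> fin_cases j <;> simp [cogram, gram, Matrix.mul_apply, Fin.sum_univ_succ]

theorem gram_mul_cogram (n : R) :
    gram n * cogram n = (2 * n) • (1 : Matrix (Fin 5) (Fin 5) R) := by
  ext i j
  fin_cases i <;> fin_cases j <;> simp [cogram, gram, Matrix.mul_apply, Fin.sum_univ_succ]

theorem two_mul_quad (n : R) (v : Fin 5 → R) : 2 * quad n v = v ⬝ᵥ gram n *ᵥ v := by
  simp only [quad, gram, dotProduct, mulVec, Fin.sum_univ_five, of_apply, cons_val', cons_val]
  ring

theorem mul_eq_smul_one_comm [IsDomain R] {m : Type*} [Fintype m] [DecidableEq m]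
    {A B : Matrix m m R} (hc : c ≠ 0) (h : A * B = c • 1) : B * A = c • 1 := by
  have hdet : A.det ≠ 0 := by
    intro h0
    have := congrArg det h
    rw [det_mul, h0, zero_mul, det_smul, det_one, mul_one] at this
    exact pow_ne_zero _ hc this.symm
  refine (isRegular_of_isLeftRegular_det (IsRegular.of_ne_zero hdet).left).left ?_
  simp only [← Matrix.mul_assoc, h, smul_one_mul, mul_smul_one]

namespace IsSimilitude

protected theorem mul (hA : IsSimilitude n c A) (hB : IsSimilitude n c' B) :
    IsSimilitude n (c * c') (A * B) :=
  calc (A * B)ᵀ * gram n * (A * B) = Bᵀ * (Aᵀ * gram n * A) * B := by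
        simp only [transpose_mul, Matrix.mul_assoc]
    _ = (c * c') • gram n := by rw [hA, Matrix.mul_smul, Matrix.smul_mul, hB, smul_smul]

theorem smul (hA : IsSimilitude n c A) (d : R) : IsSimilitude n (d ^ 2 * c) (d • A) := by
  rw [IsSimilitude, transpose_smul, Matrix.smul_mul, Matrix.smul_mul, Matrix.mul_smul, hA,
    smul_smul, smul_smul, mul_assoc, pow_two, mul_assoc]

theorem map_iff {f : R →+* S} (hf : Function.Injective f) :
    IsSimilitude (f n) (f c) (A.map f) ↔ IsSimilitude n c A := by
  have hsmul : (c • gram n).map f = f c • gram (f n) := by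
    rw [← map_gram f n]
    ext i j
    simp only [map_apply, Matrix.smul_apply, smul_eq_mul, map_mul]
  rw [IsSimilitude, IsSimilitude, ← hsmul, ← map_gram f, ← transpose_map, ← Matrix.map_mul,
    ← Matrix.map_mul, (Matrix.map_injective hf).eq_iff]

theorem column_relation (hA : IsSimilitude n c A) (j k : Fin 5) :
    A 0 j * A 4 k + A 1 j * A 3 k - 2 * n * A 2 j * A 2 k + A 3 j * A 1 k + A 4 j * A 0 k =
      c * gram n j k := by
  rw [show c * gram n j k = (c • gram n) j k from rfl, ← hA]
  simp only [Matrix.mul_apply, gram, Fin.sum_univ_five, of_apply, cons_val', cons_val,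
    transpose_apply]
  ring

theorem quad_mulVec [IsDomain R] [CharZero R] (hA : IsSimilitude n c A) (v : Fin 5 → R) :
    quad n (A *ᵥ v) = c * quad n v := by
  refine mul_left_cancel₀ (two_ne_zero' R) ?_
  rw [mul_left_comm, two_mul_quad, two_mul_quad]
  have : A *ᵥ v ⬝ᵥ gram n *ᵥ A *ᵥ v = v ⬝ᵥ (Aᵀ * gram n * A) *ᵥ v := by
    rw [← mulVec_mulVec, ← mulVec_mulVec, dotProduct_mulVec v, vecMul_transpose]
  rw [this, hA, smul_mulVec, dotProduct_smul, smul_eq_mul]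

theorem mul_cogram_mul_transpose [IsDomain R] (hn : 2 * n ≠ 0) (hc : c ≠ 0)
    (hA : IsSimilitude n c A) : A * cogram n * Aᵀ = c • cogram n := by
  have h1 : (cogram n * Aᵀ * gram n) * A = (c * (2 * n)) • 1 := by
    rw [Matrix.mul_assoc (cogram n), Matrix.mul_assoc (cogram n), hA, Matrix.mul_smul,
      cogram_mul_gram, smul_smul]
  have h2 := congrArg (· * cogram n) (mul_eq_smul_one_comm (mul_ne_zero hc hn) h1)
  refine smul_right_injective _ hn ?_
  simp only [Matrix.mul_assoc, gram_mul_cogram, Matrix.mul_smul, Matrix.mul_one,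
    smul_one_mul] at h2
  simpa only [Matrix.mul_assoc, smul_smul, mul_comm c] using h2

theorem row_relation [IsDomain R] (hn : 2 * n ≠ 0) (hc : c ≠ 0) (hA : IsSimilitude n c A)
    (j k : Fin 5) :
    2 * n * (A j 0 * A k 4 + A j 1 * A k 3 + A j 3 * A k 1 + A j 4 * A k 0) - A j 2 * A k 2 =
      c * cogram n j k := by
  rw [show c * cogram n j k = (c • cogram n) j k from rfl, ← hA.mul_cogram_mul_transpose hn hc]
  simp only [Matrix.mul_apply, cogram, Fin.sum_univ_five, of_apply, cons_val', cons_val,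
    transpose_apply]
  ring

end IsSimilitude

end Similitudes

section Generators

variable {R : Type*} [CommRing R]

/-- The Eichler transformation fixing the last basis vector `e₄`. -/
def eichlerLower (n a b c : R) : Matrix (Fin 5) (Fin 5) R :=
  !![1, 0, 0, 0, 0;
     a, 1, 0, 0, 0;
     c, 0, 1, 0, 0;
     b, 0, 0, 1, 0;
     n * c ^ 2 - a * b, -b, 2 * n * c, -a, 1]

/-- The Eichler transformation fixing the first basis vector `e₀`. -/
def eichlerUpper (n a b c : R) : Matrix (Fin 5) (Fin 5) R :=
  !![1, -a, 2 * n * c, -b, n * c ^ 2 - a * b;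
     0, 1, 0, 0, b;
     0, 0, 1, 0, c;
     0, 0, 0, 1, a;
     0, 0, 0, 0, 1]

/-- The matrix `(d α, β; d d' γ, d δ)`, acting by conjugation on the ternary form
`x₁ x₃ - d d' x₂²`. For `d = 1` it is an element of `Γ₀(d')`, in general an Atkin–Lehner
involution. -/
def atkinLehner (d d' α β γ δ : R) : Matrix (Fin 5) (Fin 5) R :=
  !![1, 0, 0, 0, 0;
     0, d * α ^ 2, 2 * d * d' * α * β, d' * β ^ 2, 0;
     0, α * γ, d * α * δ + d' * β * γ, β * δ, 0;
     0, d' * γ ^ 2, 2 * d * d' * γ * δ, d * δ ^ 2, 0;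
     0, 0, 0, 0, 1]

/-- The Weyl reflection exchanging `s` and `t` in `diag(eˢ, eᵗ, 1, e⁻ᵗ, e⁻ˢ)`. -/
def weylSub : Matrix (Fin 5) (Fin 5) R :=
  !![0, 1, 0, 0, 0;
     -1, 0, 0, 0, 0;
     0, 0, 1, 0, 0;
     0, 0, 0, 0, -1;
     0, 0, 0, 1, 0]

/-- The Weyl reflection exchanging `s` and `-t` in `diag(eˢ, eᵗ, 1, e⁻ᵗ, e⁻ˢ)`. -/
def weylAdd : Matrix (Fin 5) (Fin 5) R :=
  !![0, 0, 0, 1, 0;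
     0, 0, 0, 0, -1;
     0, 0, 1, 0, 0;
     -1, 0, 0, 0, 0;
     0, 1, 0, 0, 0]

theorem det_eichlerLower (n a b c : R) : (eichlerLower n a b c).det = 1 := by
  simp [eichlerLower, det_succ_row_zero, Fin.sum_univ_succ, Fin.succAbove, submatrix]

theorem det_eichlerUpper (n a b c : R) : (eichlerUpper n a b c).det = 1 := by
  simp [eichlerUpper, det_succ_row_zero, Fin.sum_univ_succ, Fin.succAbove, submatrix]

theorem det_atkinLehner (d d' α β γ δ : R) :
    (atkinLehner d d' α β γ δ).det = (d * α * δ - d' * β * γ) ^ 3 := by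
  simp [atkinLehner, det_succ_row_zero, Fin.sum_univ_succ, Fin.succAbove, submatrix]
  ring

theorem weylSub_eq_mul (n : R) :
    weylSub = eichlerUpper n (-1) 0 0 * eichlerLower n (-1) 0 0 * eichlerUpper n (-1) 0 0 := by
  ext i j
  fin_cases i <;> fin_cases j <;>
    simp [weylSub, eichlerUpper, eichlerLower, Matrix.mul_apply, Fin.sum_univ_succ]

theorem weylAdd_eq_mul (n : R) :
    weylAdd = eichlerUpper n 0 (-1) 0 * eichlerLower n 0 (-1) 0 * eichlerUpper n 0 (-1) 0 := by
  ext i j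
  fin_cases i <;> fin_cases j <;>
    simp [weylAdd, eichlerUpper, eichlerLower, Matrix.mul_apply, Fin.sum_univ_succ]

theorem isSimilitude_eichlerLower (n a b c : R) : IsSimilitude n 1 (eichlerLower n a b c) := by
  ext i j
  fin_cases i <;> fin_cases j <;>
    simp [eichlerLower, gram, Matrix.mul_apply, Fin.sum_univ_succ] <;> ring

theorem isSimilitude_eichlerUpper (n a b c : R) : IsSimilitude n 1 (eichlerUpper n a b c) := by
  ext i j
  fin_cases i <;> fin_cases j <;>
    simp [eichlerUpper, gram, Matrix.mul_apply, Fin.sum_univ_succ] <;> ring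

theorem isSimilitude_atkinLehner {d d' α β γ δ : R} (h : d * α * δ - d' * β * γ = 1) :
    IsSimilitude (d * d') 1 (atkinLehner d d' α β γ δ) := by
  have h2 : (d * α * δ - d' * β * γ) ^ 2 = 1 := by rw [h, one_pow]
  ext i j
  fin_cases i <;> fin_cases j <;>
    simp only [atkinLehner, gram, Matrix.mul_apply, Fin.sum_univ_five, transpose_apply, of_apply,
      cons_val', cons_val, Fin.zero_eta, Fin.mk_one, Fin.reduceFinMk, Matrix.smul_apply,
      smul_eq_mul]
  all_goals first | ring1 | linear_combination h2 | linear_combination (-(2 * d * d')) * h2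

theorem atkinLehner_mul (n α β γ δ α' β' γ' δ' : R) :
    atkinLehner 1 n α β γ δ * atkinLehner 1 n α' β' γ' δ' =
      atkinLehner 1 n (α * α' + n * β * γ') (α * β' + β * δ') (γ * α' + δ * γ')
        (n * γ * β' + δ * δ') := by
  ext i j
  fin_cases i <;> fin_cases j <;>
    simp [atkinLehner, Matrix.mul_apply, Fin.sum_univ_succ] <;> ring

end Generators

section IdentityComponent

variable {R S : Type*} [CommRing R] [CommRing S] [Algebra R ℝ] [Algebra R S] [Algebra S ℝ]
  [IsScalarTower R S ℝ] {N : ℕ} {A B : Matrix (Fin 5) (Fin 5) R}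

/-- A matrix over a ring of real numbers that lies in `SO₀(Ŝ_N; ℝ)`. -/
def IsSO0 (N : ℕ) (A : Matrix (Fin 5) (Fin 5) R) : Prop :=
  ∃ g ∈ SO0Real N, g.1 = A.map (algebraMap R ℝ)

theorem isSO0_map_iff : IsSO0 N (A.map (algebraMap R S)) ↔ IsSO0 N A := by
  simp only [IsSO0, Matrix.map_map, ← RingHom.coe_comp, ← IsScalarTower.algebraMap_eq]

namespace IsSO0

protected theorem one : IsSO0 N (1 : Matrix (Fin 5) (Fin 5) R) :=
  ⟨1, one_mem _, (Matrix.map_one _ (map_zero _) (map_one _)).symm⟩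

protected theorem mul (hA : IsSO0 N A) (hB : IsSO0 N B) : IsSO0 N (A * B) := by
  obtain ⟨a, ha, ha'⟩ := hA
  obtain ⟨b, hb, hb'⟩ := hB
  exact ⟨a * b, mul_mem ha hb, by rw [Matrix.map_mul, ← ha', ← hb']; rfl⟩

theorem isSimilitude [FaithfulSMul R ℝ] (hA : IsSO0 N A) : IsSimilitude (N : R) 1 A := by
  obtain ⟨-, ⟨g, -, rfl⟩, hg⟩ := hA
  have h : IsSimilitude (N : ℝ) 1 g.1.1 := (g.2 : _).trans (one_smul _ _).symm
  rwa [← IsSimilitude.map_iff (FaithfulSMul.algebraMap_injective R ℝ), map_natCast, map_one, ← hg]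

theorem det_eq_one [FaithfulSMul R ℝ] (hA : IsSO0 N A) : A.det = 1 := by
  obtain ⟨g, -, hg⟩ := hA
  refine FaithfulSMul.algebraMap_injective R ℝ ?_
  rw [RingHom.map_det, RingHom.mapMatrix_apply, ← hg, map_one]
  exact g.2

theorem adjugate (hA : IsSO0 N A) : IsSO0 N A.adjugate := by
  obtain ⟨g, hg, hA⟩ := hA
  refine ⟨g⁻¹, inv_mem hg, ?_⟩
  rw [← RingHom.mapMatrix_apply] at hA ⊢
  exact (Matrix.SpecialLinearGroup.coe_inv g).trans (by rw [hA, RingHom.map_adjugate])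

theorem exists_inv [FaithfulSMul R ℝ] (hA : IsSO0 N A) : ∃ B, IsSO0 N B ∧ A * B = 1 ∧ B * A = 1 :=
  ⟨A.adjugate, hA.adjugate, by rw [mul_adjugate, hA.det_eq_one, one_smul],
    by rw [adjugate_mul, hA.det_eq_one, one_smul]⟩

end IsSO0

theorem isSO0_of_path {f : ℝ → Matrix (Fin 5) (Fin 5) ℝ} (hc : Continuous f) (h0 : f 0 = 1)
    (hS : ∀ t, IsSimilitude (N : ℝ) 1 (f t)) (hdet : ∀ t, (f t).det = 1) (t : ℝ) :
    IsSO0 N (f t) := by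
  let F : ℝ → SOReal N := fun t => ⟨⟨f t, hdet t⟩, (hS t).trans (one_smul _ _)⟩
  have hF : Continuous F := Continuous.subtype_mk (Continuous.subtype_mk hc _) _
  have h1 : F 0 = 1 := Subtype.ext (Subtype.ext h0)
  exact ⟨(F t).1, ⟨F t, (isPreconnected_range hF).subset_connectedComponent ⟨0, h1⟩ ⟨t, rfl⟩, rfl⟩,
    (Matrix.map_id _).symm⟩

theorem isSO0_eichlerLower (a b c : R) : IsSO0 N (eichlerLower (N : R) a b c) := by
  rw [← isSO0_map_iff (S := ℝ)]
  have hmap : (eichlerLower (N : R) a b c).map (algebraMap R ℝ) =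
      eichlerLower (N : ℝ) (1 * algebraMap R ℝ a) (1 * algebraMap R ℝ b)
        (1 * algebraMap R ℝ c) := by
    ext i j
    fin_cases i <;> fin_cases j <;> simp [eichlerLower, map_ofNat]
  rw [hmap]
  refine isSO0_of_path (f := fun t => eichlerLower (N : ℝ) (t * _) (t * _) (t * _)) ?_ ?_
    (fun _ => isSimilitude_eichlerLower ..) (fun _ => det_eichlerLower ..) 1
  · unfold eichlerLower
    fun_prop
  · ext i j
    fin_cases i <;> fin_cases j <;> simp [eichlerLower]

theorem isSO0_eichlerUpper (a b c : R) : IsSO0 N (eichlerUpper (N : R) a b c) := by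
  rw [← isSO0_map_iff (S := ℝ)]
  have hmap : (eichlerUpper (N : R) a b c).map (algebraMap R ℝ) =
      eichlerUpper (N : ℝ) (1 * algebraMap R ℝ a) (1 * algebraMap R ℝ b)
        (1 * algebraMap R ℝ c) := by
    ext i j
    fin_cases i <;> fin_cases j <;> simp [eichlerUpper, map_ofNat]
  rw [hmap]
  refine isSO0_of_path (f := fun t => eichlerUpper (N : ℝ) (t * _) (t * _) (t * _)) ?_ ?_
    (fun _ => isSimilitude_eichlerUpper ..) (fun _ => det_eichlerUpper ..) 1
  · unfold eichlerUpper
    fun_prop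
  · ext i j
    fin_cases i <;> fin_cases j <;> simp [eichlerUpper]

theorem isSO0_weylSub : IsSO0 N (weylSub : Matrix (Fin 5) (Fin 5) R) := by
  rw [weylSub_eq_mul (N : R)]
  exact ((isSO0_eichlerUpper _ _ _).mul (isSO0_eichlerLower _ _ _)).mul (isSO0_eichlerUpper _ _ _)

theorem isSO0_weylAdd : IsSO0 N (weylAdd : Matrix (Fin 5) (Fin 5) R) := by
  rw [weylAdd_eq_mul (N : R)]
  exact ((isSO0_eichlerUpper _ _ _).mul (isSO0_eichlerLower _ _ _)).mul (isSO0_eichlerUpper _ _ _)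

theorem isSO0_atkinLehner_upper (t : ℝ) : IsSO0 N (atkinLehner 1 (N : ℝ) 1 t 0 1) := by
  refine isSO0_of_path (f := fun t => atkinLehner 1 (N : ℝ) 1 t 0 1) ?_ ?_ (fun t => ?_)
    (fun t => ?_) t
  · unfold atkinLehner
    fun_prop
  · ext i j
    fin_cases i <;> fin_cases j <;> simp [atkinLehner]
  · simpa only [one_mul] using isSimilitude_atkinLehner (d := 1) (d' := (N : ℝ)) (by ring)
  · rw [det_atkinLehner]
    ring

theorem isSO0_atkinLehner_lower (t : ℝ) : IsSO0 N (atkinLehner 1 (N : ℝ) 1 0 t 1) := by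
  refine isSO0_of_path (f := fun t => atkinLehner 1 (N : ℝ) 1 0 t 1) ?_ ?_ (fun t => ?_)
    (fun t => ?_) t
  · unfold atkinLehner
    fun_prop
  · ext i j
    fin_cases i <;> fin_cases j <;> simp [atkinLehner]
  · simpa only [one_mul] using isSimilitude_atkinLehner (d := 1) (d' := (N : ℝ)) (by ring)
  · rw [det_atkinLehner]
    ring

theorem isSO0_atkinLehner_diagonal {t : ℝ} (ht : t ≠ 0) :
    IsSO0 N (atkinLehner 1 (N : ℝ) t 0 0 t⁻¹) := by
  have h2 : (0 : ℝ) < t ^ 2 := by positivity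
  refine ⟨_, torus_mem N (0, Real.log (t ^ 2)), ?_⟩
  change diagonal _ = _
  ext i j
  fin_cases i <;> fin_cases j <;>
    simp [atkinLehner, -Real.log_pow, Real.exp_neg, Real.exp_log h2, ht]

theorem isSO0_atkinLehner_of_ne_zero {α β γ δ : ℝ} (hα : α ≠ 0) (h : α * δ - N * β * γ = 1) :
    IsSO0 N (atkinLehner 1 (N : ℝ) α β γ δ) := by
  have key := ((isSO0_atkinLehner_lower (N := N) (γ / α)).mul (isSO0_atkinLehner_diagonal hα)).mul
    (isSO0_atkinLehner_upper (β / α))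
  rw [atkinLehner_mul, atkinLehner_mul] at key
  have hδ : δ = (1 + N * β * γ) / α := by
    rw [eq_div_iff hα]
    linear_combination h
  convert key using 1
  rw [hδ]
  congr 1 <;> field_simp <;> ring

theorem isSO0_atkinLehner_one {α β γ δ : ℝ} (h : α * δ - N * β * γ = 1) :
    IsSO0 N (atkinLehner 1 (N : ℝ) α β γ δ) := by
  rcases ne_or_eq α 0 with hα | rfl
  · exact isSO0_atkinLehner_of_ne_zero hα h
  have hγ : -(N * γ) ≠ 0 := by
    intro h0
    exact one_ne_zero (α := ℝ) (by linear_combination -h + β * h0)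
  have key := (isSO0_atkinLehner_upper (N := N) 1).mul (isSO0_atkinLehner_of_ne_zero
    (α := -(N * γ)) (β := β - δ) (γ := γ) (δ := δ) hγ (by linear_combination h))
  rw [atkinLehner_mul] at key
  convert key using 1
  congr 1 <;> ring

theorem isSO0_atkinLehner {d d' α β γ δ : R} (hd : 0 < algebraMap R ℝ d) (hN : d * d' = N)
    (h : d * α * δ - d' * β * γ = 1) : IsSO0 N (atkinLehner d d' α β γ δ) := by
  rw [← isSO0_map_iff (S := ℝ)]
  replace hN := congrArg (algebraMap R ℝ) hN
  replace h := congrArg (algebraMap R ℝ) h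
  simp only [map_mul, map_sub, map_one, map_natCast] at hN h
  obtain ⟨s, hs, hs0⟩ : ∃ s : ℝ, s ^ 2 = algebraMap R ℝ d ∧ s ≠ 0 :=
    ⟨_, Real.sq_sqrt hd.le, (Real.sqrt_pos.2 hd).ne'⟩
  -- Rescaling by `√d` turns the Atkin–Lehner element into an element of `SL₂(ℝ)`.
  convert isSO0_atkinLehner_one (N := N) (α := s * algebraMap R ℝ α) (β := algebraMap R ℝ β / s)
    (γ := algebraMap R ℝ γ / s) (δ := s * algebraMap R ℝ δ) ?_ using 1
  · rw [← hN, ← hs]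
    ext i j
    fin_cases i <;> fin_cases j <;> simp [atkinLehner, ← hs, map_ofNat] <;> field_simp
  · rw [← hN, ← h, ← hs]
    field_simp

end IdentityComponent

section Transitivity

variable {N : ℕ} {u v w : Fin 5 → ℤ}

/-- `w` lies in the `SO₀(Ŝ_N; ℤ)`-orbit of `v`. -/
def OrbitRel (N : ℕ) (v w : Fin 5 → ℤ) : Prop :=
  ∃ A : Matrix (Fin 5) (Fin 5) ℤ, IsSO0 N A ∧ A *ᵥ v = w

/-- A primitive integral vector. -/
def Primitive {ι : Type*} (v : ι → ℤ) : Prop :=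
  ∀ k : ℤ, (∀ i, k ∣ v i) → IsUnit k

theorem dvd_mulVec {m n : Type*} [Fintype n] {k : ℤ} {v : n → ℤ} (h : ∀ i, k ∣ v i)
    (A : Matrix m n ℤ) (i : m) : k ∣ (A *ᵥ v) i :=
  Finset.dvd_sum fun j _ => (h j).mul_left _

namespace OrbitRel

protected theorem refl (v : Fin 5 → ℤ) : OrbitRel N v v := ⟨1, IsSO0.one, one_mulVec v⟩

protected theorem trans (h : OrbitRel N u v) (h' : OrbitRel N v w) : OrbitRel N u w := by
  obtain ⟨A, hA, rfl⟩ := h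
  obtain ⟨B, hB, rfl⟩ := h'
  exact ⟨B * A, hB.mul hA, (mulVec_mulVec ..).symm⟩

protected theorem symm (h : OrbitRel N v w) : OrbitRel N w v := by
  obtain ⟨A, hA, rfl⟩ := h
  obtain ⟨B, hB, -, hBA⟩ := hA.exists_inv
  exact ⟨B, hB, by rw [mulVec_mulVec, hBA, one_mulVec]⟩

theorem quad_eq (h : OrbitRel N v w) : quad (N : ℤ) w = quad (N : ℤ) v := by
  obtain ⟨A, hA, rfl⟩ := h
  rw [hA.isSimilitude.quad_mulVec, one_mul]

theorem primitive (h : OrbitRel N v w) (hv : Primitive v) : Primitive w := by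
  obtain ⟨B, -, rfl⟩ := h.symm
  exact fun k hk => hv k (dvd_mulVec hk B)

end OrbitRel

theorem orbitRel_eichlerLower (a b c : ℤ) (v : Fin 5 → ℤ) :
    OrbitRel N v ![v 0, v 1 + a * v 0, v 2 + c * v 0, v 3 + b * v 0,
      v 4 - a * v 3 - b * v 1 + 2 * N * c * v 2 + (N * c ^ 2 - a * b) * v 0] :=
  ⟨_, isSO0_eichlerLower a b c, by
    ext i
    fin_cases i <;> simp [eichlerLower, mulVec, dotProduct, Fin.sum_univ_succ] <;> ring⟩

theorem orbitRel_weylSub (v : Fin 5 → ℤ) : OrbitRel N v ![v 1, -v 0, v 2, -v 4, v 3] :=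
  ⟨_, isSO0_weylSub, by
    ext i
    fin_cases i <;> simp [weylSub, mulVec, dotProduct, Fin.sum_univ_succ]⟩

theorem orbitRel_weylAdd (v : Fin 5 → ℤ) : OrbitRel N v ![v 3, -v 4, v 2, -v 0, v 1] :=
  ⟨_, isSO0_weylAdd, by
    ext i
    fin_cases i <;> simp [weylAdd, mulVec, dotProduct, Fin.sum_univ_succ]⟩

theorem exists_orbitRel_apply_zero_ne_zero (hN : N ≠ 0) (hv : v ≠ 0) (hq : quad (N : ℤ) v = 0) :
    ∃ w, OrbitRel N v w ∧ w 0 ≠ 0 := by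
  by_contra! h
  have h0 : v 0 = 0 := h v (OrbitRel.refl v)
  have h1 : v 1 = 0 := h _ (orbitRel_weylSub v)
  have h3 : v 3 = 0 := h _ (orbitRel_weylAdd v)
  have h4 : v 4 = 0 := neg_eq_zero.1 (h _ ((orbitRel_weylSub v).trans (orbitRel_weylAdd _)))
  have h2 : v 2 = 0 := by simpa [quad, h0, h1, h3, h4, hN] using hq
  refine hv (funext fun i => ?_)
  fin_cases i
  exacts [h0, h1, h2, h3, h4]

theorem exists_orbitRel_minimal (hN : N ≠ 0) (hv : v ≠ 0) (hq : quad (N : ℤ) v = 0) :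
    ∃ w, OrbitRel N v w ∧ w 0 ≠ 0 ∧ ∀ u, OrbitRel N w u → u 0 ≠ 0 → |w 0| ≤ |u 0| := by
  obtain ⟨w, ⟨hvw, hw0⟩, hmin⟩ := (measure fun w : Fin 5 → ℤ => (w 0).natAbs).wf.has_min
    {w | OrbitRel N v w ∧ w 0 ≠ 0} (exists_orbitRel_apply_zero_ne_zero hN hv hq)
  refine ⟨w, hvw, hw0, fun u hwu hu0 => ?_⟩
  have := hmin u ⟨hvw.trans hwu, hu0⟩
  rw [Int.abs_eq_natAbs, Int.abs_eq_natAbs]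
  exact_mod_cast not_lt.1 this

/-- Division with remainder: a multiple of `w 0` can be subtracted from `x` without leaving the
orbit, and the remainder cannot be smaller than `w 0`. -/
theorem dvd_of_minimal (hmin : ∀ u, OrbitRel N w u → u 0 ≠ 0 → |w 0| ≤ |u 0|) (hw0 : w 0 ≠ 0)
    {x : ℤ} (h : ∀ q, ∃ u, OrbitRel N w u ∧ |u 0| = |x - q * w 0|) : w 0 ∣ x := by
  obtain ⟨u, hwu, hu⟩ := h (x / w 0)
  have hrem : x - x / w 0 * w 0 = x % w 0 := by
    rw [Int.emod_def, mul_comm]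
  rw [hrem, abs_of_nonneg (Int.emod_nonneg x hw0)] at hu
  by_contra hx
  have hu0 : u 0 ≠ 0 := by
    rw [← abs_ne_zero, hu]
    exact fun h0 => hx (Int.dvd_of_emod_eq_zero h0)
  exact (Int.emod_lt_abs x hw0).not_ge ((hmin u hwu hu0).trans_eq hu)

theorem dvd_of_quad_eq_zero {n : ℤ} (hn : Squarefree n) (hq : quad n v = 0) {k : ℤ}
    (h04 : k ^ 2 ∣ v 0 * v 4) (h13 : k ^ 2 ∣ v 1 * v 3) : k ∣ v 2 := by
  refine dvd_of_sq_dvd_mul_sq hn ?_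
  rw [← sub_eq_zero.1 hq]
  exact dvd_add h04 h13

theorem dvd_apply_of_minimal (hN : Squarefree N) (hw0 : w 0 ≠ 0)
    (hmin : ∀ u, OrbitRel N w u → u 0 ≠ 0 → |w 0| ≤ |u 0|) (hq : quad (N : ℤ) w = 0) (i : Fin 5) :
    w 0 ∣ w i := by
  have h1 : w 0 ∣ w 1 := dvd_of_minimal hmin hw0 fun q =>
    ⟨_, (orbitRel_eichlerLower (-q) 0 0 w).trans (orbitRel_weylSub _), by
      simp only [cons_val, neg_mul, ← sub_eq_add_neg]⟩
  have h3 : w 0 ∣ w 3 := dvd_of_minimal hmin hw0 fun q =>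
    ⟨_, (orbitRel_eichlerLower 0 (-q) 0 w).trans (orbitRel_weylAdd _), by
      simp only [cons_val, neg_mul, ← sub_eq_add_neg]⟩
  have h4 : w 0 ∣ w 4 := by
    obtain ⟨k, hk⟩ := h1
    obtain ⟨l, hl⟩ := h3
    refine dvd_of_minimal hmin hw0 fun q => ⟨_, ((orbitRel_eichlerLower (1 - k) (q + k * l - l) 0
      w).trans (orbitRel_weylSub _)).trans (orbitRel_weylAdd _), ?_⟩
    simp only [cons_val, abs_neg, hk, hl]
    ring_nf
  have h2 : w 0 ∣ w 2 := dvd_of_quad_eq_zero (Int.squarefree_natCast.2 hN) hq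
    (pow_two (w 0) ▸ mul_dvd_mul_left _ h4) (pow_two (w 0) ▸ mul_dvd_mul h1 h3)
  fin_cases i
  exacts [dvd_rfl, h1, h2, h3, h4]

theorem orbitRel_single_of_isUnit (hw0 : IsUnit (w 0)) (hq : quad (N : ℤ) w = 0) :
    OrbitRel N w (Pi.single 0 1) := by
  have hsq : w 0 * w 0 = 1 := Int.isUnit_mul_self hw0
  have hlead : OrbitRel N w ![w 0, 0, 0, 0, 0] := by
    convert orbitRel_eichlerLower (-(w 0 * w 1)) (-(w 0 * w 3)) (-(w 0 * w 2)) w using 1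
    rw [quad] at hq
    ext i
    fin_cases i <;> simp only [Fin.zero_eta, Fin.mk_one, Fin.reduceFinMk, cons_val]
    · linear_combination w 1 * hsq
    · linear_combination w 2 * hsq
    · linear_combination w 3 * hsq
    · linear_combination -w 0 * hq + (w 4 + w 0 * (w 1 * w 3 - N * w 2 ^ 2)) * hsq
  refine hlead.trans ?_
  rcases Int.isUnit_iff.1 hw0 with h | h
  · convert OrbitRel.refl (N := N) _
    ext i
    fin_cases i <;> simp [h]
  · convert (orbitRel_weylSub (N := N) _).trans (orbitRel_weylSub _)
    ext i
    fin_cases i <;> simp [h]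

theorem orbitRel_single (hN : Squarefree N) (hv : Primitive v) (hq : quad (N : ℤ) v = 0) :
    OrbitRel N v (Pi.single 0 1) := by
  have hv0 : v ≠ 0 := by
    rintro rfl
    exact not_isUnit_zero (hv 0 fun _ => dvd_rfl)
  obtain ⟨w, hvw, hw0, hmin⟩ := exists_orbitRel_minimal hN.ne_zero hv0 hq
  rw [← hvw.quad_eq] at hq
  exact hvw.trans (orbitRel_single_of_isUnit
    (hvw.primitive hv _ (dvd_apply_of_minimal hN hw0 hmin hq)) hq)

end Transitivity

section ConicParametrization

theorem exists_eq_sq_of_mul_eq_sq {x y z : ℤ} (hxy : IsCoprime x y) (h : x * y = z ^ 2) :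
    ∃ α γ ε : ℤ, IsUnit ε ∧ x = ε * α ^ 2 ∧ z = ε * (α * γ) ∧ y = ε * γ ^ 2 := by
  obtain ⟨a, u, rfl⟩ := exists_associated_pow_of_mul_eq_pow' hxy h
  have hu : (u : ℤ) * u = 1 := Int.isUnit_mul_self u.isUnit
  rcases eq_or_ne a 0 with rfl | ha
  · have hz : z = 0 := by simpa using h.symm
    have hy : IsUnit y := isCoprime_zero_left.1 (by simpa using hxy)
    exact ⟨0, 1, y, hy, by simp, by simp [hz], by simp⟩
  obtain ⟨c, rfl⟩ : a ∣ z := (Int.pow_dvd_pow_iff two_ne_zero).1 (h ▸ (Dvd.intro _ rfl).mul_right _)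
  have hy : u * y = c ^ 2 := mul_left_cancel₀ (pow_ne_zero 2 ha) (by linear_combination h)
  exact ⟨a, u * c, u, u.isUnit, mul_comm _ _, by linear_combination -(a * c) * hu,
    by linear_combination u * hy - (y + u * c ^ 2) * hu⟩

theorem exists_eq_mul_sq_of_mul_eq_mul_sq {n x y z : ℤ} (hn : n ≠ 0) (hxy : IsCoprime x y)
    (h : x * y = n * z ^ 2) : ∃ d d' α γ ε : ℤ, 0 < d ∧ d * d' = n ∧ IsUnit ε ∧
      x = ε * (d * α ^ 2) ∧ z = ε * (α * γ) ∧ y = ε * (d' * γ ^ 2) := by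
  obtain ⟨x', hx'⟩ : (Int.gcd x n : ℤ) ∣ x := Int.gcd_dvd_left ..
  obtain ⟨d', hd'⟩ : (Int.gcd x n : ℤ) ∣ n := Int.gcd_dvd_right ..
  have hd : 0 < (Int.gcd x n : ℤ) := Int.natCast_pos.2 (Int.gcd_pos_of_ne_zero_right _ hn)
  have hgcd : ∀ k : ℤ, k ∣ x → k ∣ n → k ∣ (Int.gcd x n : ℤ) := fun _ => Int.dvd_coe_gcd
  generalize (Int.gcd x n : ℤ) = d at hx' hd' hd hgcd
  subst hx' hd'
  have hcop : IsCoprime d' x' := by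
    refine isRelPrime_iff_isCoprime.1 fun k hkd hkx => isUnit_of_dvd_one ?_
    refine (mul_dvd_mul_iff_left hd.ne').1 ?_
    rw [mul_one]
    exact hgcd _ (mul_dvd_mul_left d hkx) (mul_dvd_mul_left d hkd)
  have h1 : x' * y = d' * z ^ 2 := mul_left_cancel₀ hd.ne' (by linear_combination h)
  obtain ⟨y', rfl⟩ : d' ∣ y := hcop.dvd_of_dvd_mul_left ⟨z ^ 2, h1⟩
  have h2 : x' * y' = z ^ 2 :=
    mul_left_cancel₀ (right_ne_zero_of_mul hn) (by linear_combination h1)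
  obtain ⟨α, γ, ε, hε, rfl, rfl, rfl⟩ :=
    exists_eq_sq_of_mul_eq_sq (hxy.of_mul_left_right.of_mul_right_right) h2
  exact ⟨d, d', α, γ, ε, hd, rfl, hε, by ring, rfl, by ring⟩

end ConicParametrization

section PrimitiveVectors

variable {ι : Type*} {a : ℕ} {v x y : ι → ℤ}

/-- An integral vector (or, on pairs of indices, a matrix) that is nonzero modulo every prime
divisor of `a`. -/
def PrimitiveMod (a : ℕ) (v : ι → ℤ) : Prop :=
  ∀ ⦃p : ℕ⦄, p.Prime → p ∣ a → ∃ i, ¬ (p : ℤ) ∣ v i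

theorem primitive_of_forall_prime (h : ∀ p : ℕ, p.Prime → ∃ i, ¬ (p : ℤ) ∣ v i) : Primitive v := by
  intro k hk
  by_contra hu
  obtain ⟨p, hp, hpk⟩ := Nat.exists_prime_and_dvd (mt Int.isUnit_iff_natAbs_eq.2 hu)
  obtain ⟨i, hi⟩ := h p hp
  exact hi ((Int.natCast_dvd.2 hpk).trans (hk i))

theorem primitive_of_isCoprime {i j : ι} (h : IsCoprime (v i) (v j)) : Primitive v :=
  fun _ hk => h.isUnit_of_dvd' (hk i) (hk j)

theorem Primitive.of_mulVec [Fintype ι] {m : Type*} {A : Matrix m ι ℤ} (h : Primitive (A *ᵥ v)) :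
    Primitive v :=
  fun k hk => h k (dvd_mulVec hk A)

theorem exists_isCoprime_selecting (ha : a ≠ 0) (P : ℕ → Prop) :
    ∃ m n : ℤ, IsCoprime m n ∧ ∀ p : ℕ, p.Prime → p ∣ a →
      (P p → (p : ℤ) ∣ n) ∧ (¬ P p → (p : ℤ) ∣ m) := by
  classical
  have hdvd (Q : ℕ → Prop) [DecidablePred Q] {p : ℕ} (hp : p.Prime) (hpa : p ∣ a) (hQ : Q p) :
      (p : ℤ) ∣ (∏ q ∈ a.primeFactors with Q q, q : ℕ) :=
    Int.natCast_dvd_natCast.2 <| Finset.dvd_prod_of_mem _ <|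
      Finset.mem_filter.2 ⟨Nat.mem_primeFactors.2 ⟨hp, hpa, ha⟩, hQ⟩
  refine ⟨_, _, Nat.isCoprime_iff_coprime.2 ?_, fun p hp hpa =>
    ⟨hdvd P hp hpa, hdvd (fun q => ¬ P q) hp hpa⟩⟩
  refine Nat.Coprime.prod_left fun q hq => Nat.Coprime.prod_right fun r hr => ?_
  rw [Finset.mem_filter, Nat.mem_primeFactors] at hq hr
  refine (Nat.coprime_primes hq.1.1 hr.1.1).2 ?_
  rintro rfl
  exact hq.2 hr.2

theorem exists_isCoprime_primitiveMod (ha : a ≠ 0) (h : PrimitiveMod a (Sum.elim x y)) :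
    ∃ m n : ℤ, IsCoprime m n ∧ PrimitiveMod a (m • x + n • y) := by
  obtain ⟨m, n, hmn, hsel⟩ := exists_isCoprime_selecting ha fun p => ∃ i, ¬ (p : ℤ) ∣ x i
  refine ⟨m, n, hmn, fun p hp hpa => ?_⟩
  have hp' : Prime (p : ℤ) := Nat.prime_iff_prime_int.1 hp
  simp only [Pi.add_apply, Pi.smul_apply, smul_eq_mul]
  by_cases hx : ∃ i, ¬ (p : ℤ) ∣ x i
  · have hn : (p : ℤ) ∣ n := (hsel p hp hpa).1 hx
    have hm : ¬ (p : ℤ) ∣ m := fun hm => hp'.not_isUnit (hmn.isUnit_of_dvd' hm hn)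
    obtain ⟨i, hi⟩ := hx
    exact ⟨i, fun hd => ((dvd_add_left (hn.mul_right _)).1 hd |> hp'.dvd_or_dvd).elim hm hi⟩
  · have hm : (p : ℤ) ∣ m := (hsel p hp hpa).2 hx
    have hn : ¬ (p : ℤ) ∣ n := fun hn => hp'.not_isUnit (hmn.isUnit_of_dvd' hm hn)
    obtain ⟨i | i, hi⟩ := h hp hpa
    · exact absurd ⟨i, hi⟩ hx
    · exact ⟨i, fun hd => ((dvd_add_right (hm.mul_right _)).1 hd |> hp'.dvd_or_dvd).elim hn hi⟩

theorem exists_isCoprime_mul_mul {n r s : ℤ} (hn : Squarefree n) (h : IsCoprime r s) :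
    ∃ d d' : ℤ, 0 < d ∧ d * d' = n ∧ IsCoprime (d * r) (d' * s) := by
  obtain ⟨d', hd'⟩ : (Int.gcd n r : ℤ) ∣ n := Int.gcd_dvd_left ..
  have hdr : (Int.gcd n r : ℤ) ∣ r := Int.gcd_dvd_right ..
  have hdd' : IsRelPrime (Int.gcd n r : ℤ) d' := IsRelPrime.of_squarefree_mul (hd' ▸ hn)
  have hrd' : IsRelPrime r d' := fun k hkr hkd' =>
    hdd' (Int.dvd_coe_gcd (hd' ▸ hkd'.mul_left _) hkr) hkd'
  exact ⟨_, d', Int.natCast_pos.2 (Int.gcd_pos_of_ne_zero_left _ hn.ne_zero), hd'.symm,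
    IsCoprime.mul_left (.mul_right hdd'.isCoprime (h.of_isCoprime_of_dvd_left hdr))
      (.mul_right hrd'.isCoprime h)⟩

/-- `(d r², r s, d' s²)` is the image of `(1, 0, 0)` under an Atkin–Lehner matrix, which is why the
combination has this shape. -/
theorem exists_primitiveMod_conic {n : ℤ} (hn : Squarefree n) (ha : a ≠ 0)
    (h : PrimitiveMod a (Sum.elim x y)) (z : ι → ℤ) :
    ∃ d d' r s : ℤ, 0 < d ∧ d * d' = n ∧ IsCoprime (d * r) (d' * s) ∧
      PrimitiveMod a fun i => d * r ^ 2 * x i + r * s * z i + d' * s ^ 2 * y i := by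
  obtain ⟨r, s, hrs, hsel⟩ := exists_isCoprime_selecting ha fun p => ∃ i, ¬ (p : ℤ) ∣ x i
  obtain ⟨d, d', hd, hn, hcop⟩ := exists_isCoprime_mul_mul hn hrs
  refine ⟨d, d', r, s, hd, hn, hcop, fun p hp hpa => ?_⟩
  have hp' : Prime (p : ℤ) := Nat.prime_iff_prime_int.1 hp
  simp only [pow_two, ← mul_assoc]
  by_cases hx : ∃ i, ¬ (p : ℤ) ∣ x i
  · have hs : (p : ℤ) ∣ s := (hsel p hp hpa).1 hx
    have hdr : ¬ (p : ℤ) ∣ d * r := fun h => hp'.not_isUnit (hcop.isUnit_of_dvd' h (hs.mul_left _))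
    obtain ⟨i, hi⟩ := hx
    refine ⟨i, fun hdvd => ?_⟩
    rw [add_assoc, dvd_add_left (dvd_add ((hs.mul_left _).mul_right _)
      ((hs.mul_left _).mul_right _)), hp'.dvd_mul, hp'.dvd_mul] at hdvd
    exact (hdvd.resolve_right hi).elim hdr fun h => hdr (h.mul_left d)
  · have hr : (p : ℤ) ∣ r := (hsel p hp hpa).2 hx
    have hds : ¬ (p : ℤ) ∣ d' * s := fun h => hp'.not_isUnit (hcop.isUnit_of_dvd' (hr.mul_left _) h)
    obtain ⟨i | i, hi⟩ := h hp hpa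
    · exact absurd ⟨i, hi⟩ hx
    refine ⟨i, fun hdvd => ?_⟩
    rw [dvd_add_right (dvd_add ((hr.mul_left _).mul_right _) ((hr.mul_right _).mul_right _)),
      hp'.dvd_mul, hp'.dvd_mul] at hdvd
    exact (hdvd.resolve_right hi).elim hds fun h => hds (h.mul_left d')

end PrimitiveVectors

section AtkinLehner

variable {n : ℤ} {V : Matrix (Fin 5) (Fin 5) ℤ} {N : ℕ}

/-- An integral element of the (extended) Atkin–Lehner group of level `n`, acting on the ternary
form `x₁ x₃ - n x₂²`. -/
def IsAtkinLehner (n : ℤ) (V : Matrix (Fin 5) (Fin 5) ℤ) : Prop :=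
  ∃ d d' α β γ δ : ℤ, 0 < d ∧ d * d' = n ∧ d * α * δ - d' * β * γ = 1 ∧
    V = atkinLehner d d' α β γ δ

theorem IsAtkinLehner.isSO0 (hV : IsAtkinLehner N V) : IsSO0 N V := by
  obtain ⟨d, d', α, β, γ, δ, hd, hdd', hdet, rfl⟩ := hV
  exact isSO0_atkinLehner (by simpa using hd) (by simpa using hdd') hdet

theorem isAtkinLehner_shear (n t : ℤ) : IsAtkinLehner n (atkinLehner 1 n 1 t 0 1) :=
  ⟨1, n, 1, t, 0, 1, one_pos, one_mul n, by ring, rfl⟩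

theorem exists_isAtkinLehner_mulVec_single {d d' r s : ℤ} (hd : 0 < d)
    (h : IsCoprime (d * r) (d' * s)) : ∃ V, IsAtkinLehner (d * d') V ∧
      V *ᵥ Pi.single 1 1 = ![0, d * r ^ 2, r * s, d' * s ^ 2, 0] := by
  obtain ⟨δ, β, hdet⟩ := h
  refine ⟨_, ⟨d, d', r, -β, s, δ, hd, rfl, by linear_combination hdet, rfl⟩, ?_⟩
  ext i
  fin_cases i <;> simp [atkinLehner]

theorem exists_isAtkinLehner_smul_mulVec_single (hn : Squarefree n) {w : Fin 5 → ℤ}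
    (hw : Primitive w) (hq : quad n w = 0) (h0 : w 0 = 0) (h4 : w 4 = 0) :
    ∃ V, ∃ ε : ℤ, IsAtkinLehner n V ∧ IsUnit ε ∧ w = ε • (V *ᵥ Pi.single 1 1) := by
  have hcop : IsCoprime (w 1) (w 3) := by
    refine isRelPrime_iff_isCoprime.1 fun k hk1 hk3 => hw k fun i => ?_
    have hk2 : k ∣ w 2 :=
      dvd_of_quad_eq_zero hn hq (by simp [h0]) (pow_two k ▸ mul_dvd_mul hk1 hk3)
    fin_cases i <;> simp_all
  obtain ⟨d, d', α, γ, ε, hd, rfl, hε, h1, h2, h3⟩ :=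
    exists_eq_mul_sq_of_mul_eq_mul_sq hn.ne_zero hcop (z := w 2) (by
      rw [quad, h0] at hq
      linear_combination hq)
  have hcop' : IsCoprime (d * α) (d' * γ) := by
    rw [h1, h3, pow_two, pow_two, ← mul_assoc d, ← mul_assoc d'] at hcop
    exact hcop.of_mul_left_right.of_mul_left_left.of_mul_right_right.of_mul_right_left
  obtain ⟨V, hV, hVw⟩ := exists_isAtkinLehner_mulVec_single hd hcop'
  refine ⟨V, ε, hV, hε, ?_⟩
  rw [hVw]
  ext i
  fin_cases i <;> simp [h0, h1, h2, h3, h4]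

end AtkinLehner

section PrimitiveImages

variable {n c : ℤ} {a : ℕ} {M : Matrix (Fin 5) (Fin 5) ℤ} {v : Fin 5 → ℤ}

theorem exists_eq_two_mul_of_sq_eq {x u : ℤ} (hn : Squarefree n) (h : x ^ 2 = 4 * n * u) :
    ∃ s, x = 2 * n * s ∧ u = n * s ^ 2 := by
  obtain ⟨y, rfl⟩ : n ∣ x := (hn.dvd_pow_iff_dvd two_ne_zero).1 ⟨4 * u, by linear_combination h⟩
  have hy : n * y ^ 2 = 2 ^ 2 * u :=
    mul_left_cancel₀ hn.ne_zero (by linear_combination h)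
  obtain ⟨s, rfl⟩ : 2 ∣ y := dvd_of_sq_dvd_mul_sq hn ⟨u, hy⟩
  exact ⟨s, by ring, mul_left_cancel₀ four_ne_zero (by linear_combination -hy)⟩

theorem gram_mulVec (n : ℤ) (v : Fin 5 → ℤ) :
    gram n *ᵥ v = ![v 4, v 3, -2 * n * v 2, v 1, v 0] := by
  ext i
  fin_cases i <;> simp [gram, mulVec, dotProduct, Fin.sum_univ_five]

namespace IsSimilitude

theorem dvd_apply_two (hn : n ≠ 0) (hc : c ≠ 0) (hM : IsSimilitude n c M) {k : ℤ}
    (hk : k ^ 2 ∣ c) {i : Fin 5} (h0 : k ∣ M i 0) (h1 : k ∣ M i 1) (h3 : k ∣ M i 3)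
    (h4 : k ∣ M i 4) : k ∣ M i 2 := by
  refine (Int.pow_dvd_pow_iff two_ne_zero).1 ?_
  have hrow : M i 2 ^ 2 = 4 * n * (M i 0 * M i 4 + M i 1 * M i 3) - c * cogram n i i := by
    linear_combination -hM.row_relation (mul_ne_zero two_ne_zero hn) hc i i
  rw [hrow]
  refine dvd_sub ((dvd_add ?_ ?_).mul_left _) (hk.mul_right _)
  exacts [pow_two k ▸ mul_dvd_mul h0 h4, pow_two k ▸ mul_dvd_mul h1 h3]

theorem primitiveMod_columns (hn : n ≠ 0) (ha : a ≠ 0) (hM : IsSimilitude n ((a : ℤ) ^ 2) M)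
    (hprim : PrimitiveMod a fun x : Fin 5 × Fin 5 => M x.1 x.2) {p : ℕ} (hp : p.Prime)
    (hpa : p ∣ a) : ∃ i, ∃ j ≠ 2, ¬ (p : ℤ) ∣ M i j := by
  by_contra! hdvd
  obtain ⟨⟨i, j⟩, hij⟩ := hprim hp hpa
  refine hij ?_
  by_cases hj : j = 2
  · subst hj
    exact hM.dvd_apply_two hn (pow_ne_zero 2 (Int.natCast_ne_zero.2 ha))
      (pow_dvd_pow_of_dvd (Int.natCast_dvd_natCast.2 hpa) 2) (hdvd i 0 (by decide))
      (hdvd i 1 (by decide)) (hdvd i 3 (by decide)) (hdvd i 4 (by decide))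
  · exact hdvd i j hj

theorem primitive_mulVec (hM : IsSimilitude n ((a : ℤ) ^ 2) M) (hv : Primitive (gram n *ᵥ v))
    (h : PrimitiveMod a (M *ᵥ v)) : Primitive (M *ᵥ v) := by
  refine primitive_of_forall_prime fun p hp => ?_
  by_cases hpa : p ∣ a
  · exact h hp hpa
  have hp' : Prime (p : ℤ) := Nat.prime_iff_prime_int.1 hp
  by_contra! hd
  refine hp'.not_isUnit (hv p fun i => ?_)
  have hi : (p : ℤ) ∣ (a : ℤ) ^ 2 * (gram n *ᵥ v) i := by
    have hdvd := dvd_mulVec hd (Mᵀ * gram n) i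
    rwa [mulVec_mulVec, (hM : _ = _), smul_mulVec] at hdvd
  exact (hp'.dvd_or_dvd hi).resolve_left fun hpa' =>
    hpa (Int.natCast_dvd_natCast.1 (hp'.dvd_of_dvd_pow hpa'))

theorem exists_primitive_mulVec (hn : n ≠ 0) (ha : a ≠ 0) (hM : IsSimilitude n ((a : ℤ) ^ 2) M)
    (hprim : PrimitiveMod a fun x : Fin 5 × Fin 5 => M x.1 x.2) :
    ∃ v, Primitive v ∧ quad n v = 0 ∧ Primitive (M *ᵥ v) := by
  have hcols : PrimitiveMod a
      (Sum.elim (Sum.elim (M · 0) (M · 1)) (Sum.elim (-M · 3) (M · 4))) := by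
    intro p hp hpa
    obtain ⟨i, j, hj, hij⟩ := hM.primitiveMod_columns hn ha hprim hp hpa
    fin_cases j
    · exact ⟨.inl (.inl i), hij⟩
    · exact ⟨.inl (.inr i), hij⟩
    · exact absurd rfl hj
    · exact ⟨.inr (.inl i), by simpa using hij⟩
    · exact ⟨.inr (.inr i), hij⟩
  obtain ⟨m, k, hmk, h⟩ := exists_isCoprime_primitiveMod ha hcols
  obtain ⟨r, s, hrs, h⟩ := exists_isCoprime_primitiveMod ha
    (x := fun i => m * M i 0 - k * M i 3) (y := fun i => m * M i 1 + k * M i 4) (by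
      convert h using 1
      ext (i | i) <;> simp [sub_eq_add_neg])
  have hgram : Primitive (gram n *ᵥ ![m * r, m * s, 0, -(k * r), k * s]) := by
    intro q hq
    have hkq : ∀ l : ℤ, q ∣ l * r → q ∣ l * s → q ∣ l := fun l h₁ h₂ => by
      obtain ⟨x, y, hxy⟩ := hrs
      have hl : l = x * (l * r) + y * (l * s) := by linear_combination -l * hxy
      exact hl ▸ dvd_add (h₁.mul_left _) (h₂.mul_left _)
    rw [gram_mulVec] at hq
    exact hmk.isUnit_of_dvd' (hkq m (hq 4) (hq 3)) (hkq k (dvd_neg.1 (hq 1)) (hq 0))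
  refine ⟨_, hgram.of_mulVec, by simp only [quad, cons_val]; ring, hM.primitive_mulVec hgram ?_⟩
  convert h using 1
  ext i
  simp only [mulVec, dotProduct, Fin.sum_univ_five, cons_val, Pi.add_apply, Pi.smul_apply,
    smul_eq_mul]
  ring

theorem exists_isAtkinLehner_primitive_mulVec (hn : Squarefree n) (ha : a ≠ 0)
    (hM : IsSimilitude n ((a : ℤ) ^ 2) M)
    (hprim : PrimitiveMod a fun x : Fin 5 × Fin 5 => M x.1 x.2) (h0 : ∀ i, (a : ℤ) ∣ M i 0)
    (h4 : ∀ i, (a : ℤ) ∣ M i 4) :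
    ∃ V, IsAtkinLehner n V ∧ Primitive (M *ᵥ (V *ᵥ Pi.single 1 1)) := by
  have hcols : PrimitiveMod a (Sum.elim (M · 1) (M · 3)) := by
    intro p hp hpa
    have hpa' : (p : ℤ) ∣ a := Int.natCast_dvd_natCast.2 hpa
    obtain ⟨i, j, hj, hij⟩ := hM.primitiveMod_columns hn.ne_zero ha hprim hp hpa
    fin_cases j
    exacts [absurd (hpa'.trans (h0 i)) hij, ⟨.inl i, hij⟩, absurd rfl hj, ⟨.inr i, hij⟩,
      absurd (hpa'.trans (h4 i)) hij]
  obtain ⟨d, d', r, s, hd, rfl, hcop, h⟩ := exists_primitiveMod_conic hn ha hcols (M · 2)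
  obtain ⟨V, hV, hVv⟩ := exists_isAtkinLehner_mulVec_single hd hcop
  refine ⟨V, hV, ?_⟩
  rw [hVv]
  refine hM.primitive_mulVec (primitive_of_isCoprime (i := 3) (j := 1) ?_) ?_
  · rw [gram_mulVec]
    simpa only [cons_val, pow_two, ← mul_assoc] using ((hcop.mul_right hcop.of_mul_right_right
      ).mul_left (hcop.mul_right hcop.of_mul_right_right).of_mul_left_right)
  · convert h using 1
    ext i
    simp only [mulVec, dotProduct, Fin.sum_univ_five, cons_val]
    ring

end IsSimilitude

end PrimitiveImages

section Sign

variable {N : ℕ}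

/-- A basis of a positive definite plane for the form `quad n`, `n > 0`. -/
def planeBasis : Matrix (Fin 5) (Fin 2) ℝ :=
  !![1, 0; 0, 1; 0, 0; 0, 1; 1, 0]

/-- The determinant of the compression of `M` to the plane spanned by `planeBasis`. It does not
vanish on isometries, hence separates the components of the isometry group. -/
def planeDet (M : Matrix (Fin 5) (Fin 5) ℝ) : ℝ :=
  (planeBasisᵀ * M * planeBasis).det

theorem planeBasis_mulVec (v : Fin 2 → ℝ) : planeBasis *ᵥ v = ![v 0, v 1, 0, v 1, v 0] := by
  ext i
  fin_cases i <;> simp [planeBasis, mulVec, dotProduct]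

theorem planeBasis_transpose_mulVec (x : Fin 5 → ℝ) :
    planeBasisᵀ *ᵥ x = ![x 0 + x 4, x 1 + x 3] := by
  ext i
  fin_cases i <;> simp [planeBasis, mulVec, dotProduct, Fin.sum_univ_five]

theorem planeDet_ne_zero {M : Matrix (Fin 5) (Fin 5) ℝ} (hM : IsSimilitude (N : ℝ) 1 M) :
    planeDet M ≠ 0 := by
  intro h0
  obtain ⟨v, hv, hMv⟩ := exists_mulVec_eq_zero_iff.2 h0
  set x := M *ᵥ (planeBasis *ᵥ v) with hx
  rw [← mulVec_mulVec, ← mulVec_mulVec, planeBasis_transpose_mulVec] at hMv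
  have h4 : x 4 = -x 0 := eq_neg_of_add_eq_zero_right (congrFun hMv 0)
  have h3 : x 3 = -x 1 := eq_neg_of_add_eq_zero_right (congrFun hMv 1)
  have hpos : quad (N : ℝ) (planeBasis *ᵥ v) = v 0 ^ 2 + v 1 ^ 2 := by
    simp only [planeBasis_mulVec, quad, cons_val]
    ring
  have hneg : quad (N : ℝ) x ≤ 0 := by
    simp only [quad, h3, h4]
    nlinarith only [sq_nonneg (x 0), sq_nonneg (x 1), mul_nonneg N.cast_nonneg (sq_nonneg (x 2))]
  rw [hx, hM.quad_mulVec, hpos, one_mul] at hneg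
  have hv0 : v 0 = 0 := pow_eq_zero_iff two_ne_zero |>.1
    (by linarith only [hneg, sq_nonneg (v 0), sq_nonneg (v 1)])
  have hv1 : v 1 = 0 := pow_eq_zero_iff two_ne_zero |>.1
    (by linarith only [hneg, sq_nonneg (v 0), sq_nonneg (v 1)])
  exact hv (funext fun i => by fin_cases i <;> assumption)

theorem planeDet_diagonal (d : Fin 5 → ℝ) :
    planeDet (diagonal d) = (d 0 + d 4) * (d 1 + d 3) := by
  simp [planeDet, planeBasis, det_fin_two, Matrix.mul_apply, Fin.sum_univ_five, diagonal_apply]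

theorem planeDet_pos {g : SpecialLinearGroup (Fin 5) ℝ} (hg : g ∈ SO0Real N) :
    0 < planeDet g.1 := by
  obtain ⟨s, hs, rfl⟩ := hg
  have hcont : Continuous fun s : SOReal N => planeDet s.1.1 := by
    unfold planeDet
    fun_prop
  have hpre := isPreconnected_connectedComponent (x := (1 : SOReal N)).image _ hcont.continuousOn
  have hone : 0 ≤ planeDet (1 : SOReal N).1.1 := by
    change 0 ≤ planeDet 1
    rw [← diagonal_one, planeDet_diagonal]
    norm_num
  by_contra! hneg
  obtain ⟨u, -, hu⟩ := hpre.ordConnected.out ⟨s, hs, rfl⟩ ⟨1, mem_connectedComponent, rfl⟩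
    ⟨hneg, hone⟩
  exact planeDet_ne_zero ((u.2 : _).trans (one_smul _ _).symm) hu

theorem pos_of_isSO0_diagMat {c : ℚ} (h : IsSO0 N (diagMat 1 c)) : 0 < c := by
  obtain ⟨g, hg, hgc⟩ := h
  have h0 := planeDet_pos hg
  rw [hgc, diagMat, diagonal_map (map_zero _), planeDet_diagonal] at h0
  simp only [diagEntries, cons_val, map_inv₀, map_one, inv_one, eq_ratCast] at h0
  by_contra! hc
  have hc' : (c : ℝ) ≤ 0 := by exact_mod_cast hc
  linarith only [h0, hc', inv_nonpos.2 hc']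

theorem mem_GHat_iff {g : SpecialLinearGroup (Fin 5) ℚ} : g ∈ GHat N ↔ IsSO0 N g.1 := by
  refine ⟨fun h => ⟨_, h, rfl⟩, fun ⟨x, hx, hgx⟩ => ?_⟩
  rwa [(Subtype.ext hgx : x = SpecialLinearGroup.map (algebraMap ℚ ℝ) g)] at hx

theorem isSO0_diagMat {a b : ℚ} (ha : 0 < a) (hb : 0 < b) : IsSO0 N (diagMat a b) := by
  have hdet : (diagMat a b).det = 1 := by
    simp [diagMat, diagEntries, Fin.prod_univ_five, ha.ne', hb.ne']
  have hmap : (diagMat a b).map (algebraMap ℚ ℝ) =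
      diagonal ![(a : ℝ)⁻¹, (b : ℝ)⁻¹, 1, (b : ℝ)⁻¹⁻¹, (a : ℝ)⁻¹⁻¹] := by
    rw [diagMat, diagonal_map (map_zero _)]
    congr 1
    ext i
    fin_cases i <;> simp [diagEntries]
  have ha' : (0 : ℝ) < (a : ℝ)⁻¹ := inv_pos.2 (Rat.cast_pos.2 ha)
  have hb' : (0 : ℝ) < (b : ℝ)⁻¹ := inv_pos.2 (Rat.cast_pos.2 hb)
  exact mem_GHat_iff.1 (diag_mem N ha' hb' ⟨diagMat a b, hdet⟩ hmap)

end Sign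

section FixesPlane

variable {R S : Type*} [CommRing R] [CommRing S] {n : R} {A B : Matrix (Fin 5) (Fin 5) R}

/-- `A` fixes `e₀` and `e₄`; an isometry with this property is an isometry of the ternary form
`x₁ x₃ - n x₂²`. -/
structure FixesPlane (A : Matrix (Fin 5) (Fin 5) R) : Prop where
  col_zero : A.col 0 = Pi.single 0 1
  col_four : A.col 4 = Pi.single 4 1

namespace FixesPlane

theorem apply_zero (hA : FixesPlane A) (i : Fin 5) : A i 0 = (Pi.single 0 1 : Fin 5 → R) i :=
  congrFun hA.col_zero i

theorem apply_four (hA : FixesPlane A) (i : Fin 5) : A i 4 = (Pi.single 4 1 : Fin 5 → R) i :=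
  congrFun hA.col_four i

protected theorem mul (hA : FixesPlane A) (hB : FixesPlane B) : FixesPlane (A * B) where
  col_zero := by
    rw [← mulVec_single_one, ← mulVec_mulVec, mulVec_single_one, hB.col_zero, mulVec_single_one,
      hA.col_zero]
  col_four := by
    rw [← mulVec_single_one, ← mulVec_mulVec, mulVec_single_one, hB.col_four, mulVec_single_one,
      hA.col_four]

theorem of_mul_eq_one (hA : FixesPlane A) (h : B * A = 1) : FixesPlane B where
  col_zero := by
    rw [← mulVec_single_one, ← hA.col_zero, ← mulVec_single_one A, mulVec_mulVec, h, one_mulVec,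
      mulVec_single_one, hA.col_zero]
  col_four := by
    rw [← mulVec_single_one, ← hA.col_four, ← mulVec_single_one A, mulVec_mulVec, h, one_mulVec,
      mulVec_single_one, hA.col_four]

protected theorem map (hA : FixesPlane A) (f : R →+* S) : FixesPlane (A.map f) where
  col_zero := funext fun i => by
    rw [col_apply, map_apply, hA.apply_zero, Pi.single_apply, Pi.single_apply]
    split_ifs <;> simp
  col_four := funext fun i => by
    rw [col_apply, map_apply, hA.apply_four, Pi.single_apply, Pi.single_apply]
    split_ifs <;> simp

theorem zero_apply (hA : FixesPlane A) (h : IsSimilitude n 1 A) (j : Fin 5) :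
    A 0 j = (Pi.single 0 1 : Fin 5 → R) j := by
  have hrel := h.column_relation 4 j
  simp only [hA.apply_four] at hrel
  fin_cases j <;> simpa [gram] using hrel

theorem four_apply (hA : FixesPlane A) (h : IsSimilitude n 1 A) (j : Fin 5) :
    A 4 j = (Pi.single 4 1 : Fin 5 → R) j := by
  have hrel := h.column_relation 0 j
  simp only [hA.apply_zero] at hrel
  fin_cases j <;> simpa [gram] using hrel

theorem of_row_zero [IsDomain R] (hn : 2 * n ≠ 0) (h : IsSimilitude n 1 A)
    (hcol : A.col 0 = Pi.single 0 1) (hrow : A.row 0 = Pi.single 0 1) : FixesPlane A := by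
  refine ⟨hcol, funext fun i => mul_left_cancel₀ hn ?_⟩
  have hrow' : ∀ j, A 0 j = (Pi.single 0 1 : Fin 5 → R) j := congrFun hrow
  have hrel := h.row_relation hn one_ne_zero 0 i
  simp only [hrow'] at hrel
  fin_cases i <;> simpa [cogram] using hrel

theorem mul_diagMat {n : ℚ} {A : Matrix (Fin 5) (Fin 5) ℚ} (hA : FixesPlane A)
    (h : IsSimilitude n 1 A) (c : ℚ) : A * diagMat c 1 = diagMat c 1 * A := by
  ext i j
  rw [diagMat, mul_diagonal, diagonal_mul]
  fin_cases i <;> fin_cases j <;>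
    simp [diagEntries, hA.apply_zero, hA.apply_four, hA.zero_apply h, hA.four_apply h]

end FixesPlane

theorem IsAtkinLehner.fixesPlane {n : ℤ} {V : Matrix (Fin 5) (Fin 5) ℤ} (hV : IsAtkinLehner n V) :
    FixesPlane V := by
  obtain ⟨d, d', α, β, γ, δ, -, -, -, rfl⟩ := hV
  exact ⟨funext fun i => by fin_cases i <;> rfl, funext fun i => by fin_cases i <;> rfl⟩

end FixesPlane

section FirstBasisVector

variable {N a : ℕ} {c : ℤ} {M : Matrix (Fin 5) (Fin 5) ℤ}

theorem exists_isSO0_mul_row_zero (hN : Squarefree N) (hc : c ≠ 0)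
    (hM : IsSimilitude (N : ℤ) c M) (hcol : M.col 0 = Pi.single 0 1) :
    ∃ U, IsSO0 N U ∧ (M * U).col 0 = Pi.single 0 1 ∧ (M * U).row 0 = Pi.single 0 1 := by
  have h00 : M 0 0 = 1 := congrFun hcol 0
  have hN' : Squarefree (N : ℤ) := Int.squarefree_natCast.2 hN
  have hrel : M 0 2 ^ 2 = 4 * N * (M 0 4 + M 0 1 * M 0 3) := by
    have := hM.row_relation (mul_ne_zero two_ne_zero hN'.ne_zero) hc 0 0
    rw [h00, show cogram (N : ℤ) 0 0 = 0 from rfl] at this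
    linear_combination -this
  obtain ⟨s, h2, h4⟩ := exists_eq_two_mul_of_sq_eq hN' hrel
  refine ⟨eichlerUpper N (M 0 1) (M 0 3) (-s), isSO0_eichlerUpper .., ?_, funext fun j => ?_⟩
  · rw [← hcol]
    ext i
    simp [Matrix.mul_apply, Fin.sum_univ_five, eichlerUpper]
  · rw [row_apply, Matrix.mul_apply, Fin.sum_univ_five, h00, h2, eq_sub_of_add_eq h4]
    fin_cases j <;> simp [eichlerUpper]
    ring

theorem exists_isSO0_mul_mul_isSO0 (hN : Squarefree N) (ha : a ≠ 0)
    (hM : IsSimilitude (N : ℤ) ((a : ℤ) ^ 2) M)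
    (hprim : PrimitiveMod a fun x : Fin 5 × Fin 5 => M x.1 x.2) :
    ∃ A B, IsSO0 N A ∧ IsSO0 N B ∧
      (A * M * B).col 0 = Pi.single 0 1 ∧ (A * M * B).row 0 = Pi.single 0 1 := by
  have hN0 : (N : ℤ) ≠ 0 := Nat.cast_ne_zero.2 hN.ne_zero
  obtain ⟨v, hv, hqv, hMv⟩ := hM.exists_primitive_mulVec hN0 ha hprim
  have hqM : quad (N : ℤ) (M *ᵥ v) = 0 := by rw [hM.quad_mulVec, hqv, mul_zero]
  obtain ⟨A, hA, hAv⟩ := orbitRel_single hN hMv hqM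
  obtain ⟨B, hB, hBv⟩ := (orbitRel_single hN hv hqv).symm
  have hAMB : IsSimilitude (N : ℤ) ((a : ℤ) ^ 2) (A * M * B) := by
    simpa only [one_mul, mul_one] using (hA.isSimilitude.mul hM).mul hB.isSimilitude
  have hcol : (A * M * B).col 0 = Pi.single 0 1 := by
    rw [← mulVec_single_one, ← mulVec_mulVec, hBv, ← mulVec_mulVec, hAv]
  obtain ⟨U, hU, hU'⟩ :=
    exists_isSO0_mul_row_zero hN (pow_ne_zero 2 (Nat.cast_ne_zero.2 ha)) hAMB hcol
  exact ⟨A, B * U, hA, hB.mul hU, by rwa [← Matrix.mul_assoc]⟩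

end FirstBasisVector

section Classification

variable {N a : ℕ} {g h : Matrix (Fin 5) (Fin 5) ℚ} {M : Matrix (Fin 5) (Fin 5) ℤ}

theorem exists_matDen_smul_eq_map {m n : Type*} [Fintype m] [Fintype n] (g : Matrix m n ℚ) :
    ∃ M : Matrix m n ℤ, (matDen g : ℚ) • g = M.map (algebraMap ℤ ℚ) ∧
      PrimitiveMod (matDen g) fun x : m × n => M x.1 x.2 := by
  choose M hM using fun i j => mem_intSubring.1 (matDen_mul_mem g i j)
  refine ⟨of M, Matrix.ext fun i j => (hM i j).symm, fun p hp ⟨c, hc⟩ => ?_⟩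
  by_contra! hdvd
  have hcg : matDen g ∣ c := matDen_dvd_iff.2 fun i j => by
    obtain ⟨z, hz⟩ := hdvd (i, j)
    refine ⟨z, mul_left_cancel₀ (Nat.cast_ne_zero.2 hp.ne_zero : (p : ℚ) ≠ 0) ?_⟩
    calc (p : ℚ) * z = M i j := by rw [show M i j = p * z from hz, Int.cast_mul, Int.cast_natCast]
      _ = p * (c * g i j) := by rw [hM, hc, Nat.cast_mul, mul_assoc]
  have hc0 : 0 < c := Nat.pos_of_mul_pos_left (hc ▸ matDen_pos g)
  exact (Nat.le_of_dvd hc0 hcg).not_gt (hc ▸ lt_mul_left hc0 hp.one_lt)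

theorem matDen_map {m n : Type*} [Fintype m] [Fintype n] (M : Matrix m n ℤ) :
    matDen (M.map (algebraMap ℤ ℚ)) = 1 :=
  matDen_eq_one fun i j => intCast_mem_intSubring (M i j)

theorem matDen_map_mul_mul_map_dvd {l m n o : Type*} [Fintype l] [Fintype m] [Fintype n] [Fintype o]
    (A : Matrix l m ℤ) (g : Matrix m n ℚ) (B : Matrix n o ℤ) :
    matDen (A.map (algebraMap ℤ ℚ) * g * B.map (algebraMap ℤ ℚ)) ∣ matDen g := by
  have h := (matDen_mul_dvd (A.map (algebraMap ℤ ℚ) * g) (B.map (algebraMap ℤ ℚ))).trans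
    (mul_dvd_mul_right (matDen_mul_dvd (A.map (algebraMap ℤ ℚ)) g) _)
  simpa only [matDen_map, one_mul, mul_one] using h

theorem isSimilitude_of_smul_eq_map (hg : IsSimilitude (N : ℚ) 1 g)
    (hM : (a : ℚ) • g = M.map (algebraMap ℤ ℚ)) : IsSimilitude (N : ℤ) ((a : ℤ) ^ 2) M := by
  rw [← IsSimilitude.map_iff (algebraMap ℤ ℚ).injective_int, ← hM]
  simpa using hg.smul (a : ℚ)

theorem FixesPlane.apply_two_two (hfix : FixesPlane h) (hsim : IsSimilitude (N : ℚ) 1 h)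
    (hdet : h.det = 1) {c : ℚ} (hc : c ≠ 0) (h1 : ∀ i, h i 1 = c⁻¹ * (Pi.single 1 1 : Fin 5 → ℚ) i)
    (h32 : h 3 2 = 0) (h33 : h 3 3 = c) : h 2 2 = 1 := by
  have htri : h.det = ∏ i, h i i := by
    refine det_of_isUpperTriangular fun i j hij => ?_
    fin_cases i <;> fin_cases j <;>
      simp [hfix.apply_zero, hfix.four_apply hsim, h1, h32] at hij ⊢
  rw [hdet, Fin.prod_univ_five, hfix.apply_zero, hfix.apply_four, h1, h33] at htri
  simpa [hc, mul_right_comm] using htri.symm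

theorem exists_mul_shear_eq_diagMat (hN : Squarefree N) (hh : IsSO0 N h) (hfix : FixesPlane h)
    {c : ℚ} (hcol : h.col 1 = c⁻¹ • Pi.single 1 1) (hint : c * h 1 3 ∈ intSubring) :
    ∃ t : ℤ, h * (atkinLehner 1 (N : ℤ) 1 t 0 1).map (algebraMap ℤ ℚ) = diagMat 1 c := by
  have hsim : IsSimilitude (N : ℚ) 1 h := hh.isSimilitude
  have h1 : ∀ i, h i 1 = c⁻¹ * (Pi.single 1 1 : Fin 5 → ℚ) i := congrFun hcol
  have hrel : ∀ j k, _ := hsim.column_relation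
  have h33 : c⁻¹ * h 3 3 = 1 := by simpa [h1, gram] using hrel 1 3
  have hc : c ≠ 0 := fun h0 => by simp [h0] at h33
  replace h33 : h 3 3 = c := by rw [← mul_right_inj' (inv_ne_zero hc), h33, inv_mul_cancel₀ hc]
  have h32 : h 3 2 = 0 := by simpa [h1, gram, hc] using hrel 1 2
  have h22 : h 2 2 = 1 := hfix.apply_two_two hsim hh.det_eq_one hc h1 h32 h33
  have h23 : h 1 2 * c - 2 * N * h 2 3 = 0 := by
    simpa [gram, h22, h32, h33, hfix.zero_apply hsim, hfix.four_apply hsim] using hrel 2 3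
  have h33' : h 1 3 * c - 2 * N * h 2 3 * h 2 3 + c * h 1 3 = 0 := by
    simpa [gram, h33, hfix.zero_apply hsim, hfix.four_apply hsim] using hrel 3 3
  have h12 : c * h 1 2 = 2 * N * h 2 3 := by linear_combination h23
  have h13 : c * h 1 3 = N * h 2 3 ^ 2 := by linear_combination h33' / 2
  obtain ⟨t, ht⟩ := mem_intSubring.1 <| mem_intSubring_of_mul_sq (q := h 2 3)
    (Int.squarefree_natCast.2 hN) (by simpa [h13] using hint)
  refine ⟨-t, ?_⟩
  rw [← eq_inv_mul_iff_mul_eq₀ hc, ← ht] at h12 h13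
  ext i j
  rw [Matrix.mul_apply, Fin.sum_univ_five, diagMat, diagonal_apply]
  fin_cases i <;> fin_cases j <;>
    simp [diagEntries, atkinLehner, h1, h12, h13, ← ht, h22, h32, h33, hfix.zero_apply hsim,
      hfix.four_apply hsim, hfix.apply_zero, hfix.apply_four]
  ring

theorem exists_isAtkinLehner_primitive_col_one (hN : Squarefree N)
    (hsim : IsSimilitude (N : ℚ) 1 h) (hfix : FixesPlane h) (ha : a ≠ 0)
    (hM : (a : ℚ) • h = M.map (algebraMap ℤ ℚ))
    (hprim : PrimitiveMod a fun x : Fin 5 × Fin 5 => M x.1 x.2) :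
    ∃ V, IsAtkinLehner (N : ℤ) V ∧ Primitive ((M * V).col 1) := by
  have hMe : ∀ i j, (M i j : ℚ) = a * h i j := fun i j => (congrFun₂ hM i j).symm
  have hdvd0 : ∀ i, (a : ℤ) ∣ M i 0 := fun i => ⟨(Pi.single 0 1 : Fin 5 → ℤ) i, by
    rw [← Int.cast_inj (α := ℚ), hMe, hfix.apply_zero, Pi.single_apply, Pi.single_apply]
    split_ifs <;> simp⟩
  have hdvd4 : ∀ i, (a : ℤ) ∣ M i 4 := fun i => ⟨(Pi.single 4 1 : Fin 5 → ℤ) i, by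
    rw [← Int.cast_inj (α := ℚ), hMe, hfix.apply_four, Pi.single_apply, Pi.single_apply]
    split_ifs <;> simp⟩
  obtain ⟨V, hV, hw⟩ := (isSimilitude_of_smul_eq_map hsim hM).exists_isAtkinLehner_primitive_mulVec
    (Int.squarefree_natCast.2 hN) ha hprim hdvd0 hdvd4
  exact ⟨V, hV, by rwa [← mulVec_single_one, ← mulVec_mulVec]⟩

theorem exists_isSO0_mul_col_one (hN : Squarefree N) (hsim : IsSimilitude (N : ℚ) 1 h)
    (hfix : FixesPlane h) (ha : a ≠ 0) (hM : (a : ℚ) • h = M.map (algebraMap ℤ ℚ))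
    (hprim : Primitive (M.col 1)) :
    ∃ A : Matrix (Fin 5) (Fin 5) ℤ, ∃ ε : ℤ, (IsSO0 N A ∧ FixesPlane A) ∧ IsUnit ε ∧
      (A.map (algebraMap ℤ ℚ) * h).col 1 = (ε * a : ℚ)⁻¹ • Pi.single 1 1 := by
  have hMe : ∀ i j, (M i j : ℚ) = a * h i j := fun i j => (congrFun₂ hM i j).symm
  have hq : quad (N : ℤ) (M.col 1) = 0 := by
    rw [← mulVec_single_one, (isSimilitude_of_smul_eq_map hsim hM).quad_mulVec]
    simp [quad]
  obtain ⟨U, ε, hU, hε, hwU⟩ := exists_isAtkinLehner_smul_mulVec_single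
    (Int.squarefree_natCast.2 hN) hprim hq
    (by rw [col_apply, ← Int.cast_inj (α := ℚ), hMe, hfix.zero_apply hsim]; simp)
    (by rw [col_apply, ← Int.cast_inj (α := ℚ), hMe, hfix.four_apply hsim]; simp)
  obtain ⟨A, hA, -, hAU⟩ := hU.isSO0.exists_inv
  have hcol : (A * M).col 1 = ε • Pi.single 1 1 := by
    rw [← mulVec_single_one, ← mulVec_mulVec, mulVec_single_one, hwU, mulVec_smul,
      mulVec_mulVec, hAU, one_mulVec]
  refine ⟨A, ε, ⟨hA, hU.fixesPlane.of_mul_eq_one hAU⟩, hε, funext fun i => ?_⟩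
  have hentry : (a : ℚ) * (A.map (algebraMap ℤ ℚ) * h) i 1 =
      ε * (Pi.single 1 1 : Fin 5 → ℚ) i := by
    have h1 : (a : ℚ) • (A.map (algebraMap ℤ ℚ) * h) = (A * M).map (algebraMap ℤ ℚ) := by
      rw [← Matrix.mul_smul, hM, Matrix.map_mul]
    have h2 : (A * M) i 1 = ε * (Pi.single 1 1 : Fin 5 → ℤ) i := congrFun hcol i
    refine (congrFun₂ h1 i 1).trans ?_
    rw [map_apply, h2, Pi.single_apply, Pi.single_apply]
    split_ifs <;> simp
  have hεε : (ε : ℚ) * ε = 1 := by exact_mod_cast Int.isUnit_mul_self hε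
  have ha' : (a : ℚ) ≠ 0 := Nat.cast_ne_zero.2 ha
  rw [col_apply, Pi.smul_apply, smul_eq_mul,
    eq_inv_mul_iff_mul_eq₀ (mul_ne_zero (left_ne_zero_of_mul_eq_one hεε) ha'), mul_assoc, hentry,
    ← mul_assoc, hεε, one_mul]

theorem exists_isSO0_mul_mul_eq_diagMat_one (hN : Squarefree N) (hh : IsSO0 N h)
    (hfix : FixesPlane h) :
    ∃ A B : Matrix (Fin 5) (Fin 5) ℤ, (IsSO0 N A ∧ FixesPlane A) ∧ IsSO0 N B ∧
      A.map (algebraMap ℤ ℚ) * h * B.map (algebraMap ℤ ℚ) = diagMat 1 (matDen h) := by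
  obtain ⟨M, hM, hprim⟩ := exists_matDen_smul_eq_map h
  obtain ⟨V, hV, hVprim⟩ := exists_isAtkinLehner_primitive_col_one hN hh.isSimilitude hfix
    (matDen_pos h).ne' hM hprim
  have hVQ : IsSO0 N (V.map (algebraMap ℤ ℚ)) := isSO0_map_iff.2 hV.isSO0
  obtain ⟨A, ε, ⟨hA, hA'⟩, hε, hcol⟩ := exists_isSO0_mul_col_one hN (hh.mul hVQ).isSimilitude
    (hfix.mul (hV.fixesPlane.map _)) (matDen_pos h).ne'
    (by rw [← Matrix.smul_mul, hM, Matrix.map_mul]) hVprim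
  rw [← Matrix.mul_assoc] at hcol
  set k := A.map (algebraMap ℤ ℚ) * h * V.map (algebraMap ℤ ℚ) with hk
  have hkSO : IsSO0 N k := ((isSO0_map_iff.2 hA).mul hh).mul hVQ
  have hint : (ε * matDen h : ℚ) * k 1 3 ∈ intSubring := by
    rw [mul_assoc]
    exact mul_mem (intCast_mem_intSubring ε)
      (matDen_dvd_iff.1 (matDen_map_mul_mul_map_dvd A h V) 1 3)
  obtain ⟨t, ht⟩ := exists_mul_shear_eq_diagMat hN hkSO
    (((hA'.map _).mul hfix).mul (hV.fixesPlane.map _)) hcol hint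
  have hS := (isAtkinLehner_shear (N : ℤ) t).isSO0
  have hpos : (0 : ℚ) < ε * matDen h :=
    pos_of_isSO0_diagMat (ht ▸ hkSO.mul (isSO0_map_iff.2 hS))
  have hε1 : ε = 1 := (Int.isUnit_iff.1 hε).resolve_right fun h0 => by
    have hε0 : (0 : ℚ) < ε := pos_of_mul_pos_left hpos (Nat.cast_nonneg _)
    rw [Int.cast_pos, h0] at hε0
    exact absurd hε0 (by decide)
  refine ⟨A, _, ⟨hA, hA'⟩, hV.isSO0.mul hS, ?_⟩
  rw [Matrix.map_mul, ← Matrix.mul_assoc, ← hk, ht, hε1, Int.cast_one, one_mul]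

theorem FixesPlane.matDen_dvd (hfix : FixesPlane h) (hsim : IsSimilitude (N : ℚ) 1 h) (c : ℚ) :
    matDen h ∣ matDen (diagMat c 1 * h) := by
  refine matDen_dvd_iff.2 fun i j => ?_
  have hij := matDen_mul_mem (diagMat c 1 * h) i j
  have hsingle : ∀ k : Fin 5, (Pi.single k 1 : Fin 5 → ℚ) j ∈ intSubring := fun k => by
    rw [Pi.single_apply]
    split_ifs <;> simp
  generalize matDen (diagMat c 1 * h) = d at hij ⊢
  rw [diagMat, diagonal_mul] at hij
  fin_cases i
  · exact mul_mem (natCast_mem _ _) (hfix.zero_apply hsim j ▸ hsingle 0)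
  · simpa [diagEntries] using hij
  · simpa [diagEntries] using hij
  · simpa [diagEntries] using hij
  · exact mul_mem (natCast_mem _ _) (hfix.four_apply hsim j ▸ hsingle 4)

theorem exists_fixesPlane (hN : N ≠ 0) {k : Matrix (Fin 5) (Fin 5) ℚ} (hk : IsSO0 N k) {c : ℚ}
    (hc : 0 < c) (hM : c • k = M.map (algebraMap ℤ ℚ)) (hcol : M.col 0 = Pi.single 0 1)
    (hrow : M.row 0 = Pi.single 0 1) :
    ∃ h, IsSO0 N h ∧ FixesPlane h ∧ k = diagMat c 1 * h := by
  have hSO : IsSO0 N (diagMat c⁻¹ 1 * k) := (isSO0_diagMat (inv_pos.2 hc) one_pos).mul hk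
  have hMe : ∀ i j, c * k i j = M i j := congrFun₂ hM
  have hentry : ∀ i j, (diagMat c⁻¹ 1 * k) i j = diagEntries c⁻¹ 1 i * k i j :=
    fun i j => by rw [diagMat, diagonal_mul]
  refine ⟨diagMat c⁻¹ 1 * k, hSO, .of_row_zero ?_ hSO.isSimilitude (funext fun i => ?_)
    (funext fun j => ?_), ?_⟩
  · exact mul_ne_zero two_ne_zero (Nat.cast_ne_zero.2 hN)
  · have hi : k i 0 = c⁻¹ * (Pi.single 0 1 : Fin 5 → ℤ) i :=
      (eq_inv_mul_iff_mul_eq₀ hc.ne').2 ((hMe i 0).trans (congrArg _ (congrFun hcol i)))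
    rw [col_apply, hentry, hi]
    fin_cases i <;> simp [diagEntries, hc.ne']
  · have hj : c * k 0 j = (Pi.single 0 1 : Fin 5 → ℤ) j :=
      (hMe 0 j).trans (congrArg _ (congrFun hrow j))
    rw [row_apply, hentry, show diagEntries c⁻¹ 1 0 = c from inv_inv c, hj]
    fin_cases j <;> simp
  · rw [← Matrix.mul_assoc, diagMat_mul_diagMat, mul_inv_cancel₀ hc.ne', one_mul, diagMat_one,
      Matrix.one_mul]

theorem exists_eq_diagMat (hN : Squarefree N) (hg : IsSO0 N g) :
    ∃ A B : Matrix (Fin 5) (Fin 5) ℤ, IsSO0 N A ∧ IsSO0 N B ∧ ∃ a b : ℕ+, b ∣ a ∧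
      A.map (algebraMap ℤ ℚ) * g * B.map (algebraMap ℤ ℚ) = diagMat a b := by
  obtain ⟨M, hM, hprim⟩ := exists_matDen_smul_eq_map g
  have ha : (0 : ℚ) < matDen g := Nat.cast_pos.2 (matDen_pos g)
  obtain ⟨A, B, hA, hB, hcol, hrow⟩ := exists_isSO0_mul_mul_isSO0 hN (matDen_pos g).ne'
    (isSimilitude_of_smul_eq_map hg.isSimilitude hM) hprim
  set k := A.map (algebraMap ℤ ℚ) * g * B.map (algebraMap ℤ ℚ) with hk
  have hkM : (matDen g : ℚ) • k = (A * M * B).map (algebraMap ℤ ℚ) := by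
    rw [hk, ← Matrix.smul_mul, ← Matrix.mul_smul, hM, Matrix.map_mul, Matrix.map_mul]
  have hkSO : IsSO0 N k := ((isSO0_map_iff.2 hA).mul hg).mul (isSO0_map_iff.2 hB)
  obtain ⟨h, hh, hfix, hkh⟩ := exists_fixesPlane hN.ne_zero hkSO ha hkM hcol hrow
  have hdvd : matDen h ∣ matDen g :=
    (hfix.matDen_dvd hh.isSimilitude _).trans
    (by rw [← hkh]; exact matDen_map_mul_mul_map_dvd A g B)
  obtain ⟨A', B', ⟨hA', hfix'⟩, hB', hD⟩ := exists_isSO0_mul_mul_eq_diagMat_one hN hh hfix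
  refine ⟨A' * A, B * B', hA'.mul hA, hB.mul hB', ⟨matDen g, matDen_pos g⟩,
    ⟨matDen h, matDen_pos h⟩, PNat.dvd_iff.2 hdvd, ?_⟩
  have hcomm := (hfix'.map (algebraMap ℤ ℚ)).mul_diagMat
    (isSO0_map_iff.2 hA').isSimilitude (matDen g)
  calc _ = A'.map (algebraMap ℤ ℚ) * k * B'.map (algebraMap ℤ ℚ) := by
        simp only [hk, Matrix.map_mul, Matrix.mul_assoc]
    _ = diagMat (matDen g) 1 * (A'.map (algebraMap ℤ ℚ) * h * B'.map (algebraMap ℤ ℚ)) := by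
        rw [hkh, ← Matrix.mul_assoc, hcomm]
        simp only [Matrix.mul_assoc]
    _ = diagMat (matDen g) (matDen h) := by
        rw [hD, diagMat_mul_diagMat, mul_one, one_mul]

end Classification

section DoubleCosets

variable {N : ℕ} {u v g : SpecialLinearGroup (Fin 5) ℚ}

theorem mem_GammaHat_iff : g ∈ GammaHat N ↔ g ∈ GHat N ∧ ∀ i j, g.1 i j ∈ intSubring := by
  refine and_congr_right fun _ => ⟨?_, fun h => ?_⟩
  · rintro ⟨M, rfl⟩ i j
    exact intCast_mem_intSubring (M.1 i j)
  · choose M hM using fun i j => mem_intSubring.1 (h i j)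
    have hMg : (of M).map (Int.castRingHom ℚ) = g.1 := Matrix.ext hM
    refine ⟨⟨of M, (Int.castRingHom ℚ).injective_int ?_⟩, Subtype.ext hMg⟩
    rw [RingHom.map_det, RingHom.mapMatrix_apply, hMg, g.2, map_one]

theorem IsSO0.exists_mem_GammaHat {A : Matrix (Fin 5) (Fin 5) ℤ} (hA : IsSO0 N A) :
    ∃ u ∈ GammaHat N, u.1 = A.map (algebraMap ℤ ℚ) :=
  have hAQ : IsSO0 N (A.map (algebraMap ℤ ℚ)) := isSO0_map_iff.2 hA
  ⟨⟨_, hAQ.det_eq_one⟩, mem_GammaHat_iff.2 ⟨mem_GHat_iff.2 hAQ, fun i j => ⟨A i j, rfl⟩⟩, rfl⟩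

theorem matDeg_of_mem_GammaHat (hu : u ∈ GammaHat N) : matDeg u.1 = 1 :=
  matDeg_eq_one (mem_GammaHat_iff.1 hu).2

theorem matDeg_mul_mul_of_mem_GammaHat (hu : u ∈ GammaHat N) (hv : v ∈ GammaHat N)
    (g : SpecialLinearGroup (Fin 5) ℚ) : matDeg (u * g * v).1 = matDeg g.1 := by
  have hle : ∀ {u v : SpecialLinearGroup (Fin 5) ℚ}, u ∈ GammaHat N → v ∈ GammaHat N →
      ∀ g, matDeg (u * g * v).1 ≤ matDeg g.1 := fun {u v} hu hv g =>
    calc matDeg (u.1 * g.1 * v.1) ≤ matDeg u.1 * matDeg g.1 * matDeg v.1 :=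
          (matDeg_mul_le _ _).trans (mul_le_mul_left (matDeg_mul_le _ _) _)
      _ = matDeg g.1 := by
          rw [matDeg_of_mem_GammaHat hu, matDeg_of_mem_GammaHat hv, one_mul, mul_one]
  refine (hle hu hv g).antisymm ?_
  have h := hle (inv_mem hu) (inv_mem hv) (u * g * v)
  rwa [show u⁻¹ * (u * g * v) * v⁻¹ = g by group] at h

theorem exists_normal_form (hN : Squarefree N) (hg : g ∈ GHat N) :
    ∃ u ∈ GammaHat N, ∃ v ∈ GammaHat N, ∃ a b : ℕ+, b ∣ a ∧ (u * g * v).1 = diagMat a b ∧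
      matDeg g.1 = toLex (a, a * b) := by
  obtain ⟨A, B, hA, hB, a, b, hab, hAB⟩ := exists_eq_diagMat hN (mem_GHat_iff.1 hg)
  obtain ⟨u, hu, huA⟩ := hA.exists_mem_GammaHat
  obtain ⟨v, hv, hvB⟩ := hB.exists_mem_GammaHat
  have huv : (u * g * v).1 = diagMat a b := by
    rw [← hAB, ← huA, ← hvB]
    rfl
  refine ⟨u, hu, v, hv, a, b, hab, huv, ?_⟩
  rw [← matDeg_mul_mul_of_mem_GammaHat hu hv, huv, matDeg_diagMat hab]

end DoubleCosets

section Iwasawa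

variable {N : ℕ} {h : Matrix (Fin 5) (Fin 5) ℚ}

theorem exists_primitive_smul {ι : Type*} [Finite ι] {v : ι → ℚ} (hv : v ≠ 0) :
    ∃ (c : ℚ) (w : ι → ℤ), c ≠ 0 ∧ Primitive w ∧ v = c • (algebraMap ℤ ℚ ∘ w) := by
  cases nonempty_fintype ι
  obtain ⟨i₀, -⟩ := Function.ne_iff.1 hv
  obtain ⟨b, hb⟩ := IsLocalization.exist_integer_multiples_of_finite (nonZeroDivisors ℤ) v
  choose f hf using hb
  obtain ⟨w, hw, hgcd⟩ := Finset.univ.extract_gcd f ⟨i₀, Finset.mem_univ i₀⟩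
  have hv' : v = ((b : ℚ)⁻¹ * Finset.univ.gcd f) • (algebraMap ℤ ℚ ∘ w) := funext fun i => by
    have hb0 : ((b : ℤ) : ℚ) ≠ 0 := Int.cast_ne_zero.2 (nonZeroDivisors.coe_ne_zero b)
    have hfi : (f i : ℚ) = b * v i := by simpa using hf i
    rw [Pi.smul_apply, smul_eq_mul, mul_assoc, eq_inv_mul_iff_mul_eq₀ hb0, ← hfi,
      hw i (Finset.mem_univ i), Int.cast_mul]
    rfl
  refine ⟨_, w, fun hc => hv ?_, fun k hk => ?_, hv'⟩
  · rw [hv', hc, zero_smul]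
  · exact isUnit_of_dvd_one (hgcd ▸ Finset.dvd_gcd fun i _ => hk i)

theorem exists_primitive_isotropic_smul {v : Fin 5 → ℚ} (hv : v ≠ 0) (hq : quad (N : ℚ) v = 0) :
    ∃ (c : ℚ) (w : Fin 5 → ℤ), c ≠ 0 ∧ Primitive w ∧ quad (N : ℤ) w = 0 ∧
      v = c • (algebraMap ℤ ℚ ∘ w) := by
  obtain ⟨c, w, hc, hw, rfl⟩ := exists_primitive_smul hv
  refine ⟨c, w, hc, hw, ?_, rfl⟩
  have hcw : c ^ 2 * ((quad (N : ℤ) w : ℤ) : ℚ) = 0 := by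
    rw [← hq]
    simp only [quad, Pi.smul_apply, Function.comp_apply, smul_eq_mul, eq_intCast]
    push_cast
    ring
  exact_mod_cast (mul_eq_zero_iff_left (pow_ne_zero 2 hc)).1 hcw

theorem quad_col_eq_zero (hh : IsSO0 N h) {j : Fin 5} (hj : quad (N : ℚ) (Pi.single j 1) = 0) :
    quad (N : ℚ) (h.col j) = 0 := by
  rw [← mulVec_single_one, hh.isSimilitude.quad_mulVec, hj, mul_zero]

theorem exists_isSO0_mul_apply_zero (hN : Squarefree N) (hh : IsSO0 N h) :
    ∃ A : Matrix (Fin 5) (Fin 5) ℤ, IsSO0 N A ∧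
      ∀ i, i ≠ 0 → (A.map (algebraMap ℤ ℚ) * h) i 0 = 0 := by
  have hcol : h.col 0 ≠ 0 := fun h0 =>
    one_ne_zero (hh.det_eq_one.symm.trans (det_eq_zero_of_column_eq_zero 0 (congrFun h0)))
  obtain ⟨c, w, -, hw, hq, hcw⟩ :=
    exists_primitive_isotropic_smul hcol (quad_col_eq_zero hh (by simp [quad]))
  obtain ⟨A, hA, hAw⟩ := orbitRel_single hN hw hq
  refine ⟨A, hA, fun i hi => ?_⟩
  have hAh : (A.map (algebraMap ℤ ℚ) * h).col 0 = c • (algebraMap ℤ ℚ ∘ (A *ᵥ w)) := by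
    rw [← mulVec_single_one, ← mulVec_mulVec, mulVec_single_one, hcw, mulVec_smul]
    exact congrArg _ (funext fun i => (RingHom.map_mulVec _ A w i).symm)
  rw [← col_apply (A.map (algebraMap ℤ ℚ) * h), hAh, hAw]
  simp [hi]

theorem exists_isSO0_fixesPlane_mulVec_eq (hN : Squarefree N) {v : Fin 5 → ℚ} (hv : v ≠ 0)
    (hq : quad (N : ℚ) v = 0) (hv0 : v 0 = 0) (hv4 : v 4 = 0) :
    ∃ (A : Matrix (Fin 5) (Fin 5) ℤ) (c : ℚ), IsSO0 N A ∧ FixesPlane A ∧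
      A.map (algebraMap ℤ ℚ) *ᵥ v = c • Pi.single 1 1 := by
  obtain ⟨c, w, hc, hw, hqw, rfl⟩ := exists_primitive_isotropic_smul hv hq
  have hw0 : w 0 = 0 := by simpa [hc] using hv0
  have hw4 : w 4 = 0 := by simpa [hc] using hv4
  obtain ⟨V, ε, hV, -, hwV⟩ :=
    exists_isAtkinLehner_smul_mulVec_single (Int.squarefree_natCast.2 hN) hw hqw hw0 hw4
  obtain ⟨A, hA, -, hAV⟩ := hV.isSO0.exists_inv
  have hAw : A *ᵥ w = ε • Pi.single 1 1 := by
    rw [hwV, mulVec_smul, mulVec_mulVec, hAV, one_mulVec]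
  have hAv : A.map (algebraMap ℤ ℚ) *ᵥ (algebraMap ℤ ℚ ∘ w) = algebraMap ℤ ℚ ∘ (A *ᵥ w) :=
    funext fun i => (RingHom.map_mulVec _ A w i).symm
  refine ⟨A, c * ε, hA, hV.fixesPlane.of_mul_eq_one hAV, ?_⟩
  rw [mulVec_smul, hAv, hAw]
  ext i
  simp [Pi.single_apply]

theorem exists_isSO0_mul_apply_one (hN : Squarefree N) (hh : IsSO0 N h)
    (h0 : ∀ i, i ≠ 0 → h i 0 = 0) :
    ∃ A : Matrix (Fin 5) (Fin 5) ℤ, (IsSO0 N A ∧ FixesPlane A) ∧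
      ∀ i, i ≠ 0 → i ≠ 1 → (A.map (algebraMap ℤ ℚ) * h) i 1 = 0 := by
  have hrel := hh.isSimilitude.column_relation
  have h44 : h 0 0 * h 4 4 = 1 := by simpa [gram, h0] using hrel 0 4
  have h00 : h 0 0 ≠ 0 := left_ne_zero_of_mul_eq_one h44
  have h41 : h 4 1 = 0 := by simpa [gram, h0, h00] using hrel 0 1
  have h43 : h 4 3 = 0 := by simpa [gram, h0, h00] using hrel 0 3
  set v : Fin 5 → ℚ := ![0, h 1 1, h 2 1, h 3 1, 0] with hv
  have hcol : h.col 1 = h 0 1 • Pi.single 0 1 + v := by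
    ext i
    fin_cases i <;> simp [hv, h41]
  have hq : quad (N : ℚ) v = 0 := by
    rw [← quad_col_eq_zero hh (j := 1) (by simp [quad])]
    simp [quad, hv, h41]
  have hv0 : v ≠ 0 := fun hv0 => by
    have h11 : h 1 1 = 0 := congrFun hv0 1
    have h21 : h 2 1 = 0 := congrFun hv0 2
    have h31 : h 3 1 = 0 := congrFun hv0 3
    simpa [gram, h11, h21, h31, h41, h43] using hrel 1 3
  obtain ⟨A, c, hA, hA', hAv⟩ := exists_isSO0_fixesPlane_mulVec_eq hN hv0 hq rfl rfl
  refine ⟨A, ⟨hA, hA'⟩, fun i hi0 hi1 => ?_⟩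
  rw [← col_apply (A.map (algebraMap ℤ ℚ) * h), ← mulVec_single_one, ← mulVec_mulVec,
    mulVec_single_one, hcol, mulVec_add, hAv, mulVec_smul, mulVec_single_one,
    (hA'.map _).col_zero]
  simp [hi0, hi1]

theorem isUpperTriangular_of_flag (hh : IsSO0 N h) (h0 : ∀ i, i ≠ 0 → h i 0 = 0)
    (h1 : ∀ i, i ≠ 0 → i ≠ 1 → h i 1 = 0) : h.IsUpperTriangular := by
  have hrel := hh.isSimilitude.column_relation
  have h44 : h 0 0 * h 4 4 = 1 := by simpa [gram, h0] using hrel 0 4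
  have h00 : h 0 0 ≠ 0 := left_ne_zero_of_mul_eq_one h44
  have h42 : h 4 2 = 0 := by simpa [gram, h0, h00] using hrel 0 2
  have h43 : h 4 3 = 0 := by simpa [gram, h0, h00] using hrel 0 3
  have h33 : h 1 1 * h 3 3 = 1 := by simpa [gram, h1, h43] using hrel 1 3
  have h32 : h 3 2 = 0 := by
    simpa [gram, h1, h42, left_ne_zero_of_mul_eq_one h33] using hrel 1 2
  intro i j hij
  fin_cases i <;> fin_cases j <;> simp_all

theorem exists_isSO0_mul_isUpperTriangular (hN : Squarefree N) (hh : IsSO0 N h) :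
    ∃ A : Matrix (Fin 5) (Fin 5) ℤ, IsSO0 N A ∧
      (A.map (algebraMap ℤ ℚ) * h).IsUpperTriangular := by
  obtain ⟨A, hA, h0⟩ := exists_isSO0_mul_apply_zero hN hh
  have hAh := (isSO0_map_iff.2 hA).mul hh
  obtain ⟨B, ⟨hB, hB'⟩, h1⟩ := exists_isSO0_mul_apply_one hN hAh h0
  refine ⟨B * A, hB.mul hA, ?_⟩
  rw [Matrix.map_mul, Matrix.mul_assoc]
  refine isUpperTriangular_of_flag ((isSO0_map_iff.2 hB).mul hAh) (fun i hi => ?_) h1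
  rw [Matrix.mul_apply, Finset.sum_eq_single 0 (fun j _ hj => by rw [h0 j hj, mul_zero]) (by simp),
    (hB'.map _).apply_zero, Pi.single_eq_of_ne hi, zero_mul]

end Iwasawa

section Extremal

variable {N : ℕ} {k n : Matrix (Fin 5) (Fin 5) ℚ}

theorem mem_intSubring_of_isUpperTriangular (hN : Squarefree N) (hn : IsSO0 N n)
    (hup : n.IsUpperTriangular) (h0 : ∀ j, n 0 j ∈ intSubring) (h1 : ∀ j, n 1 j ∈ intSubring)
    (h00 : (n 0 0)⁻¹ ∈ intSubring) (h11 : (n 1 1)⁻¹ ∈ intSubring) (i j : Fin 5) :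
    n i j ∈ intSubring := by
  have hN' : Squarefree (N : ℤ) := Int.squarefree_natCast.2 hN
  have hlow : ∀ i j, j < i → n i j = 0 := fun i j hij => hup hij
  have hrel := hn.isSimilitude.column_relation
  have hint : ∀ q : ℚ, N * q ^ 2 ∈ intSubring → q ∈ intSubring := fun q hq =>
    mem_intSubring_of_mul_sq hN' (by exact_mod_cast hq)
  have r04 : n 0 0 * n 4 4 = 1 := by simpa [gram, hlow] using hrel 0 4
  have r13 : n 1 1 * n 3 3 = 1 := by simpa [gram, hlow] using hrel 1 3
  have hquad : ∀ j, n 0 j * n 4 j + n 1 j * n 3 j - N * n 2 j ^ 2 =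
      quad (N : ℚ) (Pi.single j 1) := fun j => by
    rw [← one_mul (quad _ _), ← hn.isSimilitude.quad_mulVec, mulVec_single_one]
    rfl
  have r14 : n 0 1 * n 4 4 + n 1 1 * n 3 4 = 0 := by simpa [gram, hlow] using hrel 1 4
  have r22 : N * n 2 2 ^ 2 = N := by simpa [quad, hlow] using hquad 2
  have r33 : n 1 3 * n 3 3 = N * n 2 3 ^ 2 := by
    simpa [quad, hlow, sub_eq_zero] using hquad 3
  have r44 : n 0 4 * n 4 4 + n 1 4 * n 3 4 = N * n 2 4 ^ 2 := by
    simpa [quad, sub_eq_zero] using hquad 4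
  have h44 : n 4 4 ∈ intSubring := by rwa [eq_inv_of_mul_eq_one_right r04]
  have h33 : n 3 3 ∈ intSubring := by rwa [eq_inv_of_mul_eq_one_right r13]
  have h34 : n 3 4 ∈ intSubring := by
    have : n 3 4 = -(n 0 1 * n 4 4 * n 3 3) := by linear_combination n 3 3 * r14 - n 3 4 * r13
    exact this ▸ neg_mem (mul_mem (mul_mem (h0 1) h44) h33)
  have h22 := hint _ (r22.symm ▸ natCast_mem _ N)
  have h23 := hint _ (r33 ▸ mul_mem (h1 3) h33)
  have h24 := hint _ (r44 ▸ add_mem (mul_mem (h0 4) h44) (mul_mem (h1 4) h34))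
  obtain hij | hij := lt_or_ge j i
  · exact hlow i j hij ▸ zero_mem _
  · fin_cases i <;> fin_cases j <;> first | exact absurd hij (by decide) | simp_all

theorem mem_intSubring_of_mul_eq_diagMat (hN : Squarefree N) {a b a' b' : ℕ+}
    (hn : IsSO0 N n) (hup : n.IsUpperTriangular) (hkup : k.IsUpperTriangular)
    (hnk : n * k = diagMat a' b') (hk : matDen k ∣ a') (hk₂ : matDen (minors k) ∣ a' * b')
    (htn : matDen (diagMat a b * n) ∣ a) (htn₂ : matDen (minors (diagMat a b * n)) ∣ a * b)
    (i j : Fin 5) : n i j ∈ intSubring := by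
  have hlow : ∀ i j, j < i → n i j = 0 := fun i j hij => hup hij
  have hlow' : ∀ i j, j < i → k i j = 0 := fun i j hij => hkup hij
  have hdiag : ∀ i, n i i * k i i = diagEntries a' b' i := fun i => by
    rw [← diagonal_apply_eq (diagEntries (a' : ℚ) b'), ← diagMat, ← hnk, Matrix.mul_apply,
      Fintype.sum_eq_single i]
    intro j hj
    obtain hji | hij := hj.lt_or_gt
    · rw [hlow i j hji, zero_mul]
    · rw [hlow' j i hij, mul_zero]
  have hinv : (n 0 0)⁻¹ = a' * k 0 0 :=
    inv_eq_of_mul_eq_one_right (by rw [mul_left_comm, hdiag 0]; exact mul_inv_cancel₀ (by simp))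
  have hinv' : (n 1 1)⁻¹ = b' * k 1 1 :=
    inv_eq_of_mul_eq_one_right (by rw [mul_left_comm, hdiag 1]; exact mul_inv_cancel₀ (by simp))
  have h0 : ∀ j, n 0 j ∈ intSubring := fun j => by
    have := matDen_dvd_iff.1 htn 0 j
    rw [diagMat, diagonal_mul] at this
    simpa [diagEntries] using this
  have hmin : ∀ j, n 0 0 * n 1 j ∈ intSubring := fun j => by
    have := matDen_dvd_iff.1 htn₂ (0, 1) (0, j)
    simp_rw [minors_apply, diagMat, diagonal_mul, hlow 1 0 (by decide)] at this
    convert this using 1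
    simp only [diagEntries, cons_val]
    push_cast
    field_simp
    simp
  have h00 : (n 0 0)⁻¹ ∈ intSubring := hinv ▸ matDen_dvd_iff.1 hk 0 0
  have n00 : n 0 0 ≠ 0 := left_ne_zero_of_mul (by rw [hdiag]; simp [diagEntries])
  refine mem_intSubring_of_isUpperTriangular hN hn hup h0 (fun j => ?_) h00 ?_ i j
  · simpa [n00] using mul_mem h00 (hmin j)
  · have := mul_mem (h0 0) (matDen_dvd_iff.1 hk₂ (0, 1) (0, 1))
    rw [minors_apply, hlow' 1 0 (by decide), mul_zero, sub_zero, Nat.cast_mul, mul_mul_mul_comm,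
      ← hinv, ← hinv', mul_inv_cancel_left₀ n00] at this
    exact this

theorem isUpperTriangular_of_mul_eq_diagonal {m R : Type*} [Fintype m] [LinearOrder m] [CommRing R]
    {k n : Matrix m m R} {d : m → R} (hk : k.IsUpperTriangular) (hdet : IsUnit k.det)
    (hnk : n * k = diagonal d) : n.IsUpperTriangular := by
  let := k.invertibleOfIsUnitDet hdet
  rw [← mul_nonsing_inv_cancel_right k n hdet, hnk]
  exact (blockTriangular_diagonal d).mul (blockTriangular_inv_of_blockTriangular hk)

theorem mul_inv_mem_GammaHat (hN : Squarefree N) {t t' h : SpecialLinearGroup (Fin 5) ℚ}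
    {a b a' b' : ℕ+} (hab : b ∣ a) (hab' : b' ∣ a') (ht : t.1 = diagMat a b)
    (ht' : t'.1 = diagMat a' b') (hh : h ∈ GHat N) (hdeg : matDeg h.1 = matDeg t'.1)
    (hdeg_mul : matDeg (t * t' * h⁻¹).1 = matDeg t.1) : t' * h⁻¹ ∈ GammaHat N := by
  obtain ⟨A, hA, hup⟩ := exists_isSO0_mul_isUpperTriangular hN (mem_GHat_iff.1 hh)
  obtain ⟨u, hu, huA⟩ := hA.exists_mem_GammaHat
  set k := u * h with hk
  have hkG : k ∈ GHat N := mul_mem (mem_GammaHat_iff.1 hu).1 hh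
  have hkup : k.1.IsUpperTriangular := by
    change (u.1 * h.1).IsUpperTriangular
    rwa [huA]
  have ht'G : t' ∈ GHat N := by
    rw [mem_GHat_iff, ht']
    exact isSO0_diagMat (by simp) (by simp)
  set n := t' * k⁻¹ with hn
  have hnk : n.1 * k.1 = diagMat a' b' :=
    (congrArg Subtype.val (inv_mul_cancel_right t' k)).trans ht'
  have hnup : n.1.IsUpperTriangular :=
    isUpperTriangular_of_mul_eq_diagonal hkup (k.2.symm ▸ isUnit_one) hnk
  have hdeg_k : matDeg k.1 = toLex (a', a' * b') := by
    rw [← matDeg_diagMat hab', ← ht', ← hdeg, hk]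
    simpa using matDeg_mul_mul_of_mem_GammaHat hu (one_mem _) h
  have hdeg_tn : matDeg (t * n).1 = toLex (a, a * b) := by
    rw [← matDeg_diagMat hab, ← ht, ← hdeg_mul,
      show t * n = 1 * (t * t' * h⁻¹) * u⁻¹ by rw [hn, hk]; group]
    exact matDeg_mul_mul_of_mem_GammaHat (one_mem _) (inv_mem hu) _
  rw [matDeg_eq_toLex_iff] at hdeg_k hdeg_tn
  have hnG : n ∈ GHat N := mul_mem ht'G (inv_mem hkG)
  have hnint : n ∈ GammaHat N := mem_GammaHat_iff.2 ⟨hnG, mem_intSubring_of_mul_eq_diagMat hN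
    (mem_GHat_iff.1 hnG) hnup hkup hnk hdeg_k.1.dvd hdeg_k.2.dvd
    (by rw [← ht]; exact hdeg_tn.1.dvd) (by rw [← ht]; exact hdeg_tn.2.dvd)⟩
  rw [show t' * h⁻¹ = n * u by rw [hn, hk]; group]
  exact mul_mem hnint hu

end Extremal

section HeckeAlgebras

variable {N : ℕ}

theorem weylSub_mul_weylAdd_mul_diagMat (a b : ℚ) :
    weylSub * weylAdd * diagMat a b = diagMat a⁻¹ b⁻¹ * (weylSub * weylAdd) := by
  ext i j
  rw [diagMat, diagMat, mul_diagonal, diagonal_mul]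
  fin_cases i <;> fin_cases j <;>
    simp [weylSub, weylAdd, diagEntries, Matrix.mul_apply, Fin.sum_univ_five]

theorem exists_conj_eq_inv {t : SpecialLinearGroup (Fin 5) ℚ} {a b : ℚ} (ha : a ≠ 0) (hb : b ≠ 0)
    (ht : t.1 = diagMat a b) : ∃ w ∈ GammaHat N, w * t * w⁻¹ = t⁻¹ := by
  obtain ⟨w, hw, hw'⟩ := ((isSO0_weylSub (N := N)).mul isSO0_weylAdd).exists_mem_GammaHat
  have hww : w.1 = weylSub * weylAdd := by
    rw [hw', Matrix.map_mul]
    congr 1 <;> ext i j <;> fin_cases i <;> fin_cases j <;> simp [weylSub, weylAdd]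
  refine ⟨w, hw, ?_⟩
  rw [mul_inv_eq_iff_eq_mul, eq_inv_mul_iff_mul_eq]
  refine Subtype.ext ?_
  change t.1 * (w.1 * t.1) = w.1
  rw [ht, hww, weylSub_mul_weylAdd_mul_diagMat, ← Matrix.mul_assoc, diagMat_mul_diagMat,
    mul_inv_cancel₀ ha, mul_inv_cancel₀ hb, diagMat_one, Matrix.one_mul]

variable {H : Subgroup (SpecialLinearGroup (Fin 5) ℚ)}

theorem exists_normal_form_subgroupOf (hN : Squarefree N) (hΓ : GammaHat N ≤ H) (hH : H ≤ GHat N)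
    (g : H) : ∃ u ∈ (GammaHat N).subgroupOf H, ∃ v ∈ (GammaHat N).subgroupOf H, ∃ a b : ℕ+,
      b ∣ a ∧ (u * g * v).1.1 = diagMat a b ∧ matDeg g.1.1 = toLex (a, a * b) := by
  obtain ⟨u, hu, v, hv, h⟩ := exists_normal_form hN (hH g.2)
  exact ⟨⟨u, hΓ hu⟩, hu, ⟨v, hΓ hv⟩, hv, h⟩

theorem isDegree_matDeg (hN : Squarefree N) (hΓ : GammaHat N ≤ H) (hH : H ≤ GHat N) :
    IsDegree ((GammaHat N).subgroupOf H) fun g : H => matDeg g.1.1 where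
  deg_of_mem _ hu := matDeg_of_mem_GammaHat hu
  deg_mul_le g h := matDeg_mul_le g.1.1 h.1.1
  mem_doubleCoset g h hgh := by
    obtain ⟨u, hu, v, hv, a, b, -, ht, hg⟩ := exists_normal_form_subgroupOf hN hΓ hH g
    obtain ⟨u', hu', v', hv', a', b', -, ht', hh⟩ := exists_normal_form_subgroupOf hN hΓ hH h
    obtain ⟨rfl, hb⟩ := Prod.mk.inj (toLex.injective ((hh.symm.trans hgh).trans hg))
    obtain rfl := mul_left_cancel hb
    have huv : u * g * v = u' * h * v' := Subtype.ext (Subtype.ext (ht.trans ht'.symm))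
    refine DoubleCoset.mem_doubleCoset.2 ⟨u'⁻¹ * u, mul_mem (inv_mem hu') hu, v * v'⁻¹,
      mul_mem hv (inv_mem hv'), ?_⟩
    rw [show u'⁻¹ * u * g * (v * v'⁻¹) = u'⁻¹ * (u * g * v) * v'⁻¹ by group, huv]
    group
  exists_leading g h := by
    obtain ⟨u, -, v, -, a, b, hab, ht, hg⟩ := exists_normal_form_subgroupOf hN hΓ hH g
    obtain ⟨u', -, v', -, a', b', hab', ht', hh⟩ := exists_normal_form_subgroupOf hN hΓ hH h
    set t := u * g * v
    set t' := u' * h * v'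
    have htg : matDeg t.1.1 = matDeg g.1.1 := by rw [ht, hg, matDeg_diagMat hab]
    have hth : matDeg t'.1.1 = matDeg h.1.1 := by rw [ht', hh, matDeg_diagMat hab']
    refine ⟨t * t', t', ?_, hth, by rwa [mul_inv_cancel_right], fun d hd htd => ?_⟩
    · have htt : (t * t').1.1 = diagMat (a * a' : ℕ+) (b * b' : ℕ+) := by
        push_cast
        rw [← diagMat_mul_diagMat, ← ht, ← ht']
        rfl
      rw [htt, matDeg_diagMat (mul_dvd_mul hab hab'), hg, hh, ← toLex_mul, Prod.mk_mul_mk,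
        mul_mul_mul_comm]
    · exact coset_eq_iff.2 (mul_inv_mem_GammaHat hN hab hab' ht ht' (hH d.2) (hd.trans hth.symm)
        (htd.trans htg.symm))

theorem inv_mem_doubleCoset (hN : Squarefree N) (hΓ : GammaHat N ≤ H) (hH : H ≤ GHat N) (g : H) :
    g⁻¹ ∈ DoubleCoset.doubleCoset g ((GammaHat N).subgroupOf H : Set H)
      ((GammaHat N).subgroupOf H : Set H) := by
  obtain ⟨u, hu, v, hv, a, b, -, ht, -⟩ := exists_normal_form_subgroupOf hN hΓ hH g
  obtain ⟨w, hw, hwt⟩ := exists_conj_eq_inv (N := N) (by simp) (by simp) ht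
  lift w to H using hΓ hw
  have hwt' : w * (u * g * v) * w⁻¹ = (u * g * v)⁻¹ := Subtype.ext hwt
  refine DoubleCoset.mem_doubleCoset.2 ⟨v * w * u, mul_mem (mul_mem hv hw) hu, v * w⁻¹ * u,
    mul_mem (mul_mem hv (inv_mem hw)) hu, ?_⟩
  rw [show v * w * u * g * (v * w⁻¹ * u) = v * (w * (u * g * v) * w⁻¹) * u by group, hwt']
  group

theorem GammaHat_le_GHatPrimary (N p : ℕ) : GammaHat N ≤ GHatPrimary N p := by
  rintro _ ⟨hg, a, rfl⟩
  refine ⟨hg, 0, a.1, ?_⟩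
  rw [pow_zero, inv_one, one_smul]
  rfl

end HeckeAlgebras

section Generators

variable {N p : ℕ}

theorem d1_eq_diagMat (hp : p.Prime) : (d1 N p hp).1.1 = diagMat p 1 := by
  have hp0 : (p : ℚ) ≠ 0 := Nat.cast_ne_zero.2 hp.ne_zero
  change (p : ℚ)⁻¹ • diagonal ![1, (p : ℚ), p, p, (p : ℚ) ^ 2] = _
  rw [diagMat, ← diagonal_smul]
  congr 1
  ext i
  fin_cases i <;> simp [diagEntries, hp0]
  field_simp

theorem d2_eq_diagMat (hp : p.Prime) : (d2 N p hp).1.1 = diagMat p p := by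
  have hp0 : (p : ℚ) ≠ 0 := Nat.cast_ne_zero.2 hp.ne_zero
  change (p : ℚ)⁻¹ • diagonal ![1, 1, (p : ℚ), (p : ℚ) ^ 2, (p : ℚ) ^ 2] = _
  rw [diagMat, ← diagonal_smul]
  congr 1
  ext i
  fin_cases i <;> simp [diagEntries, hp0] <;> field_simp

/-- The degrees of `d1 N q` and `d2 N q`, the leading degrees of `T1 N q` and `T2 N q`. -/
def primaryDeg (q : ℕ+) : Fin 2 → ℕ+ ×ₗ ℕ+ := ![toLex (q, q), toLex (q, q * q)]

variable {q : ℕ+}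

theorem matDeg_d1 (hq : (q : ℕ).Prime) : matDeg (d1 N q hq).1.1 = primaryDeg q 0 := by
  have hdeg := matDeg_diagMat (one_dvd q)
  rw [PNat.one_coe, Nat.cast_one, mul_one, ← d1_eq_diagMat (N := N) hq] at hdeg
  exact hdeg

theorem matDeg_d2 (hq : (q : ℕ).Prime) : matDeg (d2 N q hq).1.1 = primaryDeg q 1 := by
  rw [d2_eq_diagMat, matDeg_diagMat (dvd_refl q)]
  rfl

theorem prod_primaryDeg_pow (q : ℕ+) (e : Fin 2 →₀ ℕ) :
    (e.prod fun i k => primaryDeg q i ^ k) = toLex (q ^ (e 0 + e 1), q ^ (e 0 + 2 * e 1)) := by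
  rw [Finsupp.prod_fintype _ _ fun i => pow_zero _, Fin.prod_univ_two]
  simp only [primaryDeg, cons_val_zero, cons_val_one, ← toLex_pow, ← toLex_mul, Prod.pow_mk,
    Prod.mk_mul_mk, ← pow_two, ← pow_mul, ← pow_add]

theorem injective_prod_primaryDeg_pow (hq : (q : ℕ).Prime) :
    Function.Injective fun e : Fin 2 →₀ ℕ => e.prod fun i k => primaryDeg q i ^ k := by
  intro e e' h
  simp only [prod_primaryDeg_pow] at h
  obtain ⟨h1, h2⟩ := Prod.mk.inj (toLex.injective h)
  have hinj : ∀ {m n : ℕ}, q ^ m = q ^ n → m = n := fun {m n} hmn =>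
    Nat.pow_right_injective hq.two_le
      (show (q : ℕ) ^ m = (q : ℕ) ^ n by exact_mod_cast hmn)
  have hsum := hinj h1
  have hsum' := hinj h2
  ext i
  fin_cases i <;> simp <;> omega

theorem matDen_dvd_of_mem_GHatPrimary (hp : p.Prime)
    {g : SpecialLinearGroup (Fin 5) ℚ} (hg : g ∈ GHatPrimary N p) : ∃ r, matDen g.1 ∣ p ^ r := by
  obtain ⟨-, r, M, hM⟩ := hg
  refine ⟨r, matDen_dvd_iff.2 fun i j => ⟨M i j, ?_⟩⟩
  rw [hM, Nat.cast_pow, Matrix.smul_apply, smul_eq_mul, mul_inv_cancel_left₀ (by simp [hp.ne_zero])]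
  rfl

theorem exists_prod_primaryDeg_pow_eq_matDeg (hN : Squarefree N) (hq : (q : ℕ).Prime)
    {g : SpecialLinearGroup (Fin 5) ℚ} (hg : g ∈ GHatPrimary N q) :
    ∃ e : Fin 2 →₀ ℕ, (e.prod fun i k => primaryDeg q i ^ k) = matDeg g.1 := by
  obtain ⟨u, -, v, -, a, b, hab, -, hdeg⟩ := exists_normal_form hN (GHatPrimary_le N q hg)
  obtain ⟨r, hr⟩ := matDen_dvd_of_mem_GHatPrimary hq hg
  rw [(matDeg_eq_toLex_iff.1 hdeg).1] at hr
  obtain ⟨i, -, ha⟩ := (Nat.dvd_prime_pow hq).1 hr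
  obtain ⟨j, hj, hb⟩ := (Nat.dvd_prime_pow hq).1 (ha ▸ PNat.dvd_iff.1 hab)
  obtain ⟨k, rfl⟩ := Nat.exists_eq_add_of_le' hj
  obtain rfl : a = q ^ (k + j) := PNat.eq (by rw [ha, PNat.pow_coe])
  obtain rfl : b = q ^ j := PNat.eq (by rw [hb, PNat.pow_coe])
  refine ⟨Finsupp.equivFunOnFinite.symm ![k, j], ?_⟩
  rw [prod_primaryDeg_pow, hdeg, ← pow_add, add_assoc, ← two_mul]
  rfl

end Generators

end HeckeSO

theorem theorem3 (N : ℕ) (hN : Squarefree N) :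
    (∀ (p : ℕ) (hp : p.Prime),
      ∃ φ : MvPolynomial (Fin 2) ℤ ≃+* HeckeSO.HeckePrimary N p,
        φ (MvPolynomial.X 0) = HeckeSO.T1 N p hp ∧
        φ (MvPolynomial.X 1) = HeckeSO.T2 N p hp) ∧
    NoZeroDivisors (HeckeSO.HeckeFull N) := by
  open HeckeSO in
  refine ⟨fun p hp => ?_, (isDegree_matDeg hN inf_le_left le_rfl).noZeroDivisors⟩
  lift p to ℕ+ using hp.pos
  have hΓ := GammaHat_le_GHatPrimary N p
  have hH := GHatPrimary_le N p
  have hdeg := isDegree_matDeg hN hΓ hH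
  have hlead := hdeg.hasLeading_doubleCosetElement (isHeckePair_of_le hH)
  have hT : ∀ i, HasLeading _ (![T1 N p hp, T2 N p hp] i) (primaryDeg p i) 1 :=
    Fin.forall_fin_two.2 ⟨matDeg_d1 (N := N) hp ▸ hlead (d1 N p hp),
      matDeg_d2 (N := N) hp ▸ hlead (d2 N p hp)⟩
  obtain ⟨φ, hφ⟩ := hdeg.exists_mvPolynomial_ringEquiv
    (mul_comm_of_inv_mem_doubleCoset (inv_mem_doubleCoset hN hΓ hH)) hT
    (injective_prod_primaryDeg_pow hp)
    fun g => exists_prod_primaryDeg_pow_eq_matDeg hN hp g.2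
  exact ⟨φ, hφ 0, hφ 1⟩
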